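/- **Setting.** Let $\mathbb X$ be a smooth, compact, connected Riemannian manifold with geodesic distance $\rho$, closed balls $B(x,r)=\{y:\rho(x,y)\le r\}$, and a Borel probability measure $\mu$; norms $\|\cdot\|_p$ are those of $L^p(\mu)$ (real or complex functions), and $\langle f_1,f_2\rangle=\int f_1f_2\,d\mu$. Let $\alpha>0$ and suppose $\mu(B(x,r))\le c\,r^\alpha$ for all $x\in\mathbb X$, $r>0$. Let $\{\phi_j\}_{j\ge0}$ be continuous real functions, orthonormal in $L^2(\mu)$, with $\phi_0\equiv1$, and let $0=\ell_0\le\ell_1\le\cdots$ with $\ell_j\to\infty$. Put $\Pi_L=\operatorname{span}\{\phi_j:\ell_j\le L\}$, $\Pi_\infty=\bigcup_{L\ge0}\Pi_L$, and let $X^p$ be the $L^p$-closure of $\Pi_\infty$. Let $K_t(x,y)=\sum_{j}e^{-\ell_j^2t}\phi_j(x)\phi_j(y)$. Assume that for all $t\in(0,1]$ and $x,y\in\mathbb X$ this series converges, $\int K_t(x,y)\,d\mu(y)=1$, $$|K_t(x,y)|\le c_1t^{-\alpha/2}e^{-c\rho(x,y)^2/t},\qquad |\partial_yK_t(x,y)|\le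 c_1t^{-\alpha/2-1}e^{-c\rho(x,y)^2/t},$$ where $K_t(x,\cdot)$ is differentiable and $\partial_y$ is any directional derivative at $y$ in a unit direction. Fix $A\ge2$ and assume that $\epsilon_L:=\sup_{\ell_j,\ell_k\le L}\inf_{Q\in\Pi_{AL}}\|\phi_j\phi_k-Q\|_\infty$ satisfies $L^{s}\epsilon_L\to0$ as $L\to\infty$ for every $s>0$. Let $S>\alpha$ be an integer, $\beta>0$, and let $b:\mathbb R\to\mathbb R$ be a mask of type $\beta$: $b$ is even and $C^S$, and $b(t)=(1+t)^{-\beta}F(\log t)$ for $t>0$, where $F$ is $C^S$, $F^{(k)}$ is bounded for $0\le k\le S$, and $F\ge m$ for some constant $m>0$. Let $G:\mathbb X\times\mathbb X\to\mathbb R$ be a kernel with expansion $\sum_jb(\ell_j)\phi_j(x)\phi_j(y)$, in the sense that for each $y$ the function $G(\cdot,y)$ is integrable and $\langle G(\cdot,y),\phi_k\rangle=b(\ell_k)\phi_k(y)$ for all $k$. For $P\in\Pi_\infty$ put $\mathcal D_GP=\sum_k\frac{\langle P,\phi_k\rangle}{b(\ell_k)}\phi_k$, and for a finite set $\mathcal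 C\subset\mathbb X$ and real weights $\mathbf W=\{w_y\}_{y\in\mathcal C}$ put $$\mathbb G(\mathcal C;\mathbf W;P)(x)=\sum_{y\in\mathcal C}w_y\,(\mathcal D_GP)(y)\,G(x,y).$$ For $r\ge0$, $W^p_r$ is the class of all $f\in X^p$ for which there is $(\Delta^*)^rf\in X^p$ with $\langle(\Delta^*)^rf,\phi_k\rangle=(1+\ell_k)^r\langle f,\phi_k\rangle$ for all $k$. For a finite set $\mathcal C$ with at least two points let $q(\mathcal C)=\min_{x\ne y\in\mathcal C}\rho(x,y)$ and $\delta(\mathcal C)=\sup_{x\in\mathbb X}\rho(x,\mathcal C)$; $\mathcal C$ is quasi-uniform if $\delta(\mathcal C)\le2q(\mathcal C)$. The weights $\mathbf W$ are $d$-regular with constant $\kappa$ if $\sum_{y\in\mathcal C\cap B(x,s)}|w_y|\le\kappa\{\mu(B(x,s))+d^\alpha\}$ for all $x\in\mathbb X$, $s>0$, and are quadrature weights of order $N$ if $\int P\,d\mu=\sum_{y\in\mathcal C}w_yP(y)$ for all $P\in\Pi_N$. **Theorem.** Let $1\le p\le\infty$, $1/p+1/p'=1$, $\beta>\alpha/p'$,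 $0\le r<\beta$, and let $\kappa_1,\kappa_2,\kappa,c>0$. There is a constant $c_1>0$, depending only on the setting (that is, on $\mathbb X,\rho,\mu,\alpha,\{\phi_j\},\{\ell_j\},A,S,\beta,b,G$), on $p,r$ and on $\kappa_1,\kappa_2,\kappa,c$, such that the following holds. Let $\mathcal C^*\subset\mathbb X$ be a quasi-uniform finite set, let $\kappa_1q(\mathcal C^*)^{-1}\le L\le\kappa_2q(\mathcal C^*)^{-1}$, and let $\mathbf W^*$ be quadrature weights of order $2AL$ corresponding to $\mathcal C^*$ that are $1/L$-regular with constant $\kappa$. If $f\in W^p_r$ and $P\in\Pi_L$ satisfies $\|f-P\|_p\le c\,L^{-r}\|(\Delta^*)^rf\|_p$, then $$\|f-\mathbb G(\mathcal C^*;\mathbf W^*;P)\|_p\le c_1L^{-r}\|(\Delta^*)^rf\|_p .$$ -/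

import Mathlib

open MeasureTheory Filter Topology Manifold Bundle
open scoped ENNReal ContDiff

noncomputable section

namespace Eignet

/-! ### The system `{φ_j}`, `{ℓ_j}` and diffusion polynomials -/

/-- `φ` is an orthonormal system of continuous real functions in `L²(μ)` with `φ₀ ≡ 1`, and
`ℓ` is a nondecreasing sequence with `ℓ₀ = 0` and `ℓ_j → ∞`. -/
structure IsSystem {M : Type*} [TopologicalSpace M] [MeasurableSpace M] (μ : Measure M)
    (φ : ℕ → M → ℝ) (ℓ : ℕ → ℝ) : Prop where
  continuous : ∀ j, Continuous (φ j)
  orthonormal : ∀ j k, ∫ x, φ j x * φ k x ∂μ = if j = k then 1 else 0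
  phi_zero : ∀ x, φ 0 x = 1
  ell_mono : Monotone ℓ
  ell_zero : ℓ 0 = 0
  ell_tendsto : Tendsto ℓ atTop atTop

/-- `Π_L`, the span over `𝕜` (`ℝ` or `ℂ`) of the functions `φ_j` with `ℓ_j ≤ L`. -/
def diffPoly (𝕜 : Type*) [RCLike 𝕜] {M : Type*} (φ : ℕ → M → ℝ) (ℓ : ℕ → ℝ) (L : ℝ) :
    Submodule 𝕜 (M → 𝕜) :=
  Submodule.span 𝕜 ((fun j x => (φ j x : 𝕜)) '' {j | ℓ j ≤ L})

/-- `⟨f, φ_k⟩ = ∫ f φ_k dμ`. -/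
def coeff {𝕜 : Type*} [RCLike 𝕜] {M : Type*} [MeasurableSpace M] (μ : Measure M)
    (φ : ℕ → M → ℝ) (f : M → 𝕜) (k : ℕ) : 𝕜 :=
  ∫ x, f x * (φ k x : 𝕜) ∂μ

/-- `dist(p; f, W) = inf {‖f - P‖_p : P ∈ W}`. -/
def distLp {𝕜 : Type*} [RCLike 𝕜] {M : Type*} [MeasurableSpace M] (μ : Measure M)
    (p : ℝ≥0∞) (f : M → 𝕜) (W : Set (M → 𝕜)) : ℝ≥0∞ :=
  ⨅ P ∈ W, eLpNorm (f - P) p μ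

/-- `f ∈ X^p`: `f` lies in the `L^p` closure of `Π_∞ = ⋃_{L ≥ 0} Π_L`. -/
def MemX {𝕜 : Type*} [RCLike 𝕜] {M : Type*} [MeasurableSpace M] (μ : Measure M)
    (φ : ℕ → M → ℝ) (ℓ : ℕ → ℝ) (p : ℝ≥0∞) (f : M → 𝕜) : Prop :=
  MemLp f p μ ∧
    distLp μ p f (⋃ L ∈ Set.Ici (0 : ℝ), (diffPoly 𝕜 φ ℓ L : Set (M → 𝕜))) = 0

/-- `f ∈ W^p_r` and `g = (Δ*)^r f`: both `f` and `g` belong to `X^p`, and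
`⟨g, φ_k⟩ = (1 + ℓ_k)^r ⟨f, φ_k⟩` for all `k`. -/
structure HasDeltaStar {𝕜 : Type*} [RCLike 𝕜] {M : Type*} [MeasurableSpace M] (μ : Measure M)
    (φ : ℕ → M → ℝ) (ℓ : ℕ → ℝ) (p : ℝ≥0∞) (r : ℝ) (f g : M → 𝕜) : Prop where
  mem : MemX μ φ ℓ p f
  mem_delta : MemX μ φ ℓ p g
  coeff_eq : ∀ k, coeff μ φ g k = (((1 + ℓ k) ^ r : ℝ) : 𝕜) * coeff μ φ f k

/-! ### Assumptions on the measure and on the system -/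

/-- `μ(B(x,r)) ≤ c r^α` for all `x` and all `r > 0` (closed balls). -/
def BallMeasureBound {M : Type*} [MetricSpace M] [MeasurableSpace M] (μ : Measure M)
    (α : ℝ) : Prop :=
  ∃ c > 0, ∀ (x : M) (r : ℝ), 0 < r → μ.real (Metric.closedBall x r) ≤ c * r ^ α

/-- The heat kernel `K_t(x,y) = ∑_j exp(-ℓ_j² t) φ_j(x) φ_j(y)`. -/
def heatKernel {M : Type*} (φ : ℕ → M → ℝ) (ℓ : ℕ → ℝ) (t : ℝ) (x y : M) : ℝ :=
  ∑' j, Real.exp (-(ℓ j) ^ 2 * t) * φ j x * φ j y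

/-- The series of the heat kernel converges and satisfies
`|K_t(x,y)| ≤ c₁ t^{-α/2} exp(-c ρ(x,y)²/t)` for `0 < t ≤ 1`. -/
def GaussianBound {M : Type*} [MetricSpace M] (φ : ℕ → M → ℝ) (ℓ : ℕ → ℝ) (α : ℝ) : Prop :=
  ∃ c > 0, ∃ c₁ > 0, ∀ t ∈ Set.Ioc (0 : ℝ) 1, ∀ x y : M,
    Summable (fun j => Real.exp (-(ℓ j) ^ 2 * t) * φ j x * φ j y) ∧
    |heatKernel φ ℓ t x y| ≤ c₁ * t ^ (-α / 2) * Real.exp (-c * dist x y ^ 2 / t)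

/-- `K_t(x, ·)` is differentiable and its first order directional derivatives at `y` in unit
directions (with respect to the Riemannian metric) are at most
`c₁ t^{-α/2-1} exp(-c ρ(x,y)²/t)` for `0 < t ≤ 1`. -/
def GaussianGradientBound {n : ℕ} {M : Type*} [MetricSpace M]
    [ChartedSpace (EuclideanSpace ℝ (Fin n)) M]
    [RiemannianBundle (fun x : M => TangentSpace 𝓘(ℝ, EuclideanSpace ℝ (Fin n)) x)]
    (φ : ℕ → M → ℝ) (ℓ : ℕ → ℝ) (α : ℝ) : Prop :=
  ∃ c > 0, ∃ c₁ > 0, ∀ t ∈ Set.Ioc (0 : ℝ) 1, ∀ x y : M,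
    MDifferentiableAt 𝓘(ℝ, EuclideanSpace ℝ (Fin n)) 𝓘(ℝ, ℝ) (heatKernel φ ℓ t x) y ∧
    ∀ v : TangentSpace 𝓘(ℝ, EuclideanSpace ℝ (Fin n)) y,
      |(show ℝ from mfderiv 𝓘(ℝ, EuclideanSpace ℝ (Fin n)) 𝓘(ℝ, ℝ) (heatKernel φ ℓ t x) y v)| ≤
        c₁ * t ^ (-α / 2 - 1) * Real.exp (-c * dist x y ^ 2 / t) * ‖v‖

/-- `ε_L = sup {dist(∞; φ_j φ_k, Π_{AL}) : ℓ_j, ℓ_k ≤ L}`. -/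
def productDefect (𝕜 : Type*) [RCLike 𝕜] {M : Type*} [MeasurableSpace M] (μ : Measure M)
    (φ : ℕ → M → ℝ) (ℓ : ℕ → ℝ) (A L : ℝ) : ℝ≥0∞ :=
  ⨆ (j : ℕ) (_ : ℓ j ≤ L) (k : ℕ) (_ : ℓ k ≤ L),
    distLp μ ∞ (fun x => ((φ j x * φ k x : ℝ) : 𝕜)) (diffPoly 𝕜 φ ℓ (A * L))

/-- The product assumption: `L^c ε_L → 0` as `L → ∞`, for every `c > 0`. -/
def ProductAssumption (𝕜 : Type*) [RCLike 𝕜] {M : Type*} [MeasurableSpace M] (μ : Measure M)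
    (φ : ℕ → M → ℝ) (ℓ : ℕ → ℝ) (A : ℝ) : Prop :=
  ∀ c : ℝ, 0 < c →
    Tendsto (fun L : ℝ => ENNReal.ofReal (L ^ c) * productDefect 𝕜 μ φ ℓ A L) atTop (𝓝 0)

/-! ### Data sets and weights -/

/-- The mesh norm `δ(C) = sup_x ρ(x, C)`. -/
def meshNorm {M : Type*} [MetricSpace M] (C : Finset M) : ℝ :=
  ⨆ x : M, Metric.infDist x (C : Set M)

/-- `δ(C) ≤ 2 q(C)`, where `q(C)` (`Set.infsep`) is the minimal distance between distinct points
of `C`; for it to be a minimum, `C` has at least two points. -/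
def IsQuasiUniform {M : Type*} [MetricSpace M] (C : Finset M) : Prop :=
  (C : Set M).Nontrivial ∧ meshNorm C ≤ 2 * (C : Set M).infsep

open scoped Classical in
/-- The weights `w_y`, `y ∈ C`, are `d`-regular with constant `κ`:
`∑_{y ∈ C ∩ B(x,r)} |w_y| ≤ κ (μ(B(x,r)) + d^α)` for all `x` and all `r > 0`. -/
def IsRegularWeights {M : Type*} [MetricSpace M] [MeasurableSpace M] (μ : Measure M)
    (α κ d : ℝ) (C : Finset M) (w : M → ℝ) : Prop :=
  ∀ (x : M) (r : ℝ), 0 < r →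
    ∑ y ∈ C with y ∈ Metric.closedBall x r, |w y| ≤
      κ * (μ.real (Metric.closedBall x r) + d ^ α)

/-- The weights `w_y`, `y ∈ C`, are quadrature weights of order `N`:
`∫ P dμ = ∑_{y ∈ C} w_y P(y)` for all `P ∈ Π_N`. -/
def IsQuadrature (𝕜 : Type*) [RCLike 𝕜] {M : Type*} [MeasurableSpace M] (μ : Measure M)
    (φ : ℕ → M → ℝ) (ℓ : ℕ → ℝ) (N : ℝ) (C : Finset M) (w : M → ℝ) : Prop :=
  ∀ P ∈ diffPoly 𝕜 φ ℓ N, ∫ x, P x ∂μ = ∑ y ∈ C, (w y : 𝕜) * P y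

/-! ### Masks, kernels and eignets -/

/-- `b` is a mask of type `β` (with smoothness order `S`): it is even and `C^S`, and
`b(t) = (1+t)^{-β} F(log t)` for `t > 0`, where `F` has bounded derivatives up to order `S` and
is bounded below by a positive constant. -/
def IsMask (S : ℕ) (β : ℝ) (b : ℝ → ℝ) : Prop :=
  Function.Even b ∧ ContDiff ℝ S b ∧
    ∃ F : ℝ → ℝ, ContDiff ℝ S F ∧
      (∀ t, 0 < t → b t = (1 + t) ^ (-β) * F (Real.log t)) ∧
      (∃ c, ∀ k ≤ S, ∀ u, |iteratedDeriv k F u| ≤ c) ∧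
      ∃ c₁ > 0, ∀ u, c₁ ≤ F u

/-- `G` admits the formal expansion `G(x,y) = ∑_j b(ℓ_j) φ_j(x) φ_j(y)`: for each `y`, the
function `G(·, y)` is integrable and its `k`-th coefficient is `b(ℓ_k) φ_k(y)`. (The series need
not converge pointwise.) -/
def HasExpansion {M : Type*} [MeasurableSpace M] (μ : Measure M)
    (φ : ℕ → M → ℝ) (ℓ : ℕ → ℝ) (b : ℝ → ℝ) (G : M → M → ℝ) : Prop :=
  ∀ y, Integrable (fun x => G x y) μ ∧ ∀ k, coeff μ φ (fun x => G x y) k = b (ℓ k) * φ k y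

/-- `𝒟_G P = ∑_k (⟨P, φ_k⟩ / b(ℓ_k)) φ_k`; the sum is finite if `P` is a diffusion polynomial. -/
def dG {𝕜 : Type*} [RCLike 𝕜] {M : Type*} [MeasurableSpace M] (μ : Measure M)
    (φ : ℕ → M → ℝ) (ℓ : ℕ → ℝ) (b : ℝ → ℝ) (P : M → 𝕜) (y : M) : 𝕜 :=
  ∑ᶠ k, coeff μ φ P k / (b (ℓ k) : 𝕜) * (φ k y : 𝕜)

/-- The eignet `𝔾(C; W; P, x) = ∑_{y ∈ C} w_y (𝒟_G P)(y) G(x,y)`. -/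
def eignet {𝕜 : Type*} [RCLike 𝕜] {M : Type*} [MeasurableSpace M] (μ : Measure M)
    (φ : ℕ → M → ℝ) (ℓ : ℕ → ℝ) (b : ℝ → ℝ) (G : M → M → ℝ) (C : Finset M) (w : M → ℝ)
    (P : M → 𝕜) (x : M) : 𝕜 :=
  ∑ y ∈ C, (w y : 𝕜) * dG μ φ ℓ b P y * (G x y : 𝕜)

end Eignet

end

/-!
The error is split as
`f - 𝔾(P) = (f - P) + (P - ∑ w_y (𝒟_G P)(y) G_L(·, y)) - ∑ w_y (𝒟_G P)(y) (G - G_L)(·, y)`, where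
`G_L` is the part of `G` with frequencies up to `2L`, cut off smoothly by `lowPass`. The first term is small by hypothesis.

*Middle term.* Up to the cut-off, `∫ (𝒟_G P)(y) G_L(x, y) dμ(y)` reproduces `P(x)`, because `𝒟_G`
divides the coefficients by `b` and `G_L` multiplies them back. The quadrature formula computes this
integral up to the defect of the product assumption, which is smaller than every negative
power of `L`. All other quantities grow at most polynomially: the number of frequencies up to `L`, `1/b`, the total
weight (`IsHeatSystem.exists_norm_sub_sum_lowPass_le`).

*Last term.* `G - G_L` is the sum of dyadic blocks with frequencies near `N = 2^j L`. If the kernel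
of a block is bounded in `L¹`, in either variable and with respect to `μ` as well as to the measure
`ν = ∑ |w_y| δ_y` (`weightMeasure`), then Schur's test for operators from `L^p(ν)` to `L^p(μ)` bounds
its contribution by `N^{-β} (N/L)^{α/p'} ‖𝒟_G P‖_{L^p(ν)}`. This is summable over the blocks exactly
because `β > α/p'` (`IsHeatSystem.exists_eLpNorm_tail_le`). The norm of the samples is
`‖𝒟_G P‖_{L^p(ν)} ≤ C L^{β-r} ‖(Δ*)^r f‖_p`, again by Schur's test for dyadic blocks, applied to the
multipliers `1/b` (acting on `P - f`) and `(1+t)^{-r}/b` (acting on `(Δ*)^r f`); this is where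
`r < β` is used (`IsHeatSystem.exists_eLpNorm_dG_le`).

*The `L¹` bounds for blocks.* Let `T` be the heat operator at a time comparable to `N^{-2}`, with
eigenvalues `lam_j ∈ [0, 1]`. A block is `m(T) T²` with `m` of class `C^S`, supported in a compact
subset of `(0, 1)` and bounded in `C^S` uniformly in `N`: here the form
`b(t) = (1+t)^{-β} F(log t)` enters, since `log t` only shifts by `log N` under rescaling. Expand
`m` in a Fourier series on `[0, 1]`. The operator `exp(2πi T) - 1` has a kernel with rapid decay on
the scale `1/N`, so its commutator with a power of the weight `1 + N ρ(x, ·)` is bounded by the next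
lower power, and `exp(2πi T)` is unitary on `L²`. By induction
`‖(1 + N ρ(x, ·))^k exp(2πi n T) T (x, ·)‖_2` grows at most like `(1 + |n|)^k N^{α/2}`
(`IsSmoothing.exists_eLpNorm_wt_pow_mul_kern_osc_nat_le`). As `S > α`, the Fourier coefficients of
`m` decay fast enough to sum these bounds for a weight of some order `s > α/2`; one more factor `T`
and the Cauchy-Schwarz inequality turn this into an `L¹` bound (`IsSmoothing.exists_lintegral_kern_le`,
`IsHeatSystem.exists_lintegral_block_le`).

The expansion of `G` is only known through its coefficients. It is identified with the sum of its
blocks because an integrable function with vanishing coefficients vanishes almost everywhere: the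
heat operators annihilate it and converge to the identity (`IsHeatSystem.ae_eq_zero_of_coeff_eq_zero`).
-/

namespace Eignet

set_option linter.unusedSectionVars false

/-! ### Uniformly smooth families and their Fourier series -/

/-- `UnifBdd U k f`: the functions `f i` are `k` times differentiable on `U`, and their derivatives of
order at most `k` are bounded on `U` uniformly in the index `i`. The recursion carries the
derivatives as an explicit family, so that `U` need not be open; the derivative of order `k` is
only required to be continuous when it is reached (at `k = 0`). -/
def UnifBdd {ι : Type*} (U : Set ℝ) : ℕ → (ι → ℝ → ℝ) → Prop
  | 0, f => (∀ i, ContinuousOn (f i) U) ∧ ∃ C, ∀ i, ∀ x ∈ U, |f i x| ≤ C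
  | k + 1, f => (∃ C, ∀ i, ∀ x ∈ U, |f i x| ≤ C) ∧
      ∃ f' : ι → ℝ → ℝ, (∀ i, ∀ x ∈ U, HasDerivAt (f i) (f' i x) x) ∧ UnifBdd U k f'

namespace UnifBdd

variable {ι : Type*} {U : Set ℝ} {k : ℕ} {f g : ι → ℝ → ℝ}

lemma bdd (h : UnifBdd U k f) : ∃ C, 0 ≤ C ∧ ∀ i, ∀ x ∈ U, |f i x| ≤ C := by
  have : ∃ C, ∀ i, ∀ x ∈ U, |f i x| ≤ C := by
    cases k with
    | zero => exact h.2
    | succ k => exact h.1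
  obtain ⟨C, hC⟩ := this
  exact ⟨max C 0, le_max_right _ _, fun i x hx => (hC i x hx).trans (le_max_left _ _)⟩

lemma continuousOn (h : UnifBdd U k f) (i : ι) : ContinuousOn (f i) U := by
  cases k with
  | zero => exact h.1 i
  | succ k =>
    obtain ⟨-, f', hf', -⟩ := h
    exact fun x hx => (hf' i x hx).continuousAt.continuousWithinAt

lemma of_succ (h : UnifBdd U (k + 1) f) : UnifBdd U k f := by
  induction k generalizing f with
  | zero => exact ⟨h.continuousOn, h.1⟩
  | succ k ih =>
    obtain ⟨hb, f', hf', h'⟩ := h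
    exact ⟨hb, f', hf', ih h'⟩

lemma mono {V : Set ℝ} (h : UnifBdd U k f) (hV : V ⊆ U) : UnifBdd V k f := by
  induction k generalizing f with
  | zero => exact ⟨fun j => (h.1 j).mono hV, h.2.imp fun C hC j x hx => hC j x (hV hx)⟩
  | succ k ih =>
    obtain ⟨hb, f', hf', h'⟩ := h
    exact ⟨hb.imp fun C hC j x hx => hC j x (hV hx), f', fun j x hx => hf' j x (hV hx), ih h'⟩

lemma congr (hU : IsOpen U) (h : UnifBdd U k f) (hfg : ∀ i, ∀ x ∈ U, g i x = f i x) :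
    UnifBdd U k g := by
  cases k with
  | zero =>
    exact ⟨fun i => (h.1 i).congr (hfg i), h.2.imp fun C hC i x hx => by
      rw [hfg i x hx]; exact hC i x hx⟩
  | succ k =>
    obtain ⟨hb, f', hf', h'⟩ := h
    refine ⟨hb.imp fun C hC i x hx => by rw [hfg i x hx]; exact hC i x hx, f', fun i x hx => ?_, h'⟩
    exact (hf' i x hx).congr_of_eventuallyEq
      (Filter.eventually_of_mem (hU.mem_nhds hx) (hfg i))

lemma add (hf : UnifBdd U k f) (hg : UnifBdd U k g) : UnifBdd U k (fun i x => f i x + g i x) := by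
  have hb : ∃ C, ∀ i, ∀ x ∈ U, |f i x + g i x| ≤ C := by
    obtain ⟨C, -, hC⟩ := hf.bdd
    obtain ⟨D, -, hD⟩ := hg.bdd
    exact ⟨C + D, fun i x hx => (abs_add_le _ _).trans (add_le_add (hC i x hx) (hD i x hx))⟩
  induction k generalizing f g with
  | zero => exact ⟨fun i => (hf.1 i).add (hg.1 i), hb⟩
  | succ k ih =>
    obtain ⟨-, f', hf', h1⟩ := hf
    obtain ⟨-, g', hg', h2⟩ := hg
    refine ⟨hb, _, fun i x hx => (hf' i x hx).add (hg' i x hx), ih h1 h2 ?_⟩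
    obtain ⟨C, -, hC⟩ := h1.bdd
    obtain ⟨D, -, hD⟩ := h2.bdd
    exact ⟨C + D, fun i x hx => (abs_add_le _ _).trans (add_le_add (hC i x hx) (hD i x hx))⟩

lemma mul (hf : UnifBdd U k f) (hg : UnifBdd U k g) : UnifBdd U k (fun i x => f i x * g i x) := by
  induction k generalizing f g with
  | zero =>
    obtain ⟨C, hC0, hC⟩ := hf.bdd
    obtain ⟨D, hD0, hD⟩ := hg.bdd
    exact ⟨fun i => (hf.1 i).mul (hg.1 i), C * D, fun i x hx => by
      rw [abs_mul]; exact mul_le_mul (hC i x hx) (hD i x hx) (abs_nonneg _) hC0⟩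
  | succ k ih =>
    obtain ⟨C, hC0, hC⟩ := hf.bdd
    obtain ⟨D, hD0, hD⟩ := hg.bdd
    have hf0 := hf.of_succ
    have hg0 := hg.of_succ
    obtain ⟨-, f', hf', h1⟩ := hf
    obtain ⟨-, g', hg', h2⟩ := hg
    exact ⟨⟨C * D, fun i x hx => by
      rw [abs_mul]; exact mul_le_mul (hC i x hx) (hD i x hx) (abs_nonneg _) hC0⟩,
      _, fun i x hx => (hf' i x hx).mul (hg' i x hx), (ih h1 hg0).add (ih hf0 h2)⟩

lemma const (c : ℝ) : UnifBdd U k (fun (_ : ι) _ => c) := by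
  induction k generalizing c with
  | zero => exact ⟨fun _ => continuousOn_const, |c|, fun _ _ _ => le_rfl⟩
  | succ k ih =>
    exact ⟨⟨|c|, fun _ _ _ => le_rfl⟩, fun _ _ => 0, fun _ x _ => hasDerivAt_const x c, ih 0⟩

/-- The chain rule: the inner family need not be bounded itself. -/
lemma comp {V : Set ℝ} {s s' : ι → ℝ → ℝ} (hf : UnifBdd V k f)
    (hs : ∀ i, ∀ x ∈ U, HasDerivAt (s i) (s' i x) x) (hsV : ∀ i, ∀ x ∈ U, s i x ∈ V)
    (hs' : UnifBdd U k s') : UnifBdd U k (fun i x => f i (s i x)) := by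
  induction k generalizing f with
  | zero =>
    refine ⟨fun i => (hf.1 i).comp (fun x hx => (hs i x hx).continuousAt.continuousWithinAt)
      (hsV i), hf.2.imp fun C hC i x hx => hC i _ (hsV i x hx)⟩
  | succ k ih =>
    obtain ⟨hb, f', hf', h'⟩ := hf
    exact ⟨hb.imp fun C hC i x hx => hC i _ (hsV i x hx), _,
      fun i x hx => (hf' i _ (hsV i x hx)).comp x (hs i x hx), (ih h' hs'.of_succ).mul hs'.of_succ⟩

lemma inv {c : ℝ} (hc : 0 < c) (hf : UnifBdd U k f) (hfc : ∀ i, ∀ x ∈ U, c ≤ f i x) :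
    UnifBdd U k (fun i x => (f i x)⁻¹) := by
  have hb : ∃ C, ∀ i, ∀ x ∈ U, |(f i x)⁻¹| ≤ C := ⟨c⁻¹, fun i x hx => by
    rw [abs_of_pos (inv_pos.2 (hc.trans_le (hfc i x hx)))]
    exact inv_anti₀ hc (hfc i x hx)⟩
  induction k with
  | zero =>
    exact ⟨fun i => (hf.1 i).inv₀ fun x hx => (hc.trans_le (hfc i x hx)).ne', hb⟩
  | succ k ih =>
    have h0 := ih hf.of_succ
    obtain ⟨-, f', hf', h'⟩ := hf
    refine ⟨hb, fun i x => (-1 * f' i x) * ((f i x)⁻¹ * (f i x)⁻¹), fun i x hx => ?_,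
      ((const (-1)).mul h').mul (h0.mul h0)⟩
    refine ((hf' i x hx).inv (hc.trans_le (hfc i x hx)).ne').congr_deriv ?_
    beta_reduce
    rw [div_eq_mul_inv, sq, mul_inv, neg_one_mul]

/-- Powers of a family with values in a compact subset of `(0, ∞)`. -/
lemma rpow {c : ℝ} (hc : 0 < c) (hf : UnifBdd U k f) (hfc : ∀ i, ∀ x ∈ U, c ≤ f i x) (γ : ℝ) :
    UnifBdd U k (fun i x => f i x ^ γ) := by
  obtain ⟨D, -, hD⟩ := hf.bdd
  have hb : ∀ γ : ℝ, ∃ C, ∀ i, ∀ x ∈ U, |f i x ^ γ| ≤ C := fun γ => ⟨max (c ^ γ) (D ^ γ),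
    fun i x hx => by
    have h0 := hc.trans_le (hfc i x hx)
    rw [abs_of_pos (Real.rpow_pos_of_pos h0 _)]
    rcases le_total 0 γ with h | h
    · exact (Real.rpow_le_rpow h0.le ((le_abs_self _).trans (hD i x hx)) h).trans (le_max_right _ _)
    · exact (Real.rpow_le_rpow_of_nonpos hc (hfc i x hx) h).trans (le_max_left _ _)⟩
  induction k generalizing γ with
  | zero =>
    exact ⟨fun i => (hf.1 i).rpow_const fun x hx => Or.inl (hc.trans_le (hfc i x hx)).ne', hb γ⟩
  | succ k ih =>
    have h0 := ih hf.of_succ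
    obtain ⟨-, f', hf', h'⟩ := hf
    refine ⟨hb γ, fun i x => f' i x * (γ * f i x ^ (γ - 1)), fun i x hx => ?_,
      h'.mul ((const γ).mul (h0 (γ - 1)))⟩
    have := (hf' i x hx).rpow_const (p := γ) (Or.inl (hc.trans_le (hfc i x hx)).ne')
    convert this using 1
    ring

/-- A single function that is `C^k` near a compact set. -/
lemma of_contDiffOn {V K : Set ℝ} (hV : IsOpen V) (hK : IsCompact K) (hKV : K ⊆ V)
    {φ : ℝ → ℝ} (hφ : ContDiffOn ℝ k φ V) : UnifBdd K k (fun _ : ι => φ) := by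
  have hb : ∀ {φ : ℝ → ℝ}, ContinuousOn φ V → ∃ C, ∀ _ : ι, ∀ x ∈ K, |φ x| ≤ C := fun h => by
    obtain ⟨C, hC⟩ := hK.exists_bound_of_continuousOn (h.mono hKV)
    exact ⟨C, fun _ x hx => hC x hx⟩
  induction k generalizing φ with
  | zero => exact ⟨fun _ => hφ.continuousOn.mono hKV, hb hφ.continuousOn⟩
  | succ k ih =>
    have h := hφ
    push_cast at h
    rw [contDiffOn_succ_iff_deriv_of_isOpen hV] at h
    refine ⟨hb hφ.continuousOn, fun _ => deriv φ, fun _ x hx => ?_, ih h.2.2⟩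
    exact (h.1.differentiableAt (hV.mem_nhds (hKV hx))).hasDerivAt

/-- A single function with globally bounded derivatives. -/
lemma of_iteratedDeriv {S : ℕ} {F : ℝ → ℝ} (hF : ContDiff ℝ S F)
    (hb : ∃ c, ∀ k ≤ S, ∀ u, |iteratedDeriv k F u| ≤ c) :
    UnifBdd Set.univ S (fun _ : ι => F) := by
  obtain ⟨c, hc⟩ := hb
  suffices h : ∀ k j, j + k = S → UnifBdd Set.univ k (fun _ : ι => iteratedDeriv j F) by
    simpa using h S 0 (by simp)
  intro k
  induction k with
  | zero =>
    intro j hj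
    refine ⟨fun _ => (hF.continuous_iteratedDeriv j ?_).continuousOn, c,
      fun _ x _ => hc j (by omega) x⟩
    exact_mod_cast (by omega : j ≤ S)
  | succ k ih =>
    intro j hj
    refine ⟨⟨c, fun _ x _ => hc j (by omega) x⟩, fun _ => iteratedDeriv (j + 1) F,
      fun _ x _ => ?_, ih (j + 1) (by omega)⟩
    rw [iteratedDeriv_succ]
    refine DifferentiableAt.hasDerivAt ?_
    exact (hF.differentiable_iteratedDeriv j (by exact_mod_cast (by omega : j < S))) x

/-- Extension by zero of a family supported in a closed subset of the open set `U`. -/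
lemma indicator {K : Set ℝ} (hU : IsOpen U) (hK : IsClosed K) (hKU : K ⊆ U) (hf : UnifBdd U k f)
    (h0 : ∀ i, ∀ x ∈ U, x ∉ K → f i x = 0) :
    UnifBdd Set.univ k (fun i => U.indicator (f i)) := by
  have hloc : ∀ i, ∀ x ∉ U, U.indicator (f i) =ᶠ[𝓝 x] fun _ => 0 := fun i x hx => by
    filter_upwards [hK.isOpen_compl.mem_nhds (fun h => hx (hKU h) : x ∈ Kᶜ)] with y hy
    by_cases hyU : y ∈ U
    · rw [Set.indicator_of_mem hyU, h0 i y hyU hy]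
    · exact Set.indicator_of_notMem hyU _
  have hb : ∃ C, ∀ i, ∀ x ∈ Set.univ, |U.indicator (f i) x| ≤ C := by
    obtain ⟨C, hC0, hC⟩ := hf.bdd
    refine ⟨C, fun i x _ => ?_⟩
    by_cases hx : x ∈ U
    · rw [Set.indicator_of_mem hx]; exact hC i x hx
    · rw [Set.indicator_of_notMem hx]; simpa using hC0
  have hin : ∀ i, ∀ x ∈ U, U.indicator (f i) =ᶠ[𝓝 x] f i := fun i x hx => by
    filter_upwards [hU.mem_nhds hx] with y hy
    exact Set.indicator_of_mem hy _
  induction k generalizing f with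
  | zero =>
    refine ⟨fun i => (continuous_iff_continuousAt.2 fun x => ?_).continuousOn, hb⟩
    by_cases hx : x ∈ U
    · exact ((hf.1 i).continuousAt (hU.mem_nhds hx)).congr (hin i x hx).symm
    · exact continuousAt_const.congr (hloc i x hx).symm
  | succ k ih =>
    obtain ⟨-, f', hf', h'⟩ := hf
    have h0' : ∀ i, ∀ x ∈ U, x ∉ K → f' i x = 0 := fun i x hx hxK => by
      refine (hf' i x hx).unique ?_
      refine (hasDerivAt_const x (0 : ℝ)).congr_of_eventuallyEq ?_
      filter_upwards [hU.mem_nhds hx, hK.isOpen_compl.mem_nhds hxK] with y hy hyK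
      exact h0 i y hy hyK
    refine ⟨hb, fun i => U.indicator (f' i), fun i x _ => ?_, ih h' h0' ?_ ?_ ?_⟩
    · beta_reduce
      by_cases hx : x ∈ U
      · rw [Set.indicator_of_mem hx]
        exact (hf' i x hx).congr_of_eventuallyEq (hin i x hx)
      · rw [Set.indicator_of_notMem hx]
        exact (hasDerivAt_const x (0 : ℝ)).congr_of_eventuallyEq (hloc i x hx)
    · intro i x hx
      filter_upwards [hK.isOpen_compl.mem_nhds (fun h => hx (hKU h) : x ∈ Kᶜ)] with y hy
      by_cases hyU : y ∈ U
      · rw [Set.indicator_of_mem hyU, h0' i y hyU hy]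
      · exact Set.indicator_of_notMem hyU _
    · obtain ⟨C, hC0, hC⟩ := h'.bdd
      refine ⟨C, fun i x _ => ?_⟩
      by_cases hx : x ∈ U
      · rw [Set.indicator_of_mem hx]; exact hC i x hx
      · rw [Set.indicator_of_notMem hx]; simpa using hC0
    · intro i x hx
      filter_upwards [hU.mem_nhds hx] with y hy
      exact Set.indicator_of_mem hy _

end UnifBdd

open Complex in
/-- Parseval's identity for the `k`-th derivative. -/
lemma UnifBdd.tsum_sq_fourierCoeffOn_le {ι : Type*} {K : Set ℝ} (hK : IsClosed K)
    (hK01 : K ⊆ Set.Ioo 0 1) {k : ℕ} {f : ι → ℝ → ℝ} (hf : UnifBdd Set.univ k f)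
    (h0 : ∀ i, ∀ x ∉ K, f i x = 0) :
    ∃ C, ∀ i, Summable (fun n : ℤ => |(n : ℝ)| ^ (2 * k) *
        ‖fourierCoeffOn zero_lt_one (fun x => (f i x : ℂ)) n‖ ^ 2) ∧
      ∑' n : ℤ, |(n : ℝ)| ^ (2 * k) *
        ‖fourierCoeffOn zero_lt_one (fun x => (f i x : ℂ)) n‖ ^ 2 ≤ C := by
  induction k generalizing f with
  | zero =>
    obtain ⟨C, hC0, hC⟩ := hf.bdd
    refine ⟨C ^ 2, fun i => ?_⟩
    have hcont : Continuous (fun x => (f i x : ℂ)) :=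
      continuous_ofReal.comp (continuousOn_univ.1 (hf.continuousOn i))
    have hmem : MemLp (fun x => (f i x : ℂ)) 2 (volume.restrict (Set.Ioc 0 1)) := by
      refine MemLp.of_bound hcont.aestronglyMeasurable C (Eventually.of_forall fun x => ?_)
      rw [norm_real]
      exact hC i x trivial
    have hs := hasSum_sq_fourierCoeffOn zero_lt_one hmem
    simp only [mul_zero, pow_zero, one_mul]
    refine ⟨hs.summable, hs.tsum_eq.trans_le ?_⟩
    rw [sub_zero, inv_one, one_smul]
    have hle : ∀ x : ℝ, ‖(f i x : ℂ)‖ ^ 2 ≤ C ^ 2 := fun x => by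
      rw [norm_real]
      exact pow_le_pow_left₀ (norm_nonneg _) (hC i x trivial) 2
    calc ∫ x in (0 : ℝ)..1, ‖(f i x : ℂ)‖ ^ 2 ≤ ∫ x in (0 : ℝ)..1, C ^ 2 :=
          intervalIntegral.integral_mono_on zero_le_one
            (Continuous.intervalIntegrable (by fun_prop) _ _)
            (Continuous.intervalIntegrable (by fun_prop) _ _) fun x _ => hle x
      _ = C ^ 2 := by simp
  | succ k ih =>
    obtain ⟨-, f', hf', h'⟩ := hf
    have h0' : ∀ i, ∀ x ∉ K, f' i x = 0 := fun i x hx => by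
      refine (hf' i x trivial).unique ((hasDerivAt_const x (0 : ℝ)).congr_of_eventuallyEq ?_)
      filter_upwards [hK.isOpen_compl.mem_nhds hx] with y hy
      exact h0 i y hy
    obtain ⟨C, hC⟩ := ih h' h0'
    refine ⟨C, fun i => ?_⟩
    have hle : ∀ n : ℤ, |(n : ℝ)| ^ (2 * (k + 1)) *
        ‖fourierCoeffOn zero_lt_one (fun x => (f i x : ℂ)) n‖ ^ 2 ≤ |(n : ℝ)| ^ (2 * k) *
        ‖fourierCoeffOn zero_lt_one (fun x => (f' i x : ℂ)) n‖ ^ 2 := by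
      intro n
      rcases eq_or_ne n 0 with rfl | hn
      · rw [Int.cast_zero, abs_zero, zero_pow (by omega), zero_mul]
        positivity
      have hcont : Continuous (fun x => (f' i x : ℂ)) :=
        continuous_ofReal.comp (continuousOn_univ.1 (h'.continuousOn i))
      have hF := fourierCoeffOn_of_hasDerivAt zero_lt_one hn (f := fun x => (f i x : ℂ))
        (f' := fun x => (f' i x : ℂ)) (fun x _ => (hf' i x trivial).ofReal_comp)
        (hcont.intervalIntegrable _ _)
      rw [h0 i 0 fun h => lt_irrefl _ (hK01 h).1, h0 i 1 fun h => lt_irrefl _ (hK01 h).2] at hF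
      have hn0 : (0 : ℝ) < |(n : ℝ)| := abs_pos.2 (by exact_mod_cast hn)
      have hnorm : ‖fourierCoeffOn zero_lt_one (fun x => (f i x : ℂ)) n‖ =
          (2 * Real.pi * |(n : ℝ)|)⁻¹ *
            ‖fourierCoeffOn zero_lt_one (fun x => (f' i x : ℂ)) n‖ := by
        rw [hF]
        simp [abs_of_pos Real.pi_pos]
      have hle1 : (2 * Real.pi * |(n : ℝ)|)⁻¹ ≤ |(n : ℝ)|⁻¹ := by
        refine inv_anti₀ hn0 ?_
        nlinarith [Real.pi_gt_three]
      rw [hnorm, mul_pow, mul_add, pow_add, mul_assoc]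
      refine mul_le_mul_of_nonneg_left ?_ (by positivity)
      rw [← mul_assoc, mul_one, ← mul_pow]
      refine mul_le_of_le_one_left (by positivity) (pow_le_one₀ (by positivity) ?_)
      calc |(n : ℝ)| * (2 * Real.pi * |(n : ℝ)|)⁻¹ ≤ |(n : ℝ)| * |(n : ℝ)|⁻¹ := by gcongr
        _ = 1 := mul_inv_cancel₀ hn0.ne'
    have hs := Summable.of_nonneg_of_le (fun n => by positivity) hle (hC i).1
    exact ⟨hs, (hs.tsum_le_tsum hle (hC i).1).trans (hC i).2⟩

lemma summable_one_add_abs_int_rpow {e : ℝ} (he : 1 < e) :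
    Summable (fun n : ℤ => (1 + |(n : ℝ)|) ^ (-e)) := by
  refine Summable.of_norm_bounded_eventually (Real.summable_abs_int_rpow he) ?_
  filter_upwards [(Set.finite_singleton (0 : ℤ)).compl_mem_cofinite] with n hn
  have hn0 : (0 : ℝ) < |(n : ℝ)| := abs_pos.2 (by exact_mod_cast hn)
  rw [Real.norm_of_nonneg (by positivity)]
  exact Real.rpow_le_rpow_of_nonpos hn0 (by linarith) (by linarith)

open Complex in
/-- A uniformly `C^S`-bounded family supported in a fixed compact subset of `(0, 1)` has Fourier series
on `[0, 1]` whose coefficients are summable against `(1 + |n|)^s`, uniformly over the family, for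
every `s < S - 1/2`. This is Parseval for the `S`-th derivative and the arithmetic-geometric mean
inequality. -/
theorem UnifBdd.exists_fourier_series {ι : Type*} {K : Set ℝ} (hK : IsClosed K)
    (hK01 : K ⊆ Set.Ioo 0 1) {S : ℕ} {f : ι → ℝ → ℝ} (hf : UnifBdd Set.univ S f)
    (h0 : ∀ i, ∀ x ∉ K, f i x = 0) {s : ℝ} (hs : 0 ≤ s) (hsS : s + 1 / 2 < S) :
    ∃ C, ∀ i, ∃ c : ℤ → ℂ, Summable (fun n : ℤ => ‖c n‖ * (1 + |(n : ℝ)|) ^ s) ∧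
      ∑' n : ℤ, ‖c n‖ * (1 + |(n : ℝ)|) ^ s ≤ C ∧
      ∀ u ∈ Set.Icc (0 : ℝ) 1, HasSum (fun n : ℤ => c n * exp (2 * Real.pi * I * n * u))
        (f i u : ℂ) := by
  obtain ⟨C₁, hC₁⟩ := hf.tsum_sq_fourierCoeffOn_le hK hK01 h0
  have hf0 : UnifBdd Set.univ 0 f := ⟨hf.continuousOn, by
    obtain ⟨C, -, hC⟩ := hf.bdd; exact ⟨C, hC⟩⟩
  obtain ⟨C₀, hC₀⟩ := hf0.tsum_sq_fourierCoeffOn_le hK hK01 h0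
  simp only [mul_zero, pow_zero, one_mul] at hC₀
  have he : 1 < 2 * (S : ℝ) - 2 * s := by linarith
  have hsum := summable_one_add_abs_int_rpow he
  refine ⟨2 ^ (2 * S) * (C₀ + C₁) + ∑' n : ℤ, (1 + |(n : ℝ)|) ^ (-(2 * (S : ℝ) - 2 * s)),
    fun i => ?_⟩
  set c : ℤ → ℂ := fourierCoeffOn zero_lt_one (fun x => (f i x : ℂ)) with hc
  have hle : ∀ n : ℤ, ‖c n‖ * (1 + |(n : ℝ)|) ^ s ≤
      2 ^ (2 * S) * (‖c n‖ ^ 2 + |(n : ℝ)| ^ (2 * S) * ‖c n‖ ^ 2) +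
        (1 + |(n : ℝ)|) ^ (-(2 * (S : ℝ) - 2 * s)) := by
    intro n
    have hpos : (0 : ℝ) < 1 + |(n : ℝ)| := by positivity
    have h1 : (1 + |(n : ℝ)|) ^ (2 * S) ≤ 2 ^ (2 * S) * (1 + |(n : ℝ)| ^ (2 * S)) := by
      rcases eq_or_ne n 0 with rfl | hn
      · simp only [Int.cast_zero, abs_zero, add_zero, one_pow]
        have : (1 : ℝ) ≤ 2 ^ (2 * S) := one_le_pow₀ one_le_two
        nlinarith [(by positivity : (0 : ℝ) ≤ 0 ^ (2 * S))]
      · have hn1 : (1 : ℝ) ≤ |(n : ℝ)| := by exact_mod_cast Int.one_le_abs hn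
        calc (1 + |(n : ℝ)|) ^ (2 * S) ≤ (2 * |(n : ℝ)|) ^ (2 * S) := by
              gcongr; linarith
          _ = 2 ^ (2 * S) * |(n : ℝ)| ^ (2 * S) := mul_pow _ _ _
          _ ≤ _ := by gcongr; linarith
    have h2 : (1 + |(n : ℝ)|) ^ s = (1 + |(n : ℝ)|) ^ S * (1 + |(n : ℝ)|) ^ (s - S) := by
      rw [← Real.rpow_natCast, ← Real.rpow_add hpos]; congr 1; ring
    have h3 : ((1 + |(n : ℝ)|) ^ (s - S)) ^ 2 = (1 + |(n : ℝ)|) ^ (-(2 * (S : ℝ) - 2 * s)) := by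
      rw [← Real.rpow_natCast, ← Real.rpow_mul hpos.le]; congr 1; push_cast; ring
    have h4 : ‖c n‖ ^ 2 * (1 + |(n : ℝ)|) ^ (2 * S) ≤
        ‖c n‖ ^ 2 * (2 ^ (2 * S) * (1 + |(n : ℝ)| ^ (2 * S))) := by gcongr
    rw [h2, ← h3]
    have h5 : ((1 + |(n : ℝ)|) ^ S) ^ 2 = (1 + |(n : ℝ)|) ^ (2 * S) := by ring
    nlinarith [sq_nonneg (‖c n‖ * (1 + |(n : ℝ)|) ^ S - (1 + |(n : ℝ)|) ^ (s - S)),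
      sq_nonneg (‖c n‖ * (1 + |(n : ℝ)|) ^ S), sq_nonneg ((1 + |(n : ℝ)|) ^ (s - S))]
  have hS1 := ((hC₀ i).1.add (hC₁ i).1).mul_left (2 ^ (2 * S))
  have hS2 := Summable.of_nonneg_of_le (fun n => by positivity) hle (hS1.add hsum)
  refine ⟨c, hS2, (hS2.tsum_le_tsum hle (hS1.add hsum)).trans ?_, fun u hu => ?_⟩
  · rw [hS1.tsum_add hsum, tsum_mul_left, (hC₀ i).1.tsum_add (hC₁ i).1]
    gcongr
    · exact (hC₀ i).2
    · exact (hC₁ i).2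
  · have hcont : Continuous (fun x => (f i x : ℂ)) :=
      continuous_ofReal.comp (continuousOn_univ.1 (hf.continuousOn i))
    have hf1 : f i 1 = 0 := h0 i 1 fun h => lt_irrefl _ (hK01 h).2
    have hf00 : f i 0 = 0 := h0 i 0 fun h => lt_irrefl _ (hK01 h).1
    have hlc : Continuous (AddCircle.liftIco (1 : ℝ) 0 (fun x => (f i x : ℂ))) := by
      refine AddCircle.liftIco_continuous ?_ hcont.continuousOn
      simp [hf1, hf00]
    have hcoef : ∀ n, fourierCoeff (AddCircle.liftIco (1 : ℝ) 0 (fun x => (f i x : ℂ))) n = c n := by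
      intro n
      rw [fourierCoeff_liftIco_eq, hc, fourierCoeffOn_eq_integral, fourierCoeffOn_eq_integral]
      simp
    have hsc : Summable c := by
      refine Summable.of_norm_bounded hS2 fun n => ?_
      refine le_mul_of_one_le_right (norm_nonneg _) (Real.one_le_rpow ?_ hs)
      linarith [abs_nonneg (n : ℝ)]
    have key := has_pointwise_sum_fourier_series_of_summable
      (f := ⟨_, hlc⟩) (by
        simp only [ContinuousMap.coe_mk]
        exact hsc.congr fun n => (hcoef n).symm) (u : AddCircle (1 : ℝ))
    simp only [ContinuousMap.coe_mk, hcoef] at key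
    have hval : AddCircle.liftIco (1 : ℝ) 0 (fun x => (f i x : ℂ)) (u : AddCircle (1 : ℝ)) =
        (f i u : ℂ) := by
      rcases hu.2.lt_or_eq with h | rfl
      · exact AddCircle.liftIco_coe_apply ⟨hu.1, by simpa using h⟩
      · rw [AddCircle.coe_period, ← AddCircle.coe_zero, AddCircle.liftIco_coe_apply (by simp), hf1, hf00]
    rw [hval] at key
    simpa only [fourier_coe_apply, ofReal_one, div_one, smul_eq_mul] using key

/-! ### Schur's test and integrals of decaying kernels -/

lemma eLpNorm_le_tsum {α E ι : Type*} [MeasurableSpace α] {μ : Measure α} [NormedAddCommGroup E]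
    [Denumerable ι] {f : ι → α → E} {F : α → E} (hf : ∀ i, AEStronglyMeasurable (f i) μ)
    (hF : ∀ᵐ x ∂μ, HasSum (fun i => f i x) (F x)) {p : ℝ≥0∞} (hp : 1 ≤ p) :
    eLpNorm F p μ ≤ ∑' i, eLpNorm (f i) p μ := by
  set e := (Denumerable.eqv ι).symm with he
  have hlim : ∀ᵐ x ∂μ, Tendsto (fun n => (∑ i ∈ Finset.range n, f (e i)) x) atTop (𝓝 (F x)) := by
    filter_upwards [hF] with x hx
    simpa using ((e.hasSum_iff (f := fun i => f i x)).2 hx).tendsto_sum_nat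
  refine (Lp.eLpNorm_lim_le_liminf_eLpNorm
    (fun n => Finset.aestronglyMeasurable_sum _ fun i _ => hf (e i)) F hlim).trans ?_
  refine liminf_le_of_le (by isBoundedDefault) fun b hb => ?_
  obtain ⟨n, hn⟩ := hb.exists
  refine hn.trans ((eLpNorm_sum_le (fun i _ => hf (e i)) hp).trans ?_)
  rw [← e.tsum_eq (fun i => eLpNorm (f i) p μ)]
  exact ENNReal.sum_le_tsum _

/-- **Schur's test** for a nonnegative kernel, in the form of a pointwise majorization. The two
measures and the exponent `p ∈ [1, ∞]` are arbitrary. -/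
theorem eLpNorm_le_of_schur {X Y E E' : Type*} [MeasurableSpace X] [MeasurableSpace Y]
    [NormedAddCommGroup E] [NormedAddCommGroup E'] {ν₁ : Measure X} {ν₂ : Measure Y} [SFinite ν₁]
    [SFinite ν₂] {k : X → Y → ℝ≥0∞} (hk : Measurable (Function.uncurry k)) {f : Y → E}
    (hf : AEStronglyMeasurable f ν₂) {F : X → E'} {a b : ℝ≥0∞}
    (ha : ∀ x, ∫⁻ y, k x y ∂ν₂ ≤ a) (hb : ∀ y, ∫⁻ x, k x y ∂ν₁ ≤ b)
    (hF : ∀ x, ‖F x‖ₑ ≤ ∫⁻ y, k x y * ‖f y‖ₑ ∂ν₂) {p p' : ℝ≥0∞} (hp : p.HolderConjugate p') :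
    eLpNorm F p ν₁ ≤ a ^ (p'⁻¹).toReal * b ^ (p⁻¹).toReal * eLpNorm f p ν₂ := by
  have hpp : p⁻¹ + p'⁻¹ = 1 := ENNReal.HolderConjugate.inv_add_inv_eq_one p p'
  have hp1 : 1 ≤ p := ENNReal.HolderConjugate.one_le p p'
  have hkx : ∀ x, Measurable (k x) := fun x => hk.comp measurable_prodMk_left
  have hfe : AEMeasurable (fun y => ‖f y‖ₑ) ν₂ := hf.enorm
  rcases eq_or_ne p ⊤ with rfl | hpt
  · rw [ENNReal.inv_top, zero_add] at hpp
    rw [hpp, ENNReal.inv_top, ENNReal.toReal_one, ENNReal.toReal_zero, ENNReal.rpow_one,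
      ENNReal.rpow_zero, mul_one]
    refine eLpNormEssSup_le_of_ae_enorm_bound (Eventually.of_forall fun x => ?_)
    calc ‖F x‖ₑ ≤ ∫⁻ y, k x y * ‖f y‖ₑ ∂ν₂ := hF x
      _ ≤ ∫⁻ y, k x y * eLpNorm f ⊤ ν₂ ∂ν₂ := by
        refine lintegral_mono_ae ?_
        rw [eLpNorm_exponent_top]
        filter_upwards [enorm_ae_le_eLpNormEssSup f ν₂] with y hy
        gcongr
      _ ≤ a * eLpNorm f ⊤ ν₂ := by
        rw [lintegral_mul_const _ (hkx x)]
        gcongr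
        exact ha x
  · have hp0 : p ≠ 0 := (zero_lt_one.trans_le hp1).ne'
    have hpr : 0 < p.toReal := ENNReal.toReal_pos hp0 hpt
    have hinv : (p⁻¹).toReal = p.toReal⁻¹ := ENNReal.toReal_inv p
    have hp't : p'⁻¹ ≠ ⊤ := ne_top_of_le_ne_top ENNReal.one_ne_top (hpp ▸ le_add_self)
    have hsum : (p'⁻¹).toReal + p.toReal⁻¹ = 1 := by
      rw [← hinv, ← ENNReal.toReal_add hp't (ENNReal.inv_ne_top.2 hp0), add_comm, hpp,
        ENNReal.toReal_one]
    set q := (p'⁻¹).toReal with hq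
    have hq0 : 0 ≤ q := ENNReal.toReal_nonneg
    rw [hinv]
    have hpt1 : ∀ x, ‖F x‖ₑ ^ p.toReal ≤
        a ^ (q * p.toReal) * ∫⁻ y, k x y * ‖f y‖ₑ ^ p.toReal ∂ν₂ := by
      intro x
      have h1 : ‖F x‖ₑ ≤ a ^ q * (∫⁻ y, k x y * ‖f y‖ₑ ^ p.toReal ∂ν₂) ^ p.toReal⁻¹ := by
        calc ‖F x‖ₑ ≤ ∫⁻ y, k x y * ‖f y‖ₑ ∂ν₂ := hF x
          _ = ∫⁻ y, k x y ^ q * (k x y * ‖f y‖ₑ ^ p.toReal) ^ p.toReal⁻¹ ∂ν₂ := by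
            refine lintegral_congr fun y => ?_
            rw [ENNReal.mul_rpow_of_nonneg _ _ (inv_nonneg.2 hpr.le), ← ENNReal.rpow_mul,
              mul_inv_cancel₀ hpr.ne', ENNReal.rpow_one, ← mul_assoc,
              ← ENNReal.rpow_add_of_nonneg _ _ hq0 (inv_nonneg.2 hpr.le), hsum, ENNReal.rpow_one]
          _ ≤ (∫⁻ y, k x y ∂ν₂) ^ q * (∫⁻ y, k x y * ‖f y‖ₑ ^ p.toReal ∂ν₂) ^ p.toReal⁻¹ :=
            ENNReal.lintegral_mul_norm_pow_le (hkx x).aemeasurable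
              ((hkx x).aemeasurable.mul (hfe.pow_const _)) hq0 (inv_nonneg.2 hpr.le) hsum
          _ ≤ _ := by gcongr; exact ha x
      calc ‖F x‖ₑ ^ p.toReal
          ≤ (a ^ q * (∫⁻ y, k x y * ‖f y‖ₑ ^ p.toReal ∂ν₂) ^ p.toReal⁻¹) ^ p.toReal := by gcongr
        _ = _ := by
          rw [ENNReal.mul_rpow_of_nonneg _ _ hpr.le, ← ENNReal.rpow_mul, ← ENNReal.rpow_mul,
            inv_mul_cancel₀ hpr.ne', ENNReal.rpow_one]
    rw [eLpNorm_eq_lintegral_rpow_enorm_toReal hp0 hpt, eLpNorm_eq_lintegral_rpow_enorm_toReal hp0 hpt,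
      one_div]
    have h2 : ∫⁻ x, ‖F x‖ₑ ^ p.toReal ∂ν₁ ≤
        a ^ (q * p.toReal) * (b * ∫⁻ y, ‖f y‖ₑ ^ p.toReal ∂ν₂) := by
      have hjm : AEMeasurable (Function.uncurry fun x y => k x y * ‖f y‖ₑ ^ p.toReal)
          (ν₁.prod ν₂) :=
        hk.aemeasurable.mul ((hfe.pow_const _).comp_snd)
      calc ∫⁻ x, ‖F x‖ₑ ^ p.toReal ∂ν₁
          ≤ ∫⁻ x, a ^ (q * p.toReal) * ∫⁻ y, k x y * ‖f y‖ₑ ^ p.toReal ∂ν₂ ∂ν₁ :=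
            lintegral_mono hpt1
        _ = a ^ (q * p.toReal) * ∫⁻ x, ∫⁻ y, k x y * ‖f y‖ₑ ^ p.toReal ∂ν₂ ∂ν₁ :=
            lintegral_const_mul'' _ hjm.lintegral_prod_right'
        _ = a ^ (q * p.toReal) * ∫⁻ y, ∫⁻ x, k x y * ‖f y‖ₑ ^ p.toReal ∂ν₁ ∂ν₂ := by
            rw [lintegral_lintegral_swap hjm]
        _ ≤ _ := by
            gcongr
            rw [← lintegral_const_mul'' _ (hfe.pow_const _)]
            refine lintegral_mono fun y => ?_
            have hky : Measurable fun x => k x y := hk.comp measurable_prodMk_right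
            rw [lintegral_mul_const _ hky]
            gcongr
            exact hb y
    calc (∫⁻ x, ‖F x‖ₑ ^ p.toReal ∂ν₁) ^ p.toReal⁻¹
        ≤ (a ^ (q * p.toReal) * (b * ∫⁻ y, ‖f y‖ₑ ^ p.toReal ∂ν₂)) ^ p.toReal⁻¹ := by
          gcongr
      _ = _ := by
          rw [ENNReal.mul_rpow_of_nonneg _ _ (inv_nonneg.2 hpr.le),
            ENNReal.mul_rpow_of_nonneg _ _ (inv_nonneg.2 hpr.le), ← ENNReal.rpow_mul,
            mul_assoc, mul_inv_cancel₀ hpr.ne', mul_one, mul_assoc]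

/-- The integral of `(1 + N ρ(x, y))^{-q}`, `q > α`, against a measure that has dimension `α` down to
the scale `d`, by a dyadic decomposition of the space around `x`. -/
lemma exists_lintegral_decay_le {α q : ℝ} (hα : 0 < α) (hq : α < q) :
    ∃ C, 0 < C ∧ ∀ {M : Type*} [MetricSpace M] [MeasurableSpace M] [BorelSpace M] (ν : Measure M)
      (D N d : ℝ) (x : M), 0 < D → 0 < N → 0 ≤ d →
      (∀ s, 0 < s → ν (Metric.closedBall x s) ≤ ENNReal.ofReal (D * (s ^ α + d ^ α))) →
      ∫⁻ y, ENNReal.ofReal ((1 + N * dist x y) ^ (-q)) ∂ν ≤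
        ENNReal.ofReal (C * D * (N ^ (-α) + d ^ α)) := by
  have hgeo : Summable fun m : ℕ => ((2 : ℝ) ^ (-(q - α))) ^ m :=
    summable_geometric_of_lt_one (by positivity)
      (Real.rpow_lt_one_of_one_lt_of_neg one_lt_two (by linarith))
  refine ⟨2 ^ q * ∑' m : ℕ, ((2 : ℝ) ^ (-(q - α))) ^ m, ?_, ?_⟩
  · have : 0 < ∑' m : ℕ, ((2 : ℝ) ^ (-(q - α))) ^ m :=
      hgeo.tsum_pos (fun m => by positivity) 0 (by positivity)
    positivity
  intro M _ _ _ ν D N d x hD hN hd hν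
  -- Layers `{y | N * dist x y ≤ 2 ^ m}`.
  have hpt : ∀ y, ENNReal.ofReal ((1 + N * dist x y) ^ (-q)) ≤ ∑' m : ℕ,
      (Metric.closedBall x (2 ^ m / N)).indicator
        (fun _ => ENNReal.ofReal (2 ^ q * (2 ^ (-q)) ^ m)) y := by
    intro y
    have hex : ∃ m : ℕ, N * dist x y ≤ 2 ^ m :=
      (pow_unbounded_of_one_lt (N * dist x y) one_lt_two).imp fun m hm => hm.le
    classical
    refine le_trans ?_ (ENNReal.le_tsum (Nat.find hex))
    have hmem : y ∈ Metric.closedBall x (2 ^ Nat.find hex / N) := by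
      rw [Metric.mem_closedBall, le_div_iff₀ hN, dist_comm, mul_comm]
      exact Nat.find_spec hex
    rw [Set.indicator_of_mem hmem]
    refine ENNReal.ofReal_le_ofReal ?_
    have hnn : 0 ≤ N * dist x y := by positivity
    rcases hm : Nat.find hex with _ | m
    · rw [pow_zero, mul_one]
      exact (Real.rpow_le_one_of_one_le_of_nonpos (by linarith) (by linarith)).trans
        (Real.one_le_rpow one_le_two (by linarith))
    · have hlt : ¬ N * dist x y ≤ 2 ^ m := Nat.find_min hex (by omega)
      push Not at hlt
      calc (1 + N * dist x y) ^ (-q) ≤ ((2 : ℝ) ^ m) ^ (-q) :=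
            Real.rpow_le_rpow_of_nonpos (by positivity) (by linarith) (by linarith)
        _ = 2 ^ q * (2 ^ (-q)) ^ (m + 1) := by
          rw [← Real.rpow_natCast, ← Real.rpow_natCast, ← Real.rpow_mul (by norm_num),
            ← Real.rpow_mul (by norm_num), ← Real.rpow_add (by norm_num)]
          congr 1; push_cast; ring
  calc ∫⁻ y, ENNReal.ofReal ((1 + N * dist x y) ^ (-q)) ∂ν
      ≤ ∫⁻ y, ∑' m : ℕ, (Metric.closedBall x (2 ^ m / N)).indicator
        (fun _ => ENNReal.ofReal (2 ^ q * (2 ^ (-q)) ^ m)) y ∂ν := lintegral_mono hpt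
    _ = ∑' m : ℕ, ENNReal.ofReal (2 ^ q * (2 ^ (-q)) ^ m) *
        ν (Metric.closedBall x (2 ^ m / N)) := by
      rw [lintegral_tsum fun m => (measurable_const.indicator
        Metric.isClosed_closedBall.measurableSet).aemeasurable]
      simp_rw [lintegral_indicator_const Metric.isClosed_closedBall.measurableSet]
    _ ≤ ∑' m : ℕ, ENNReal.ofReal (2 ^ q * ((2 : ℝ) ^ (-(q - α))) ^ m * (D * (N ^ (-α) + d ^ α))) := by
      refine ENNReal.tsum_le_tsum fun m => ?_
      refine (mul_le_mul_right (hν (2 ^ m / N) (by positivity)) _).trans ?_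
      rw [← ENNReal.ofReal_mul (by positivity)]
      refine ENNReal.ofReal_le_ofReal ?_
      have h1 : ((2 : ℝ) ^ m / N) ^ α = (2 ^ α) ^ m * N ^ (-α) := by
        rw [Real.div_rpow (by positivity) hN.le, Real.rpow_neg hN.le, div_eq_mul_inv,
          ← Real.rpow_natCast, ← Real.rpow_natCast, ← Real.rpow_mul (by norm_num),
          ← Real.rpow_mul (by norm_num), mul_comm α]
      have h2 : ((2 : ℝ) ^ (-(q - α))) ^ m = (2 ^ (-q)) ^ m * (2 ^ α) ^ m := by
        rw [← mul_pow, ← Real.rpow_add (by norm_num)]; congr 2; ring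
      have h3 : (1 : ℝ) ≤ (2 ^ α) ^ m := one_le_pow₀ (Real.one_le_rpow one_le_two hα.le)
      have h4 : d ^ α ≤ (2 ^ α) ^ m * d ^ α := le_mul_of_one_le_left (by positivity) h3
      rw [h1, h2]
      calc 2 ^ q * (2 ^ (-q)) ^ m * (D * ((2 ^ α) ^ m * N ^ (-α) + d ^ α))
          ≤ 2 ^ q * (2 ^ (-q)) ^ m * (D * ((2 ^ α) ^ m * N ^ (-α) + (2 ^ α) ^ m * d ^ α)) := by
            gcongr
        _ = _ := by ring
    _ = _ := by
      rw [← ENNReal.ofReal_tsum_of_nonneg (fun m => by positivity)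
        ((hgeo.mul_left _).mul_right _), tsum_mul_right, tsum_mul_left]
      congr 1; ring

/-! ### Kernels diagonal in an orthonormal system -/

/-- An orthonormal system together with eigenvalues `lam j ∈ [0, 1]` of a smoothing operator at the
scale `1/N`: its kernel `∑_j lam_j φ_j(x) φ_j(y)` has size `N^α` and decays like
`(1 + N ρ(x, y))^{-q}`. The constant `D` serves both for this bound and for the dimension bound of
`μ`. The heat operator at time `a / N²` is the example of interest. -/
structure IsSmoothing {M : Type*} [MetricSpace M] [MeasurableSpace M] (μ : Measure M)
    (φ : ℕ → M → ℝ) (α D q : ℝ) (lam : ℕ → ℝ) (N : ℝ) : Prop where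
  cont : ∀ j, Continuous (φ j)
  orth : ∀ j k, ∫ x, φ j x * φ k x ∂μ = if j = k then 1 else 0
  alpha_pos : 0 < α
  D_pos : 0 < D
  N_pos : 0 < N
  ball : ∀ (x : M) (s : ℝ), 0 < s → μ (Metric.closedBall x s) ≤ ENNReal.ofReal (D * s ^ α)
  nonneg : ∀ j, 0 ≤ lam j
  le_one : ∀ j, lam j ≤ 1
  summable : ∀ x y, Summable fun j => lam j * φ j x * φ j y
  bound : ∀ x y, |∑' j, lam j * φ j x * φ j y| ≤ D * N ^ α * (1 + N * dist x y) ^ (-q)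

/-- The kernel `∑_j a_j φ_j(x) φ_j(y)` of the operator that multiplies the `j`-th coefficient by
`a_j`. In use, either `|a_j|` is dominated by a multiple of `lam_j` or `a` has finite support, so
that the series converges absolutely. -/
noncomputable def kern {M : Type*} (φ : ℕ → M → ℝ) (a : ℕ → ℂ) (x y : M) : ℂ := ∑' j, a j * φ j x * φ j y

lemma kern_symm {M : Type*} (φ : ℕ → M → ℝ) (a : ℕ → ℂ) (x y : M) :
    kern φ a x y = kern φ a y x := tsum_congr fun j => by ring

namespace IsSmoothing

variable {M : Type*} [MetricSpace M] [CompactSpace M] [MeasurableSpace M] [BorelSpace M]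
  {μ : Measure M} [IsProbabilityMeasure μ] {φ : ℕ → M → ℝ} {α D q : ℝ} {lam : ℕ → ℝ} {N : ℝ}

lemma bound_diag (h : IsSmoothing μ φ α D q lam N) (x : M) :
    ∑' j, lam j * φ j x * φ j x ≤ D * N ^ α := by
  have := (le_abs_self _).trans (h.bound x x)
  simpa using this

/-- Off-diagonal sums are controlled by the diagonal ones. -/
lemma summable_abs (h : IsSmoothing μ φ α D q lam N) (x y : M) :
    Summable (fun j => lam j * (|φ j x| * |φ j y|)) ∧
      ∑' j, lam j * (|φ j x| * |φ j y|) ≤ D * N ^ α := by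
  have hle : ∀ j, lam j * (|φ j x| * |φ j y|) ≤
      (1 / 2) * (lam j * φ j x * φ j x + lam j * φ j y * φ j y) := fun j => by
    have h1 : |φ j x| * |φ j y| ≤ (1 / 2) * (φ j x * φ j x + φ j y * φ j y) := by
      nlinarith [sq_nonneg (|φ j x| - |φ j y|), abs_mul_abs_self (φ j x), abs_mul_abs_self (φ j y)]
    calc _ ≤ lam j * ((1 / 2) * (φ j x * φ j x + φ j y * φ j y)) :=
          mul_le_mul_of_nonneg_left h1 (h.nonneg j)
      _ = _ := by ring
  have hs := ((h.summable x x).add (h.summable y y)).mul_left (1 / 2)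
  have hs' := Summable.of_nonneg_of_le
    (fun j => mul_nonneg (h.nonneg j) (by positivity)) hle hs
  refine ⟨hs', (hs'.tsum_le_tsum hle hs).trans ?_⟩
  rw [tsum_mul_left, (h.summable x x).tsum_add (h.summable y y)]
  linarith [h.bound_diag x, h.bound_diag y]

lemma hasSum_kern (h : IsSmoothing μ φ α D q lam N) {a : ℕ → ℂ} {Λ : ℝ}
    (ha : ∀ j, ‖a j‖ ≤ Λ * lam j) (x y : M) :
    HasSum (fun j => a j * φ j x * φ j y) (kern φ a x y) ∧ ‖kern φ a x y‖ ≤ |Λ| * (D * N ^ α) := by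
  have hle : ∀ j, ‖a j * φ j x * φ j y‖ ≤ Λ * (lam j * (|φ j x| * |φ j y|)) := fun j => by
    rw [norm_mul, norm_mul, Complex.norm_real, Complex.norm_real, mul_assoc, ← mul_assoc Λ]
    exact mul_le_mul_of_nonneg_right (ha j) (by positivity)
  obtain ⟨hs, hb⟩ := h.summable_abs x y
  refine ⟨(Summable.of_norm_bounded (hs.mul_left Λ) hle).hasSum, ?_⟩
  have hle' : ∀ j, ‖a j * φ j x * φ j y‖ ≤ |Λ| * (lam j * (|φ j x| * |φ j y|)) := fun j =>
    (hle j).trans (mul_le_mul_of_nonneg_right (le_abs_self _)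
      (mul_nonneg (h.nonneg j) (by positivity)))
  refine (tsum_of_norm_bounded (hs.mul_left |Λ|).hasSum hle').trans ?_
  rw [tsum_mul_left]
  gcongr

lemma measurable_kern (h : IsSmoothing μ φ α D q lam N) {a : ℕ → ℂ} {Λ : ℝ}
    (ha : ∀ j, ‖a j‖ ≤ Λ * lam j) : Measurable (Function.uncurry (kern φ a)) := by
  refine measurable_of_tendsto_metrizable (f := fun n (z : M × M) =>
    ∑ j ∈ Finset.range n, a j * φ j z.1 * φ j z.2) (fun n => ?_) ?_
  · refine Finset.measurable_sum _ fun j _ => ?_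
    have := (h.cont j).measurable
    fun_prop
  · exact tendsto_pi_nhds.2 fun z => (h.hasSum_kern ha z.1 z.2).1.tendsto_sum_nat

lemma integrable_phi_mul (h : IsSmoothing μ φ α D q lam N) {f : M → ℂ} (hf : Integrable f μ)
    (j : ℕ) : Integrable (fun y => (φ j y : ℂ) * f y) μ := by
  obtain ⟨C, hC⟩ := isCompact_univ.exists_bound_of_continuousOn (h.cont j).continuousOn
  refine hf.bdd_mul (c := C) (Complex.measurable_ofReal.comp (h.cont j).measurable).aestronglyMeasurable
    (Eventually.of_forall fun y => ?_)
  simpa using hC y trivial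

lemma hasSum_integral_kern_mul (h : IsSmoothing μ φ α D q lam N) {a : ℕ → ℂ} {Λ : ℝ}
    (ha : ∀ j, ‖a j‖ ≤ Λ * lam j) {f : M → ℂ} (hf : Integrable f μ) (x : M) :
    HasSum (fun j => a j * φ j x * ∫ y, φ j y * f y ∂μ) (∫ y, kern φ a x y * f y ∂μ) := by
  have hi : ∀ j, Integrable (fun y => a j * φ j x * (φ j y * f y)) μ := fun j =>
    (h.integrable_phi_mul hf j).const_mul _
  have hΛ : 0 ≤ |Λ| * (D * N ^ α) := by
    have := h.D_pos; have := h.N_pos; positivity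
  have hsum : Summable fun j => ∫ y, ‖a j * φ j x * (φ j y * f y)‖ ∂μ := by
    refine summable_of_sum_le (c := |Λ| * (D * N ^ α) * ∫ y, ‖f y‖ ∂μ)
      (fun j => integral_nonneg fun y => norm_nonneg _) fun s => ?_
    rw [← integral_finsetSum _ fun j _ => (hi j).norm, ← integral_const_mul]
    refine integral_mono (integrable_finsetSum _ fun j _ => (hi j).norm)
      (hf.norm.const_mul _) fun y => ?_
    beta_reduce
    calc ∑ j ∈ s, ‖a j * φ j x * (φ j y * f y)‖
        ≤ ∑ j ∈ s, |Λ| * (lam j * (|φ j x| * |φ j y|)) * ‖f y‖ := by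
          refine Finset.sum_le_sum fun j _ => ?_
          rw [norm_mul, norm_mul, norm_mul, Complex.norm_real, Complex.norm_real,
            Real.norm_eq_abs, Real.norm_eq_abs, ← mul_assoc, ]
          have h1 : ‖a j‖ ≤ |Λ| * lam j :=
            (ha j).trans (mul_le_mul_of_nonneg_right (le_abs_self _) (h.nonneg j))
          calc ‖a j‖ * |φ j x| * |φ j y| * ‖f y‖
              ≤ |Λ| * lam j * |φ j x| * |φ j y| * ‖f y‖ := by gcongr
            _ = _ := by ring
      _ = |Λ| * (∑ j ∈ s, lam j * (|φ j x| * |φ j y|)) * ‖f y‖ := by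
          rw [← Finset.sum_mul, Finset.mul_sum]
      _ ≤ |Λ| * (D * N ^ α) * ‖f y‖ := by
          gcongr
          exact ((h.summable_abs x y).1.sum_le_tsum s
            fun j _ => mul_nonneg (h.nonneg j) (by positivity)).trans (h.summable_abs x y).2
  have := hasSum_integral_of_summable_integral_norm hi hsum
  simp_rw [integral_const_mul] at this
  have e : ∫ y, kern φ a x y * f y ∂μ =
      ∫ y, ∑' j, a j * φ j x * (φ j y * f y) ∂μ := by
    refine integral_congr_ae (Eventually.of_forall fun y => ?_)
    beta_reduce
    rw [← (h.hasSum_kern ha x y).1.tsum_eq, ← tsum_mul_right]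
    exact tsum_congr fun j => by ring
  rwa [e]

lemma orth_complex (h : IsSmoothing μ φ α D q lam N) (j k : ℕ) :
    ∫ x, (φ j x : ℂ) * φ k x ∂μ = if j = k then 1 else 0 := by
  have := h.orth j k
  have h2 : ∫ x, (φ j x : ℂ) * φ k x ∂μ = ((∫ x, φ j x * φ k x ∂μ : ℝ) : ℂ) := by
    rw [← integral_complex_ofReal]; simp
  rw [h2, this]
  split_ifs <;> simp

lemma integrable_phi (h : IsSmoothing μ φ α D q lam N) (j : ℕ) :
    Integrable (fun y => (φ j y : ℂ)) μ := by
  simpa using h.integrable_phi_mul (integrable_const (1 : ℂ)) j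

lemma integral_kern_mul_phi (h : IsSmoothing μ φ α D q lam N) {a : ℕ → ℂ} {Λ : ℝ}
    (ha : ∀ j, ‖a j‖ ≤ Λ * lam j) (x : M) (k : ℕ) :
    ∫ y, kern φ a x y * φ k y ∂μ = a k * φ k x := by
  refine (h.hasSum_integral_kern_mul ha (h.integrable_phi k) x).unique ?_
  convert hasSum_single (f := fun j => a j * φ j x * ∫ y, (φ j y : ℂ) * φ k y ∂μ) k
    (fun j hj => by rw [h.orth_complex, if_neg hj, mul_zero]) using 1
  rw [h.orth_complex, if_pos rfl, mul_one]

lemma integrable_kern (h : IsSmoothing μ φ α D q lam N) {a : ℕ → ℂ} {Λ : ℝ}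
    (ha : ∀ j, ‖a j‖ ≤ Λ * lam j) (x : M) : Integrable (kern φ a x) μ :=
  Integrable.of_bound ((h.measurable_kern ha).comp measurable_prodMk_left).aestronglyMeasurable
    (|Λ| * (D * N ^ α)) (Eventually.of_forall fun y => (h.hasSum_kern ha x y).2)

/-- Kernels compose like the operators they represent. -/
lemma integral_kern_mul_kern (h : IsSmoothing μ φ α D q lam N) {a b : ℕ → ℂ} {Λ Λ' : ℝ}
    (ha : ∀ j, ‖a j‖ ≤ Λ * lam j) (hb : ∀ j, ‖b j‖ ≤ Λ' * lam j) (x y : M) :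
    ∫ z, kern φ a x z * kern φ b z y ∂μ = kern φ (fun j => a j * b j) x y := by
  simp_rw [kern_symm φ b _ y]
  rw [← (h.hasSum_integral_kern_mul ha (h.integrable_kern hb y) x).tsum_eq, kern]
  refine tsum_congr fun j => ?_
  have := h.integral_kern_mul_phi hb y j
  simp_rw [mul_comm (φ j _ : ℂ), this]
  ring

/-- By normalization in `L²`, since `|φ| ≤ (1 + φ²)/2`. -/
lemma integral_abs_phi_le (h : IsSmoothing μ φ α D q lam N) (j : ℕ) : ∫ y, |φ j y| ∂μ ≤ 1 := by
  obtain ⟨C, hC⟩ := isCompact_univ.exists_bound_of_continuousOn (h.cont j).continuousOn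
  have hi : Integrable (φ j) μ := Integrable.of_bound (h.cont j).aestronglyMeasurable C
    (Eventually.of_forall fun y => hC y trivial)
  have hi2 : Integrable (fun y => φ j y * φ j y) μ :=
    hi.bdd_mul (c := C) (h.cont j).aestronglyMeasurable (Eventually.of_forall fun y => hC y trivial)
  calc ∫ y, |φ j y| ∂μ ≤ ∫ y, (1 / 2) * (1 + φ j y * φ j y) ∂μ := by
        refine integral_mono hi.abs (((integrable_const _).add hi2).const_mul _) fun y => ?_
        beta_reduce
        nlinarith [sq_nonneg (|φ j y| - 1), abs_mul_abs_self (φ j y)]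
    _ = 1 := by
        rw [integral_const_mul, integral_add (integrable_const _) hi2, h.orth j j]
        simp; norm_num

/-- The trace of the smoothing operator is the integral of its kernel over the diagonal. -/
lemma sum_lam_le (h : IsSmoothing μ φ α D q lam N) (s : Finset ℕ) : ∑ j ∈ s, lam j ≤ D * N ^ α := by
  have hi : ∀ j, Integrable (fun y => lam j * φ j y * φ j y) μ := fun j => by
    refine Continuous.integrable_of_hasCompactSupport ?_ (HasCompactSupport.of_compactSpace _)
    have := h.cont j
    fun_prop
  calc ∑ j ∈ s, lam j = ∑ j ∈ s, ∫ y, lam j * φ j y * φ j y ∂μ := by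
        refine Finset.sum_congr rfl fun j _ => ?_
        simp_rw [mul_assoc]
        rw [integral_const_mul, h.orth, if_pos rfl, mul_one]
    _ = ∫ y, ∑ j ∈ s, lam j * φ j y * φ j y ∂μ := (integral_finsetSum _ fun j _ => hi j).symm
    _ ≤ ∫ y, D * N ^ α ∂μ := by
        refine integral_mono (integrable_finsetSum _ fun j _ => hi j) (integrable_const _)
          fun y => ?_
        exact ((h.summable y y).sum_le_tsum s fun j _ => by
          rw [mul_assoc]; exact mul_nonneg (h.nonneg j) (mul_self_nonneg _)).trans (h.bound_diag y)
    _ = D * N ^ α := by simp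

lemma summable_lam (h : IsSmoothing μ φ α D q lam N) : Summable lam :=
  summable_of_sum_le h.nonneg h.sum_lam_le

lemma norm_integral_phi_mul_le (h : IsSmoothing μ φ α D q lam N) {f : M → ℂ} {R : ℝ}
    (hR : ∀ y, ‖f y‖ ≤ R) (j : ℕ) : ∫ y, ‖(φ j y : ℂ) * f y‖ ∂μ ≤ R := by
  have hR0 : 0 ≤ R := by
    obtain ⟨x⟩ := nonempty_of_isProbabilityMeasure μ
    exact (norm_nonneg _).trans (hR x)
  calc ∫ y, ‖(φ j y : ℂ) * f y‖ ∂μ ≤ ∫ y, |φ j y| * R ∂μ := by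
        refine integral_mono_of_nonneg (Eventually.of_forall fun y => norm_nonneg _)
          ((h.integrable_phi j).norm.congr (Eventually.of_forall fun y => by simp) |>.mul_const R)
          (Eventually.of_forall fun y => ?_)
        beta_reduce
        rw [norm_mul, Complex.norm_real, Real.norm_eq_abs]
        gcongr
        exact hR y
    _ ≤ R := by
        rw [integral_mul_const]
        exact mul_le_of_le_one_left hR0 (h.integral_abs_phi_le j)

lemma integrable_of_bdd {f : M → ℂ} {R : ℝ} (hf : Measurable f) (hR : ∀ y, ‖f y‖ ≤ R) :
    Integrable f μ :=
  Integrable.of_bound hf.aestronglyMeasurable R (Eventually.of_forall hR)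

lemma measurable_integral_kern (h : IsSmoothing μ φ α D q lam N) {a : ℕ → ℂ} {Λ : ℝ}
    (ha : ∀ j, ‖a j‖ ≤ Λ * lam j) {f : M → ℂ} (hf : Measurable f) :
    Measurable fun x => ∫ y, kern φ a x y * f y ∂μ := by
  have : StronglyMeasurable (Function.uncurry fun x y => kern φ a x y * f y) :=
    ((h.measurable_kern ha).mul (hf.comp measurable_snd)).stronglyMeasurable
  exact this.integral_prod_right.measurable

lemma norm_integral_kern_le (h : IsSmoothing μ φ α D q lam N) {a : ℕ → ℂ} {Λ : ℝ}
    (ha : ∀ j, ‖a j‖ ≤ Λ * lam j) {f : M → ℂ} {R : ℝ} (hR : ∀ y, ‖f y‖ ≤ R) (x : M) :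
    ‖∫ y, kern φ a x y * f y ∂μ‖ ≤ |Λ| * (D * N ^ α) * R := by
  refine (norm_integral_le_of_norm_le_const (C := |Λ| * (D * N ^ α) * R)
    (Eventually.of_forall fun y => ?_)).trans (by simp)
  rw [norm_mul]
  have := (norm_nonneg _).trans (h.hasSum_kern ha x y).2
  gcongr
  · exact (h.hasSum_kern ha x y).2
  · exact hR y

/-- The bilinear form of the operator with kernel `kern φ a`, in terms of coefficients. -/
lemma hasSum_integral_mul_integral_kern (h : IsSmoothing μ φ α D q lam N) {a : ℕ → ℂ} {Λ : ℝ}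
    (ha : ∀ j, ‖a j‖ ≤ Λ * lam j) {f g : M → ℂ} {R R' : ℝ} (hf : Measurable f)
    (hR : ∀ y, ‖f y‖ ≤ R) (hg : Measurable g) (hR' : ∀ y, ‖g y‖ ≤ R') :
    HasSum (fun j => a j * (∫ y, φ j y * f y ∂μ) * ∫ y, φ j y * g y ∂μ)
      (∫ x, g x * ∫ y, kern φ a x y * f y ∂μ ∂μ) := by
  have hgi : Integrable g μ := integrable_of_bdd hg hR'
  have hfi : Integrable f μ := integrable_of_bdd hf hR
  have hi : ∀ j, Integrable (fun x => a j * (∫ y, φ j y * f y ∂μ) * (φ j x * g x)) μ := fun j =>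
    (h.integrable_phi_mul hgi j).const_mul _
  have hR0 : 0 ≤ R := by
    obtain ⟨x⟩ := nonempty_of_isProbabilityMeasure μ
    exact (norm_nonneg _).trans (hR x)
  have hsum : Summable fun j => ∫ x, ‖a j * (∫ y, φ j y * f y ∂μ) * (φ j x * g x)‖ ∂μ := by
    refine Summable.of_nonneg_of_le (fun j => integral_nonneg fun y => norm_nonneg _)
      (fun j => ?_) (h.summable_lam.mul_left (Λ * R * R'))
    simp_rw [norm_mul (a j * _) _]
    rw [integral_const_mul, norm_mul]
    calc ‖a j‖ * ‖∫ y, φ j y * f y ∂μ‖ * ∫ x, ‖φ j x * g x‖ ∂μ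
        ≤ (Λ * lam j) * R * R' := by
          have h1 := ha j
          have h2 := (norm_integral_le_integral_norm _).trans (h.norm_integral_phi_mul_le hR j)
          have h3 := h.norm_integral_phi_mul_le hR' j
          have h0 := (norm_nonneg _).trans h1
          exact mul_le_mul (mul_le_mul h1 h2 (norm_nonneg _) h0) h3
            (integral_nonneg fun _ => norm_nonneg _) (mul_nonneg h0 hR0)
      _ = _ := by ring
  have := hasSum_integral_of_summable_integral_norm hi hsum
  simp_rw [integral_const_mul] at this
  have e : ∫ x, g x * ∫ y, kern φ a x y * f y ∂μ ∂μ =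
      ∫ x, ∑' j, a j * (∫ y, φ j y * f y ∂μ) * (φ j x * g x) ∂μ := by
    refine integral_congr_ae (Eventually.of_forall fun x => ?_)
    beta_reduce
    rw [← (h.hasSum_integral_kern_mul ha hfi x).tsum_eq, ← tsum_mul_left]
    exact tsum_congr fun j => by ring
  rwa [e]

lemma integral_phi_mul_integral_kern (h : IsSmoothing μ φ α D q lam N) {a : ℕ → ℂ} {Λ : ℝ}
    (ha : ∀ j, ‖a j‖ ≤ Λ * lam j) {f : M → ℂ} {R : ℝ} (hf : Measurable f)
    (hR : ∀ y, ‖f y‖ ≤ R) (k : ℕ) :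
    ∫ x, φ k x * ∫ y, kern φ a x y * f y ∂μ ∂μ = a k * ∫ y, φ k y * f y ∂μ := by
  obtain ⟨C, hC⟩ := isCompact_univ.exists_bound_of_continuousOn (h.cont k).continuousOn
  refine (h.hasSum_integral_mul_integral_kern ha hf hR
    (g := fun y => φ k y) (Complex.measurable_ofReal.comp (h.cont k).measurable) (R' := C)
    fun y => by simpa using hC y trivial).unique ?_
  convert hasSum_single (f := fun j => a j * (∫ y, φ j y * f y ∂μ) *
    ∫ y, (φ j y : ℂ) * φ k y ∂μ) k (fun j hj => by rw [h.orth_complex, if_neg hj, mul_zero]) using 1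
  rw [h.orth_complex, if_pos rfl, mul_one]

open ComplexConjugate in
/-- If `|1 + c_j| = 1`, then `1 +` the operator with kernel `kern φ c` is an isometry of `L²`. -/
lemma eLpNorm_add_integral_kern (h : IsSmoothing μ φ α D q lam N) {c : ℕ → ℂ} {Λ : ℝ}
    (hc : ∀ j, ‖c j‖ ≤ Λ * lam j) (hc1 : ∀ j, ‖1 + c j‖ = 1) {f : M → ℂ} {R : ℝ}
    (hf : Measurable f) (hR : ∀ y, ‖f y‖ ≤ R) :
    eLpNorm (fun x => f x + ∫ y, kern φ c x y * f y ∂μ) 2 μ = eLpNorm f 2 μ := by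
  set A : M → ℂ := fun x => ∫ y, kern φ c x y * f y ∂μ with hA
  have hAm : Measurable A := h.measurable_integral_kern hc hf
  have hAb : ∀ x, ‖A x‖ ≤ |Λ| * (D * N ^ α) * R := h.norm_integral_kern_le hc hR
  have hcm : ∀ {g : M → ℂ}, Measurable g → Measurable fun x => conj (g x) := fun hg =>
    Complex.continuous_conj.measurable.comp hg
  have hcb : ∀ {g : M → ℂ} {R : ℝ}, (∀ x, ‖g x‖ ≤ R) → ∀ x, ‖conj (g x)‖ ≤ R := fun hg x => by
    rw [RCLike.norm_conj]; exact hg x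
  have hprod : ∀ {g g' : M → ℂ} {R R' : ℝ}, Measurable g → Measurable g' → (∀ x, ‖g x‖ ≤ R) →
      (∀ x, ‖g' x‖ ≤ R') → Integrable (fun x => conj (g x) * g' x) μ := fun hg hg' hR hR' => by
    refine (integrable_of_bdd hg' hR').bdd_mul (hcm hg).aestronglyMeasurable
      (Eventually.of_forall (hcb hR))
  have hcoef : ∀ (g : M → ℂ) j, ∫ y, φ j y * conj (g y) ∂μ = conj (∫ y, φ j y * g y ∂μ) := by
    intro g j
    rw [← integral_conj]
    simp
  have hsum1 := h.hasSum_integral_mul_integral_kern hc hf hR (hcm hf) (hcb hR)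
  have hsum2 := h.hasSum_integral_mul_integral_kern hc hf hR (hcm hAm) (hcb hAb)
  have hsum3 := (Complex.hasSum_conj'.2 hsum1)
  simp_rw [hcoef] at hsum1 hsum2 hsum3
  have hAc : ∀ j, ∫ y, φ j y * A y ∂μ = c j * ∫ y, φ j y * f y ∂μ :=
    h.integral_phi_mul_integral_kern hc hf hR
  simp_rw [hAc] at hsum2
  have hzero := ((hsum1.add hsum3).add hsum2).unique (a₂ := 0) (by
    convert hasSum_zero using 2 with j
    have h1 : (1 + c j) * conj (1 + c j) = 1 := by
      rw [Complex.mul_conj, Complex.normSq_eq_norm_sq, hc1 j]; simp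
    rw [map_add, map_one] at h1
    simp only [map_mul, Complex.conj_conj]
    linear_combination ((∫ y, φ j y * f y ∂μ) * conj (∫ y, φ j y * f y ∂μ)) * h1)
  have hkey : ∫ x, ‖f x + A x‖ ^ 2 ∂μ = ∫ x, ‖f x‖ ^ 2 ∂μ := by
    have e : ∀ g : M → ℂ, ((∫ x, ‖g x‖ ^ 2 ∂μ : ℝ) : ℂ) = ∫ x, conj (g x) * g x ∂μ := fun g => by
      rw [← integral_complex_ofReal]
      refine integral_congr_ae (Eventually.of_forall fun x => ?_)
      simp [Complex.conj_mul']
    apply Complex.ofReal_injective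
    rw [e f, e fun x => f x + A x]
    have h4 : ∫ x, conj (f x + A x) * (f x + A x) ∂μ = ∫ x, conj (f x) * f x ∂μ +
        ((∫ x, conj (f x) * A x ∂μ + ∫ x, conj (A x) * f x ∂μ) + ∫ x, conj (A x) * A x ∂μ) := by
      have i1 := hprod hf hf hR hR
      have i2 := hprod hf hAm hR hAb
      have i3 := hprod hAm hf hAb hR
      have i4 := hprod hAm hAm hAb hAb
      have i23 : Integrable (fun x => conj (f x) * A x + conj (A x) * f x) μ := i2.add i3
      have i234 : Integrable (fun x => conj (f x) * A x + conj (A x) * f x + conj (A x) * A x) μ :=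
        i23.add i4
      rw [← integral_add i2 i3, ← integral_add i23 i4, ← integral_add i1 i234]
      refine integral_congr_ae (Eventually.of_forall fun x => ?_)
      simp only [map_add]
      ring
    have h5 : conj (∫ x, conj (f x) * A x ∂μ) = ∫ x, conj (A x) * f x ∂μ := by
      rw [← integral_conj]
      refine integral_congr_ae (Eventually.of_forall fun x => ?_)
      simp [mul_comm]
    rw [h4, ← h5, hzero, add_zero]
  have hmem : ∀ {g : M → ℂ} {R : ℝ}, Measurable g → (∀ x, ‖g x‖ ≤ R) → MemLp g 2 μ :=
    fun hg hR => MemLp.of_bound hg.aestronglyMeasurable _ (Eventually.of_forall hR)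
  have h6 : MemLp (fun x => f x + A x) 2 μ := (hmem hf hR).add (hmem hAm hAb)
  rw [h6.eLpNorm_eq_integral_rpow_norm two_ne_zero ENNReal.ofNat_ne_top,
    (hmem hf hR).eLpNorm_eq_integral_rpow_norm two_ne_zero ENNReal.ofNat_ne_top]
  simp only [ENNReal.toReal_ofNat, Real.rpow_two]
  rw [hkey]

end IsSmoothing

/-! ### Weighted kernels of the unitary multiplier `exp(2πi lam)` -/

/-- The weight `1 + N ρ(x, y)`, which is submultiplicative along chains of points. -/
def wt {M : Type*} [MetricSpace M] (N : ℝ) (x y : M) : ℝ := 1 + N * dist x y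

section wt
variable {M : Type*} [MetricSpace M] {N : ℝ}

lemma one_le_wt (hN : 0 < N) (x y : M) : 1 ≤ wt N x y :=
  le_add_of_nonneg_right (mul_nonneg hN.le dist_nonneg)

lemma wt_pos (hN : 0 < N) (x y : M) : 0 < wt N x y := zero_lt_one.trans_le (one_le_wt hN x y)

lemma wt_symm (x y : M) : wt N x y = wt N y x := by rw [wt, wt, dist_comm]

lemma wt_le_mul (hN : 0 < N) (x y z : M) : wt N x z ≤ wt N x y * wt N y z := by
  unfold wt
  have h1 := mul_le_mul_of_nonneg_left (dist_triangle x y z) hN.le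
  have h2 : 0 ≤ (N * dist x y) * (N * dist y z) :=
    mul_nonneg (mul_nonneg hN.le dist_nonneg) (mul_nonneg hN.le dist_nonneg)
  nlinarith

lemma measurable_wt [MeasurableSpace M] [BorelSpace M] [SecondCountableTopology M] (N : ℝ) :
    Measurable (Function.uncurry (wt (M := M) N)) := by
  unfold wt Function.uncurry
  fun_prop

end wt

/-- The modulus of a kernel times the `k`-th power of the weight at scale `1/N`. -/
noncomputable def wkern {M : Type*} [MetricSpace M] (φ : ℕ → M → ℝ) (a : ℕ → ℂ) (N : ℝ) (k : ℕ)
    (x y : M) : ℝ≥0∞ :=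
  ‖kern φ a x y‖ₑ * ENNReal.ofReal (wt N x y ^ k)

lemma wkern_symm {M : Type*} [MetricSpace M] (φ : ℕ → M → ℝ) (a : ℕ → ℂ) (N : ℝ) (k : ℕ)
    (x y : M) : wkern φ a N k x y = wkern φ a N k y x := by
  rw [wkern, wkern, kern_symm, wt_symm]

open Complex in
/-- The multiplier `exp(2πi lam) - 1`: adding the identity to its operator gives a unitary one. -/
noncomputable def expSubOne (lam : ℕ → ℝ) (j : ℕ) : ℂ := exp (2 * Real.pi * I * lam j) - 1

namespace IsSmoothing

variable {M : Type*} [MetricSpace M] [CompactSpace M] [MeasurableSpace M] [BorelSpace M]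
  {μ : Measure M} [IsProbabilityMeasure μ] {φ : ℕ → M → ℝ} {α D q : ℝ} {lam : ℕ → ℝ} {N : ℝ}

lemma norm_lam_le (h : IsSmoothing μ φ α D q lam N) (j : ℕ) : ‖(lam j : ℂ)‖ ≤ 1 * lam j := by
  rw [Complex.norm_real, Real.norm_of_nonneg (h.nonneg j), one_mul]

lemma norm_kern_lam_le (h : IsSmoothing μ φ α D q lam N) (x y : M) :
    ‖kern φ (fun j => (lam j : ℂ)) x y‖ ≤ D * N ^ α * wt N x y ^ (-q) := by
  have : kern φ (fun j => (lam j : ℂ)) x y = ((∑' j, lam j * φ j x * φ j y : ℝ) : ℂ) := by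
    rw [kern, Complex.ofReal_tsum]
    exact tsum_congr fun j => by push_cast; rfl
  rw [this, Complex.norm_real]
  exact h.bound x y

lemma measurable_wkern (h : IsSmoothing μ φ α D q lam N) {a : ℕ → ℂ} {Λ : ℝ}
    (ha : ∀ j, ‖a j‖ ≤ Λ * lam j) (k : ℕ) :
    Measurable (Function.uncurry (wkern φ a N k)) :=
  (h.measurable_kern ha).enorm.mul ((measurable_wt N).pow_const k).ennreal_ofReal

lemma measurable_wkern_right (h : IsSmoothing μ φ α D q lam N) {a : ℕ → ℂ} {Λ : ℝ}
    (ha : ∀ j, ‖a j‖ ≤ Λ * lam j) (k : ℕ) (x : M) : Measurable (wkern φ a N k x) :=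
  (h.measurable_wkern ha k).of_uncurry_left

lemma measurable_wkern_swap (h : IsSmoothing μ φ α D q lam N) {a : ℕ → ℂ} {Λ : ℝ}
    (ha : ∀ j, ‖a j‖ ≤ Λ * lam j) (k : ℕ) :
    Measurable fun z : M × M => wkern φ a N k z.2 z.1 := by
  simp_rw [wkern_symm φ a N k _ (Prod.fst _)]
  exact h.measurable_wkern ha k

/-- The weighted kernel of the smoothing operator is bounded in `L¹(ν)`. -/
lemma exists_lintegral_kern_lam_le (μ : Measure M) [IsProbabilityMeasure μ] (φ : ℕ → M → ℝ)
    {α : ℝ} (hα : 0 < α) (D : ℝ) {q : ℝ} {k : ℕ} (hq : α + k < q) :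
    ∃ C, 0 < C ∧ ∀ (lam : ℕ → ℝ) (N : ℝ), IsSmoothing μ φ α D q lam N →
      ∀ (ν : Measure M) (D' d : ℝ) (x : M), 0 < D' → 0 ≤ d →
      (∀ s, 0 < s → ν (Metric.closedBall x s) ≤ ENNReal.ofReal (D' * (s ^ α + d ^ α))) →
      ∫⁻ y, wkern φ (fun j => (lam j : ℂ)) N k x y ∂ν ≤
        ENNReal.ofReal (C * D * D' * (1 + (N * d) ^ α)) := by
  obtain ⟨C, hC, hCb⟩ := exists_lintegral_decay_le hα (q := q - k) (by linarith)
  refine ⟨C, hC, fun lam N h ν D' d x hD' hd hν => ?_⟩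
  have hN := h.N_pos
  have hD := h.D_pos
  have hNα : 0 < N ^ α := Real.rpow_pos_of_pos hN _
  calc ∫⁻ y, wkern φ (fun j => (lam j : ℂ)) N k x y ∂ν
      ≤ ∫⁻ y, ENNReal.ofReal (D * N ^ α) * ENNReal.ofReal ((1 + N * dist x y) ^ (-(q - k))) ∂ν := by
        refine lintegral_mono fun y => ?_
        have hw := wt_pos hN x y
        rw [wkern, ← ofReal_norm, ← ENNReal.ofReal_mul (norm_nonneg _),
          ← ENNReal.ofReal_mul (by positivity)]
        refine ENNReal.ofReal_le_ofReal ?_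
        calc ‖kern φ (fun j => (lam j : ℂ)) x y‖ * wt N x y ^ k
            ≤ D * N ^ α * wt N x y ^ (-q) * wt N x y ^ k := by
              gcongr; exact h.norm_kern_lam_le x y
          _ = D * N ^ α * wt N x y ^ (-(q - k)) := by
              rw [mul_assoc, ← Real.rpow_natCast, ← Real.rpow_add hw]
              congr 2; ring
    _ = ENNReal.ofReal (D * N ^ α) * ∫⁻ y, ENNReal.ofReal ((1 + N * dist x y) ^ (-(q - k))) ∂ν :=
        lintegral_const_mul' _ _ ENNReal.ofReal_ne_top
    _ ≤ ENNReal.ofReal (D * N ^ α) * ENNReal.ofReal (C * D' * (N ^ (-α) + d ^ α)) := by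
        gcongr
        exact hCb ν D' N d x hD' hN hd hν
    _ = _ := by
        rw [← ENNReal.ofReal_mul (by positivity), Real.mul_rpow hN.le hd, Real.rpow_neg hN.le]
        congr 1
        field_simp

lemma ball' (h : IsSmoothing μ φ α D q lam N) (x : M) (s : ℝ) (hs : 0 < s) :
    μ (Metric.closedBall x s) ≤ ENNReal.ofReal (D * (s ^ α + 0 ^ α)) := by
  rw [Real.zero_rpow h.alpha_pos.ne', add_zero]
  exact h.ball x s hs

/-- Weighted Schur norms are submultiplicative. -/
lemma lintegral_kern_pow_le (h : IsSmoothing μ φ α D q lam N) {k : ℕ} {B : ℝ≥0∞}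
    (hB : ∀ x, ∫⁻ y, wkern φ (fun j => (lam j : ℂ)) N k x y ∂μ ≤ B) (m : ℕ) (x : M) :
    ∫⁻ y, wkern φ (fun j => (lam j : ℂ) ^ (m + 1)) N k x y ∂μ ≤ B ^ (m + 1) := by
  have hN := h.N_pos
  have hdom : ∀ (m : ℕ) j, ‖(lam j : ℂ) ^ (m + 1)‖ ≤ 1 * lam j := fun m j => by
    rw [norm_pow, Complex.norm_real, Real.norm_of_nonneg (h.nonneg j), one_mul]
    exact pow_le_of_le_one (h.nonneg j) (h.le_one j) (by omega)
  induction m generalizing x with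
  | zero => simpa using hB x
  | succ m ih =>
    have hcomp : ∀ y, wkern φ (fun j => (lam j : ℂ) ^ (m + 1 + 1)) N k x y ≤
        ∫⁻ z, wkern φ (fun j => (lam j : ℂ)) N k x z *
          wkern φ (fun j => (lam j : ℂ) ^ (m + 1)) N k z y ∂μ := by
      intro y
      have e : kern φ (fun j => (lam j : ℂ) ^ (m + 1 + 1)) x y =
          ∫ z, kern φ (fun j => (lam j : ℂ)) x z *
            kern φ (fun j => (lam j : ℂ) ^ (m + 1)) z y ∂μ := by
        rw [h.integral_kern_mul_kern h.norm_lam_le (hdom m)]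
        congr 1; ext j; ring
      rw [wkern, e, mul_comm]
      refine (mul_le_mul_right (enorm_integral_le_lintegral_enorm _) _).trans ?_
      rw [← lintegral_const_mul' _ _ ENNReal.ofReal_ne_top]
      refine lintegral_mono fun z => ?_
      have hw : ENNReal.ofReal (wt N x y ^ k) ≤
          ENNReal.ofReal (wt N x z ^ k) * ENNReal.ofReal (wt N z y ^ k) := by
        have := wt_pos hN x z
        rw [← ENNReal.ofReal_mul (by positivity), ← mul_pow]
        exact ENNReal.ofReal_le_ofReal (pow_le_pow_left₀ (wt_pos hN x y).le (wt_le_mul hN x z y) k)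
      rw [enorm_mul, wkern, wkern]
      refine (mul_le_mul_left hw _).trans (le_of_eq ?_)
      ring
    calc _ ≤ ∫⁻ y, ∫⁻ z, wkern φ (fun j => (lam j : ℂ)) N k x z *
          wkern φ (fun j => (lam j : ℂ) ^ (m + 1)) N k z y ∂μ ∂μ :=
          lintegral_mono hcomp
      _ = ∫⁻ z, ∫⁻ y, wkern φ (fun j => (lam j : ℂ)) N k x z *
          wkern φ (fun j => (lam j : ℂ) ^ (m + 1)) N k z y ∂μ ∂μ := by
          refine lintegral_lintegral_swap (Measurable.aemeasurable ?_)
          have m1 : Measurable fun z : M × M => wkern φ (fun j => (lam j : ℂ)) N k x z.2 :=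
            (h.measurable_wkern_right h.norm_lam_le k x).comp measurable_snd
          exact m1.mul (h.measurable_wkern_swap (hdom m) k)
      _ ≤ ∫⁻ z, wkern φ (fun j => (lam j : ℂ)) N k x z *
          B ^ (m + 1) ∂μ := by
          refine lintegral_mono fun z => ?_
          beta_reduce
          rw [lintegral_const_mul _ (h.measurable_wkern_right (hdom m) k z)]
          gcongr
          exact ih z
      _ ≤ B ^ (m + 1 + 1) := by
          rw [lintegral_mul_const _ (h.measurable_wkern_right h.norm_lam_le k x), pow_succ' B (m + 1)]
          gcongr
          exact hB x

open Complex in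
lemma norm_expSubOne_le (h : IsSmoothing μ φ α D q lam N) (j : ℕ) :
    ‖expSubOne lam j‖ ≤ (2 * Real.pi) * lam j := by
  have := Real.norm_exp_I_mul_ofReal_sub_one_le (x := 2 * Real.pi * lam j)
  rw [Real.norm_of_nonneg (mul_nonneg Real.two_pi_pos.le (h.nonneg j))] at this
  rw [expSubOne]
  convert this using 4
  push_cast; ring

open Complex in
/-- Expand `exp(2πi lam) - 1` into powers of `lam`. -/
lemma lintegral_kern_expSubOne_le (h : IsSmoothing μ φ α D q lam N) {k : ℕ} {B : ℝ} (hB0 : 0 ≤ B)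
    (hB : ∀ x, ∫⁻ y, wkern φ (fun j => (lam j : ℂ)) N k x y ∂μ ≤ ENNReal.ofReal B) (x : M) :
    ∫⁻ y, wkern φ (expSubOne lam) N k x y ∂μ ≤
      ENNReal.ofReal (Real.exp (2 * Real.pi * B)) := by
  have hdom : ∀ (m : ℕ) j, ‖(lam j : ℂ) ^ (m + 1)‖ ≤ 1 * lam j := fun m j => by
    rw [norm_pow, Complex.norm_real, Real.norm_of_nonneg (h.nonneg j), one_mul]
    exact pow_le_of_le_one (h.nonneg j) (h.le_one j) (by omega)
  have hexp : Summable fun m : ℕ => (2 * Real.pi) ^ (m + 1) / (m + 1).factorial :=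
    (summable_nat_add_iff 1).2 (Real.summable_pow_div_factorial (2 * Real.pi))
  set e : ℕ → ℂ := fun m => (2 * Real.pi * I) ^ (m + 1) / (m + 1).factorial with he
  have hnorm : ∀ m, ‖e m‖ = (2 * Real.pi) ^ (m + 1) / (m + 1).factorial := fun m => by
    simp [he, abs_of_pos Real.pi_pos]
  have hser : ∀ j, HasSum (fun m : ℕ => e m * (lam j : ℂ) ^ (m + 1)) (expSubOne lam j) := fun j => by
    have h1 := NormedSpace.expSeries_div_hasSum_exp (2 * Real.pi * I * lam j : ℂ)
    rw [← Complex.exp_eq_exp_ℂ] at h1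
    have h2 := (hasSum_nat_add_iff' 1).2 h1
    simp only [Finset.range_one, Finset.sum_singleton, pow_zero, Nat.factorial_zero, Nat.cast_one,
      div_one] at h2
    have e1 : (fun m : ℕ => e m * (lam j : ℂ) ^ (m + 1)) =
        fun m => (2 * Real.pi * I * lam j : ℂ) ^ (m + 1) / (m + 1).factorial := by
      funext m
      rw [he]; ring
    rw [e1]
    exact h2
  have hk : ∀ y, kern φ (expSubOne lam) x y =
      ∑' m, e m * kern φ (fun j => (lam j : ℂ) ^ (m + 1)) x y := by
    intro y
    have hsum : Summable (Function.uncurry fun (j m : ℕ) =>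
        e m * (lam j : ℂ) ^ (m + 1) * φ j x * φ j y) := by
      have := (h.summable_abs x y).1.mul_of_nonneg hexp
        (fun j => mul_nonneg (h.nonneg j) (by positivity)) (fun m => by positivity)
      refine Summable.of_norm_bounded this fun ⟨j, m⟩ => ?_
      simp only [Function.uncurry]
      rw [norm_mul, norm_mul, norm_mul, hnorm, Complex.norm_real, Complex.norm_real,
        Real.norm_eq_abs, Real.norm_eq_abs]
      have := hdom m j
      rw [one_mul] at this
      calc _ ≤ (2 * Real.pi) ^ (m + 1) / (m + 1).factorial * lam j * |φ j x| * |φ j y| := by gcongr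
        _ = _ := by ring
    calc kern φ (expSubOne lam) x y
        = ∑' j, ∑' m, e m * (lam j : ℂ) ^ (m + 1) * φ j x * φ j y := by
          refine tsum_congr fun j => ?_
          rw [← (hser j).tsum_eq, ← tsum_mul_right, ← tsum_mul_right]
      _ = ∑' m, ∑' j, e m * (lam j : ℂ) ^ (m + 1) * φ j x * φ j y := hsum.tsum_comm.symm
      _ = _ := by
          refine tsum_congr fun m => ?_
          rw [kern, ← tsum_mul_left]
          exact tsum_congr fun j => by ring
  have hmeas := fun m => h.measurable_wkern_right (hdom m) k x
  calc ∫⁻ y, wkern φ (expSubOne lam) N k x y ∂μ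
      ≤ ∫⁻ y, ∑' m, ‖e m‖ₑ * (wkern φ (fun j => (lam j : ℂ) ^ (m + 1)) N k x y) ∂μ := by
        refine lintegral_mono fun y => ?_
        simp_rw [wkern, ← mul_assoc]
        rw [ENNReal.tsum_mul_right, hk y]
        gcongr
        refine (enorm_tsum_le_tsum_enorm).trans (le_of_eq ?_)
        simp_rw [enorm_mul]
    _ = ∑' m, ‖e m‖ₑ * ∫⁻ y, wkern φ (fun j => (lam j : ℂ) ^ (m + 1)) N k x y ∂μ := by
        rw [lintegral_tsum fun m =>
          ((hmeas m).const_mul _).aemeasurable]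
        refine tsum_congr fun m => ?_
        exact lintegral_const_mul _ (hmeas m)
    _ ≤ ∑' m : ℕ, ENNReal.ofReal ((2 * Real.pi * B) ^ (m + 1) / (m + 1).factorial) := by
        refine ENNReal.tsum_le_tsum fun m => ?_
        refine (mul_le_mul_right (h.lintegral_kern_pow_le hB m x) _).trans (le_of_eq ?_)
        rw [← ofReal_norm, hnorm, ← ENNReal.ofReal_pow hB0,
          ← ENNReal.ofReal_mul (by positivity)]
        congr 1; ring
    _ = ENNReal.ofReal (∑' m : ℕ, (2 * Real.pi * B) ^ (m + 1) / (m + 1).factorial) :=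
        (ENNReal.ofReal_tsum_of_nonneg (fun m => by positivity)
          ((summable_nat_add_iff 1).2 (Real.summable_pow_div_factorial _))).symm
    _ ≤ _ := by
        refine ENNReal.ofReal_le_ofReal ?_
        rw [Real.exp_eq_exp_ℝ, NormedSpace.exp_eq_tsum_div]
        beta_reduce
        rw [(Real.summable_pow_div_factorial (2 * Real.pi * B)).tsum_eq_zero_add]
        simp

end IsSmoothing

/-! ### Growth of the oscillating kernels -/

open Complex in
/-- The multiplier `exp(2πi n lam) lam`, from which smooth multipliers are built by Fourier series. -/
noncomputable def osc (lam : ℕ → ℝ) (n : ℤ) (j : ℕ) : ℂ :=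
  exp (2 * Real.pi * I * n * lam j) * lam j

lemma osc_zero (lam : ℕ → ℝ) : osc lam 0 = fun j => (lam j : ℂ) := by
  funext j; simp [osc]

lemma norm_osc (lam : ℕ → ℝ) (n : ℤ) (j : ℕ) : ‖osc lam n j‖ = |lam j| := by
  have : (2 * Real.pi * Complex.I * n * lam j : ℂ) =
      ((2 * Real.pi * n * lam j : ℝ) : ℂ) * Complex.I := by push_cast; ring
  rw [osc, norm_mul, this, Complex.norm_exp_ofReal_mul_I, one_mul, Complex.norm_real,
    Real.norm_eq_abs]

open ComplexConjugate in
lemma osc_neg (lam : ℕ → ℝ) (n : ℤ) (j : ℕ) : osc lam (-n) j = conj (osc lam n j) := by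
  rw [osc, osc, map_mul, Complex.conj_ofReal, ← Complex.exp_conj]
  congr 2
  simp [Complex.conj_ofNat]

open ComplexConjugate in
lemma kern_osc_neg {M : Type*} (φ : ℕ → M → ℝ) (lam : ℕ → ℝ) (n : ℤ) (x y : M) :
    kern φ (osc lam (-n)) x y = conj (kern φ (osc lam n) x y) := by
  rw [kern, kern, Complex.conj_tsum]
  refine tsum_congr fun j => ?_
  rw [osc_neg, map_mul, map_mul, Complex.conj_ofReal, Complex.conj_ofReal]

lemma norm_one_add_expSubOne (lam : ℕ → ℝ) (j : ℕ) : ‖1 + expSubOne lam j‖ = 1 := by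
  have : (2 * Real.pi * Complex.I * lam j : ℂ) =
      ((2 * Real.pi * lam j : ℝ) : ℂ) * Complex.I := by push_cast; ring
  rw [expSubOne, add_sub_cancel, this, Complex.norm_exp_ofReal_mul_I]

lemma osc_succ (lam : ℕ → ℝ) (n : ℕ) (j : ℕ) :
    osc lam ((n + 1 : ℕ) : ℤ) j = osc lam n j + expSubOne lam j * osc lam n j := by
  have : (2 * Real.pi * Complex.I * ((n + 1 : ℕ) : ℤ) * lam j : ℂ) =
      2 * Real.pi * Complex.I * lam j + 2 * Real.pi * Complex.I * (n : ℤ) * lam j := by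
    push_cast; ring
  rw [osc, osc, this, Complex.exp_add, expSubOne]
  ring

namespace IsSmoothing

variable {M : Type*} [MetricSpace M] [CompactSpace M] [MeasurableSpace M] [BorelSpace M]
  {μ : Measure M} [IsProbabilityMeasure μ] {φ : ℕ → M → ℝ} {α D q : ℝ} {lam : ℕ → ℝ} {N : ℝ}

lemma norm_osc_le (h : IsSmoothing μ φ α D q lam N) (n : ℤ) (j : ℕ) :
    ‖osc lam n j‖ ≤ 1 * lam j := by
  rw [norm_osc, abs_of_nonneg (h.nonneg j), one_mul]

lemma measurable_kern_right (h : IsSmoothing μ φ α D q lam N) {a : ℕ → ℂ} {Λ : ℝ}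
    (ha : ∀ j, ‖a j‖ ≤ Λ * lam j) (x : M) : Measurable (kern φ a x) :=
  (h.measurable_kern ha).of_uncurry_left

/-- The kernels `osc lam n` are the iterates of a unitary operator on the smoothing kernel. -/
lemma kern_osc_succ (h : IsSmoothing μ φ α D q lam N) (n : ℕ) (x y : M) :
    kern φ (osc lam ((n + 1 : ℕ) : ℤ)) x y = kern φ (osc lam n) x y +
      ∫ z, kern φ (expSubOne lam) y z * kern φ (osc lam n) x z ∂μ := by
  have hdom : ∀ j, ‖expSubOne lam j * osc lam n j‖ ≤ (2 * Real.pi) * lam j := fun j => by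
    rw [norm_mul]
    have h1 := h.norm_expSubOne_le j
    have h2 := h.norm_osc_le n j
    have h3 := h.le_one j
    have h4 : ‖osc lam n j‖ ≤ 1 := by linarith
    exact (mul_le_of_le_one_right (norm_nonneg _) h4).trans h1
  simp_rw [kern_symm φ (osc lam n) x]
  rw [h.integral_kern_mul_kern h.norm_expSubOne_le (h.norm_osc_le n), kern_symm φ _ x y]
  refine HasSum.tsum_eq ?_
  convert (h.hasSum_kern (h.norm_osc_le n) y x).1.add (h.hasSum_kern hdom y x).1 using 2 with j
  rw [osc_succ]; ring

lemma measurable_wt_right (x : M) (N : ℝ) : Measurable (wt N x) :=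
  (measurable_wt N).of_uncurry_left

lemma exists_wt_pow_mul_bound (h : IsSmoothing μ φ α D q lam N) (k : ℕ) (x : M) {a : ℕ → ℂ} {Λ : ℝ}
    (ha : ∀ j, ‖a j‖ ≤ Λ * lam j) :
    ∃ R, ∀ z, ‖((wt N x z ^ k : ℝ) : ℂ) * kern φ a x z‖ ≤ R := by
  have hc : Continuous fun z => wt N x z ^ k := by unfold wt; fun_prop
  obtain ⟨C, hC⟩ := isCompact_univ.exists_bound_of_continuousOn hc.continuousOn
  refine ⟨C * (|Λ| * (D * N ^ α)), fun z => ?_⟩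
  rw [norm_mul, Complex.norm_real]
  have h1 := hC z trivial
  have h2 := (h.hasSum_kern ha x z).2
  exact mul_le_mul h1 h2 (norm_nonneg _) ((norm_nonneg _).trans h1)

lemma measurable_wt_pow_mul (h : IsSmoothing μ φ α D q lam N) (k : ℕ) (x : M) {a : ℕ → ℂ} {Λ : ℝ}
    (ha : ∀ j, ‖a j‖ ≤ Λ * lam j) :
    Measurable fun z => ((wt N x z ^ k : ℝ) : ℂ) * kern φ a x z :=
  (Complex.measurable_ofReal.comp ((measurable_wt_right x N).pow_const k)).mul
    (h.measurable_kern_right ha x)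

/-- The weighted `L²` norm of the smoothing kernel, from its sup norm and a weighted `L¹` norm. -/
lemma exists_eLpNorm_wt_pow_mul_kern_lam_le (μ : Measure M) [IsProbabilityMeasure μ]
    (φ : ℕ → M → ℝ) {α : ℝ} (hα : 0 < α) {D : ℝ} (hD : 0 < D) {q : ℝ} {k : ℕ}
    (hq : α + 2 * k < q) :
    ∃ C, 0 < C ∧ ∀ (lam : ℕ → ℝ) (N : ℝ), IsSmoothing μ φ α D q lam N → ∀ x,
      eLpNorm (fun z => ((wt N x z ^ k : ℝ) : ℂ) * kern φ (fun j => (lam j : ℂ)) x z) 2 μ ≤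
        ENNReal.ofReal (C * N ^ (α / 2)) := by
  obtain ⟨C, hC, hCb⟩ := exists_lintegral_kern_lam_le μ φ hα D (k := 2 * k) (q := q)
    (by push_cast; exact hq)
  refine ⟨(D * (C * D * D)) ^ (1 / 2 : ℝ), by positivity, fun lam N h x => ?_⟩
  have hN := h.N_pos
  have h1 := hCb lam N h μ D 0 x hD le_rfl (h.ball' x)
  rw [mul_zero, Real.zero_rpow hα.ne', add_zero, mul_one] at h1
  rw [eLpNorm_eq_lintegral_rpow_enorm_toReal two_ne_zero ENNReal.ofNat_ne_top]
  simp only [ENNReal.toReal_ofNat]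
  calc (∫⁻ z, ‖((wt N x z ^ k : ℝ) : ℂ) * kern φ (fun j => (lam j : ℂ)) x z‖ₑ ^ (2 : ℝ) ∂μ) ^
        (1 / 2 : ℝ)
      ≤ (∫⁻ z, ENNReal.ofReal (D * N ^ α) *
          (‖kern φ (fun j => (lam j : ℂ)) x z‖ₑ * ENNReal.ofReal (wt N x z ^ (2 * k))) ∂μ) ^
        (1 / 2 : ℝ) := by
        gcongr with z
        have hw := wt_pos hN x z
        have h2 : ‖kern φ (fun j => (lam j : ℂ)) x z‖ₑ ≤ ENNReal.ofReal (D * N ^ α) := by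
          rw [← ofReal_norm]
          refine ENNReal.ofReal_le_ofReal ?_
          simpa using (h.hasSum_kern h.norm_lam_le x z).2
        rw [enorm_mul, ← ofReal_norm, Complex.norm_real, Real.norm_of_nonneg (by positivity),
          ENNReal.rpow_two, mul_pow, ← ENNReal.ofReal_pow (by positivity), ← pow_mul, mul_comm k 2,
          mul_comm, sq, mul_assoc]
        gcongr
    _ ≤ (ENNReal.ofReal (D * N ^ α) * ENNReal.ofReal (C * D * D)) ^ (1 / 2 : ℝ) := by
        rw [lintegral_const_mul' _ _ ENNReal.ofReal_ne_top]
        gcongr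
        exact h1
    _ = _ := by
        rw [← ENNReal.ofReal_mul (by positivity),
          ENNReal.ofReal_rpow_of_nonneg (by positivity) (by norm_num)]
        congr 1
        rw [show D * N ^ α * (C * D * D) = (D * (C * D * D)) * N ^ α by ring,
          Real.mul_rpow (by positivity) (by positivity), ← Real.rpow_mul hN.le]
        congr 2; ring

/-- The difference of two powers of weights, as it occurs in a commutator: one order of the weight
`b` is traded for the weight `t` that separates `a` from `b`. -/
lemma abs_pow_succ_sub_pow_succ_le {a b t : ℝ} (k : ℕ) (ha : 0 ≤ a) (hb : 0 ≤ b) (ht : 1 ≤ t)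
    (hab : |a - b| ≤ t) (hle : a ≤ b * t) :
    |a ^ (k + 1) - b ^ (k + 1)| ≤ t ^ (k + 1) * ((k + 1) * b ^ k) := by
  refine (abs_pow_sub_pow_le a b (k + 1)).trans ?_
  rw [abs_of_nonneg ha, abs_of_nonneg hb, Nat.add_sub_cancel]
  have hmax : max a b ≤ b * t := max_le hle (le_mul_of_one_le_right hb ht)
  have h0 : 0 ≤ max a b := ha.trans (le_max_left _ _)
  calc |a - b| * ((k + 1 : ℕ) : ℝ) * max a b ^ k ≤ t * ((k + 1 : ℕ) : ℝ) * (b * t) ^ k := by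
        gcongr
    _ = _ := by push_cast; ring

/-- Applying the unitary operator once more to the kernel `osc lam n` increases its weighted `L²`
norm by at most a multiple of the norm with a weight of one order less. The unitary operator
preserves the `L²` norm of the weighted kernel, and the commutator of the operator and the weight
`wt ^ (k + 1)` is bounded by `wt ^ k` times the weighted kernel of `expSubOne`. -/
lemma eLpNorm_commutator_le (h : IsSmoothing μ φ α D q lam N) {k : ℕ} {B : ℝ≥0∞}
    (hB : ∀ x, ∫⁻ y, wkern φ (expSubOne lam) N (k + 1) x y ∂μ ≤ B) (n : ℕ) (x : M) :
    eLpNorm (fun z => ((wt N x z ^ (k + 1) : ℝ) : ℂ) * kern φ (osc lam ((n + 1 : ℕ) : ℤ)) x z) 2 μ ≤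
      eLpNorm (fun z => ((wt N x z ^ (k + 1) : ℝ) : ℂ) * kern φ (osc lam n) x z) 2 μ +
      B * ((k + 1) * eLpNorm (fun z => ((wt N x z ^ k : ℝ) : ℂ) * kern φ (osc lam n) x z) 2 μ) := by
  have hN := h.N_pos
  set f : M → ℂ := fun z => ((wt N x z ^ (k + 1) : ℝ) : ℂ) * kern φ (osc lam n) x z with hf
  have hfm : Measurable f := h.measurable_wt_pow_mul (k + 1) x (h.norm_osc_le n)
  obtain ⟨R, hR⟩ := h.exists_wt_pow_mul_bound (k + 1) x (h.norm_osc_le n)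
  set g : M → ℂ := fun z => ((k + 1 : ℕ) : ℂ) *
    (((wt N x z ^ k : ℝ) : ℂ) * kern φ (osc lam n) x z) with hg
  have hgm : Measurable g := (h.measurable_wt_pow_mul k x (h.norm_osc_le n)).const_mul _
  have hvm := h.measurable_kern_right (h.norm_osc_le n) x
  have hvi := h.integrable_kern (h.norm_osc_le n) x
  have hfi : Integrable f μ := integrable_of_bdd hfm hR
  have hJm := fun y => (h.measurable_kern_right h.norm_expSubOne_le y)
  have hJb := fun y z => (h.hasSum_kern h.norm_expSubOne_le y z).2
  set r : M → ℂ := fun y => ((wt N x y ^ (k + 1) : ℝ) : ℂ) *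
    (∫ z, kern φ (expSubOne lam) y z * kern φ (osc lam n) x z ∂μ) -
      ∫ z, kern φ (expSubOne lam) y z * f z ∂μ with hr
  have hsplit : (fun z => ((wt N x z ^ (k + 1) : ℝ) : ℂ) *
      kern φ (osc lam ((n + 1 : ℕ) : ℤ)) x z) =
      (fun y => f y + ∫ z, kern φ (expSubOne lam) y z * f z ∂μ) + r := by
    funext y
    simp only [Pi.add_apply, hr, h.kern_osc_succ n x y, hf]
    ring
  have hm1 : Measurable fun y => f y + ∫ z, kern φ (expSubOne lam) y z * f z ∂μ :=
    hfm.add (h.measurable_integral_kern h.norm_expSubOne_le hfm)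
  have hm2 : Measurable r :=
    ((Complex.measurable_ofReal.comp ((measurable_wt_right x N).pow_const (k + 1))).mul
      (h.measurable_integral_kern h.norm_expSubOne_le hvm)).sub
      (h.measurable_integral_kern h.norm_expSubOne_le hfm)
  have hrb : ∀ y, ‖r y‖ₑ ≤ ∫⁻ z, wkern φ (expSubOne lam) N (k + 1) y z * ‖g z‖ₑ ∂μ := by
    intro y
    have e : r y = ∫ z, ((wt N x y ^ (k + 1) - wt N x z ^ (k + 1) : ℝ) : ℂ) *
        (kern φ (expSubOne lam) y z * kern φ (osc lam n) x z) ∂μ := by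
      rw [hr]
      beta_reduce
      have i1 : Integrable (fun z => ((wt N x y ^ (k + 1) : ℝ) : ℂ) *
          (kern φ (expSubOne lam) y z * kern φ (osc lam n) x z)) μ :=
        (hvi.bdd_mul (hJm y).aestronglyMeasurable (Eventually.of_forall (hJb y))).const_mul _
      have i2 : Integrable (fun z => kern φ (expSubOne lam) y z * f z) μ :=
        hfi.bdd_mul (hJm y).aestronglyMeasurable (Eventually.of_forall (hJb y))
      rw [← integral_const_mul, ← integral_sub i1 i2]
      refine integral_congr_ae (Eventually.of_forall fun z => ?_)
      simp only [hf]
      push_cast; ring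
    rw [e]
    refine (enorm_integral_le_lintegral_enorm _).trans (lintegral_mono fun z => ?_)
    have hwy := wt_pos hN y z
    have hwx := wt_pos hN x z
    have hcm : |wt N x y ^ (k + 1) - wt N x z ^ (k + 1)| ≤
        wt N y z ^ (k + 1) * ((k + 1) * wt N x z ^ k) := by
      refine abs_pow_succ_sub_pow_succ_le k (wt_pos hN x y).le hwx.le (one_le_wt hN y z) ?_ ?_
      · have : |dist x y - dist x z| ≤ dist y z := by
          rw [dist_comm x y, dist_comm x z, dist_comm y z, dist_comm z y]
          exact abs_dist_sub_le y z x
        unfold wt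
        rw [add_sub_add_left_eq_sub, ← mul_sub, abs_mul, abs_of_pos hN]
        nlinarith
      · rw [wt_symm y z]
        exact wt_le_mul hN x z y
    rw [wkern, ← ofReal_norm, ← ofReal_norm, ← ofReal_norm, ← ENNReal.ofReal_mul (norm_nonneg _),
      ← ENNReal.ofReal_mul (by positivity)]
    refine ENNReal.ofReal_le_ofReal ?_
    rw [norm_mul, norm_mul, hg]
    beta_reduce
    rw [norm_mul, norm_mul, Complex.norm_real, Complex.norm_real, Complex.norm_natCast,
      Real.norm_eq_abs, Real.norm_of_nonneg (by positivity : (0 : ℝ) ≤ wt N x z ^ k)]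
    calc _ ≤ wt N y z ^ (k + 1) * ((k + 1) * wt N x z ^ k) *
          (‖kern φ (expSubOne lam) y z‖ * ‖kern φ (osc lam n) x z‖) := by gcongr
      _ = _ := by push_cast; ring
  have hschur : eLpNorm r 2 μ ≤ B * eLpNorm g 2 μ := by
    have := eLpNorm_le_of_schur (h.measurable_wkern h.norm_expSubOne_le (k + 1))
      hgm.aestronglyMeasurable (F := r) hB
      (fun z => by simp_rw [wkern_symm φ _ N (k + 1) _ z]; exact hB z) hrb
      (inferInstance : ENNReal.HolderConjugate 2 2)
    refine this.trans (le_of_eq ?_)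
    rw [← ENNReal.rpow_add_of_nonneg _ _ ENNReal.toReal_nonneg ENNReal.toReal_nonneg]
    norm_num
  have hgn : eLpNorm g 2 μ =
      (k + 1) * eLpNorm (fun z => ((wt N x z ^ k : ℝ) : ℂ) * kern φ (osc lam n) x z) 2 μ := by
    have : g = ((k + 1 : ℕ) : ℂ) • fun z => ((wt N x z ^ k : ℝ) : ℂ) * kern φ (osc lam n) x z := rfl
    rw [this, eLpNorm_const_smul]
    congr 1
    rw [← ofReal_norm, Complex.norm_natCast, ENNReal.ofReal_natCast]
    push_cast; rfl
  rw [hsplit]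
  refine (eLpNorm_add_le hm1.aestronglyMeasurable hm2.aestronglyMeasurable one_le_two).trans ?_
  rw [h.eLpNorm_add_integral_kern h.norm_expSubOne_le (norm_one_add_expSubOne lam) hfm hR, ← hgn]
  gcongr

/-- The weighted `L²` norms of the oscillating kernels grow only polynomially in `n`, with the power
of the weight as exponent: induction on `k`, summing the commutator bound over `n`. -/
lemma exists_eLpNorm_wt_pow_mul_kern_osc_nat_le (μ : Measure M) [IsProbabilityMeasure μ]
    (φ : ℕ → M → ℝ) {α : ℝ} (hα : 0 < α) {D : ℝ} (hD : 0 < D) {q : ℝ} {k : ℕ}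
    (hq : α + 2 * k < q) :
    ∃ C, 0 < C ∧ ∀ (lam : ℕ → ℝ) (N : ℝ), IsSmoothing μ φ α D q lam N → ∀ (n : ℕ) (x : M),
      eLpNorm (fun z => ((wt N x z ^ k : ℝ) : ℂ) * kern φ (osc lam n) x z) 2 μ ≤
        ENNReal.ofReal (C * (1 + n) ^ k * N ^ (α / 2)) := by
  induction k with
  | zero =>
    obtain ⟨C, hC, hCb⟩ := exists_eLpNorm_wt_pow_mul_kern_lam_le μ φ hα hD hq
    refine ⟨C, hC, fun lam N h n x => ?_⟩
    have h0 := hCb lam N h x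
    simp only [pow_zero, Complex.ofReal_one, one_mul, mul_one] at h0 ⊢
    refine le_trans (le_of_eq ?_) h0
    induction n with
    | zero => simp_rw [Nat.cast_zero, osc_zero]
    | succ n ih =>
      rw [← ih]
      simp_rw [h.kern_osc_succ n x]
      exact h.eLpNorm_add_integral_kern h.norm_expSubOne_le (norm_one_add_expSubOne lam)
        (h.measurable_kern_right (h.norm_osc_le n) x) (fun z => (h.hasSum_kern (h.norm_osc_le n) x z).2)
  | succ k ih =>
    push_cast at hq
    obtain ⟨C, hC, hCb⟩ := ih (by linarith)
    obtain ⟨C₀, hC₀, hCb₀⟩ := exists_eLpNorm_wt_pow_mul_kern_lam_le μ φ hα hD (k := k + 1) (q := q)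
      (by push_cast; linarith)
    obtain ⟨C₁, hC₁, hCb₁⟩ := exists_lintegral_kern_lam_le μ φ hα D (k := k + 1) (q := q)
      (by push_cast; linarith [(Nat.cast_nonneg k : (0 : ℝ) ≤ k)])
    set E := Real.exp (2 * Real.pi * (C₁ * D * D)) with hE
    have hEpos : 0 < E := Real.exp_pos _
    refine ⟨C₀ + E * ((k + 1) * C), by positivity, fun lam N h n x => ?_⟩
    have hN := h.N_pos
    have hJ : ∀ x, ∫⁻ y, wkern φ (expSubOne lam) N (k + 1) x y ∂μ ≤ ENNReal.ofReal E := by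
      refine h.lintegral_kern_expSubOne_le (by positivity) fun x => ?_
      have := hCb₁ lam N h μ D 0 x hD le_rfl (h.ball' x)
      rwa [mul_zero, Real.zero_rpow hα.ne', add_zero, mul_one] at this
    have key : eLpNorm (fun z => ((wt N x z ^ (k + 1) : ℝ) : ℂ) * kern φ (osc lam n) x z) 2 μ ≤
        ENNReal.ofReal ((C₀ + E * ((k + 1) * C) * (n * (1 + n) ^ k)) * N ^ (α / 2)) := by
      induction n with
      | zero =>
        simp_rw [Nat.cast_zero, osc_zero]
        simpa using hCb₀ lam N h x
      | succ n ihn =>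
        refine (h.eLpNorm_commutator_le hJ n x).trans ((add_le_add ihn
          (mul_le_mul_right (mul_le_mul_right (hCb lam N h n x) _) _)).trans ?_)
        have e : ((k : ℝ≥0∞) + 1) = ENNReal.ofReal (k + 1) := by
          rw [ENNReal.ofReal_add (by positivity) zero_le_one]; simp
        rw [e, ← ENNReal.ofReal_mul (by positivity), ← ENNReal.ofReal_mul (by positivity),
          ← ENNReal.ofReal_add (by positivity) (by positivity)]
        refine ENNReal.ofReal_le_ofReal ?_
        have h1 : (1 + (n : ℝ)) ^ k ≤ (1 + ((n + 1 : ℕ) : ℝ)) ^ k := by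
          gcongr; omega
        calc _ = (C₀ + E * ((k + 1) * C) * ((n + 1) * (1 + n) ^ k)) * N ^ (α / 2) := by ring
          _ ≤ (C₀ + E * ((k + 1) * C) * ((n + 1) * (1 + ((n + 1 : ℕ) : ℝ)) ^ k)) * N ^ (α / 2) := by
            gcongr
          _ = _ := by push_cast; ring
    refine key.trans (ENNReal.ofReal_le_ofReal ?_)
    have h2 : (1 : ℝ) ≤ (1 + n) ^ (k + 1) := one_le_pow₀ (by linarith [(Nat.cast_nonneg n : (0:ℝ) ≤ n)])
    have h3 : (n : ℝ) * (1 + n) ^ k ≤ (1 + n) ^ (k + 1) := by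
      rw [pow_succ']; gcongr; linarith
    refine mul_le_mul_of_nonneg_right ?_ (by positivity)
    calc _ ≤ C₀ * (1 + n) ^ (k + 1) + E * ((k + 1) * C) * (1 + n) ^ (k + 1) :=
          add_le_add (le_mul_of_one_le_right hC₀.le h2)
            (mul_le_mul_of_nonneg_left h3 (by positivity))
      _ = _ := by ring

end IsSmoothing

/-! ### Kernels of smooth multipliers -/

namespace IsSmoothing

variable {M : Type*} [MetricSpace M] [CompactSpace M] [MeasurableSpace M] [BorelSpace M]
  {μ : Measure M} [IsProbabilityMeasure μ] {φ : ℕ → M → ℝ} {α D q : ℝ} {lam : ℕ → ℝ} {N : ℝ}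

lemma measurable_wt_rpow_mul (h : IsSmoothing μ φ α D q lam N) (s : ℝ) (x : M) {a : ℕ → ℂ} {Λ : ℝ}
    (ha : ∀ j, ‖a j‖ ≤ Λ * lam j) :
    Measurable fun z => ((wt N x z ^ s : ℝ) : ℂ) * kern φ a x z :=
  (Complex.measurable_ofReal.comp ((measurable_wt_right x N).pow_const s)).mul
    (h.measurable_kern_right ha x)

/-- Fractional weights, by interpolation between the weights `1` and `wt ^ S`. -/
lemma exists_eLpNorm_wt_rpow_mul_kern_osc_le (μ : Measure M) [IsProbabilityMeasure μ]
    (φ : ℕ → M → ℝ) {α : ℝ} (hα : 0 < α) {D : ℝ} (hD : 0 < D) {q : ℝ} {S : ℕ}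
    (hq : α + 2 * S < q) {s : ℝ} (hs : 0 ≤ s) (hsS : s ≤ S) :
    ∃ C, 0 < C ∧ ∀ (lam : ℕ → ℝ) (N : ℝ), IsSmoothing μ φ α D q lam N → ∀ (n : ℤ) (x : M),
      eLpNorm (fun z => ((wt N x z ^ s : ℝ) : ℂ) * kern φ (osc lam n) x z) 2 μ ≤
        ENNReal.ofReal (C * (1 + |(n : ℝ)|) ^ s * N ^ (α / 2)) := by
  obtain ⟨C₀, hC₀, hCb₀⟩ := exists_eLpNorm_wt_pow_mul_kern_osc_nat_le μ φ hα hD (k := 0) (q := q)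
    (by push_cast; linarith [(Nat.cast_nonneg S : (0 : ℝ) ≤ S)])
  obtain ⟨C₁, hC₁, hCb₁⟩ := exists_eLpNorm_wt_pow_mul_kern_osc_nat_le μ φ hα hD hq
  refine ⟨C₀ + C₁, by positivity, fun lam N h n x => ?_⟩
  have hN := h.N_pos
  wlog hn : 0 ≤ n generalizing n
  · have := this (-n) (by omega)
    have e : |((-n : ℤ) : ℝ)| = |(n : ℝ)| := by push_cast; exact abs_neg _
    rw [e] at this
    refine le_trans (le_of_eq (eLpNorm_congr_norm_ae (Eventually.of_forall fun z => ?_))) this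
    rw [norm_mul, norm_mul, kern_osc_neg, RCLike.norm_conj]
  obtain ⟨n, rfl⟩ := Int.eq_ofNat_of_zero_le hn
  have eA : 1 + |((n : ℤ) : ℝ)| = 1 + (n : ℝ) := by simp
  rw [eA]
  set A : ℝ := 1 + n with hA
  have hA1 : 1 ≤ A := by linarith [(Nat.cast_nonneg n : (0 : ℝ) ≤ n)]
  have hA0 : 0 < A := by linarith
  have h0 := hCb₀ lam N h n x
  have h1 := hCb₁ lam N h n x
  simp only [pow_zero, Complex.ofReal_one, one_mul, mul_one] at h0
  have hm0 := h.measurable_kern_right (h.norm_osc_le n) x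
  have hm1 := h.measurable_wt_pow_mul S x (h.norm_osc_le n)
  have hpt : ∀ z, ‖((wt N x z ^ s : ℝ) : ℂ) * kern φ (osc lam n) x z‖ ≤
      ‖A ^ s * ‖kern φ (osc lam n) x z‖ +
        A ^ (s - S) * ‖((wt N x z ^ S : ℝ) : ℂ) * kern φ (osc lam n) x z‖‖ := by
    intro z
    have hw := wt_pos hN x z
    have hle : wt N x z ^ s ≤ A ^ s + A ^ (s - S) * wt N x z ^ S := by
      rcases le_total (wt N x z) A with hwA | hwA
      · exact (Real.rpow_le_rpow hw.le hwA hs).trans (le_add_of_nonneg_right (by positivity))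
      · refine le_add_of_nonneg_of_le (by positivity) ?_
        calc wt N x z ^ s = wt N x z ^ (s - S) * wt N x z ^ S := by
              rw [← Real.rpow_natCast, ← Real.rpow_add hw]; congr 1; ring
          _ ≤ _ := mul_le_mul_of_nonneg_right
              (Real.rpow_le_rpow_of_nonpos hA0 hwA (by linarith)) (by positivity)
    rw [norm_mul, Complex.norm_real, Real.norm_of_nonneg (by positivity), norm_mul,
      Complex.norm_real, Real.norm_of_nonneg (by positivity : 0 ≤ wt N x z ^ S),
      Real.norm_of_nonneg (by positivity), ← mul_assoc, ← add_mul]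
    gcongr
  refine (eLpNorm_mono hpt).trans ?_
  have hadd := eLpNorm_add_le (f := A ^ s • fun z => ‖kern φ (osc lam n) x z‖)
    (g := A ^ (s - S) • fun z => ‖((wt N x z ^ S : ℝ) : ℂ) * kern φ (osc lam n) x z‖)
    (hm0.norm.aestronglyMeasurable.const_smul _)
    (hm1.norm.aestronglyMeasurable.const_smul _) one_le_two (μ := μ)
  refine hadd.trans ?_
  rw [eLpNorm_const_smul, eLpNorm_const_smul, eLpNorm_norm, eLpNorm_norm, ← ofReal_norm,
    ← ofReal_norm, Real.norm_of_nonneg (by positivity : 0 ≤ A ^ s),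
    Real.norm_of_nonneg (by positivity : 0 ≤ A ^ (s - S))]
  refine (add_le_add (mul_le_mul_right h0 _) (mul_le_mul_right h1 _)).trans ?_
  rw [← ENNReal.ofReal_mul (by positivity), ← ENNReal.ofReal_mul (by positivity),
    ← ENNReal.ofReal_add (by positivity) (by positivity)]
  refine ENNReal.ofReal_le_ofReal (le_of_eq ?_)
  have : A ^ (s - S) * A ^ S = A ^ s := by
    rw [← Real.rpow_natCast, ← Real.rpow_add hA0]; congr 1; ring
  linear_combination (C₁ * N ^ (α / 2)) * this

/-- A weighted `L²` bound for the kernel of `m(lam) lam`, from the absolutely convergent Fourier series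
of `m`. -/
lemma exists_eLpNorm_wt_rpow_mul_kern_le (μ : Measure M) [IsProbabilityMeasure μ]
    (φ : ℕ → M → ℝ) {α : ℝ} (hα : 0 < α) {D : ℝ} (hD : 0 < D) {q : ℝ} {S : ℕ}
    (hq : α + 2 * S < q) {s : ℝ} (hs : 0 ≤ s) (hsS : s ≤ S) :
    ∃ C, 0 < C ∧ ∀ (lam : ℕ → ℝ) (N : ℝ), IsSmoothing μ φ α D q lam N →
      ∀ (m : ℝ → ℝ) (c : ℤ → ℂ) (C₁ : ℝ), Summable (fun n : ℤ => ‖c n‖ * (1 + |(n : ℝ)|) ^ s) →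
      ∑' n : ℤ, ‖c n‖ * (1 + |(n : ℝ)|) ^ s ≤ C₁ →
      (∀ u ∈ Set.Icc (0 : ℝ) 1, HasSum (fun n : ℤ => c n *
        Complex.exp (2 * Real.pi * Complex.I * n * u)) (m u : ℂ)) →
      (∀ j, ‖(m (lam j) * lam j : ℂ)‖ ≤ C₁ * lam j) ∧
      ∀ x, eLpNorm (fun z => ((wt N x z ^ s : ℝ) : ℂ) * kern φ (fun j => m (lam j) * lam j) x z) 2 μ ≤
        ENNReal.ofReal (C * C₁ * N ^ (α / 2)) := by
  obtain ⟨C, hC, hCb⟩ := exists_eLpNorm_wt_rpow_mul_kern_osc_le μ φ hα hD hq hs hsS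
  refine ⟨C, hC, fun lam N h m c C₁ hc hC₁ hm => ?_⟩
  have hN := h.N_pos
  have hcn : ∀ n, ‖c n‖ ≤ ‖c n‖ * (1 + |(n : ℝ)|) ^ s := fun n =>
    le_mul_of_one_le_right (norm_nonneg _) (Real.one_le_rpow (by linarith [abs_nonneg (n : ℝ)]) hs)
  have hcs : Summable fun n => ‖c n‖ := hc.of_nonneg_of_le (fun n => norm_nonneg _) hcn
  have hexp : ∀ (n : ℤ) (u : ℝ), ‖Complex.exp (2 * Real.pi * Complex.I * n * u)‖ = 1 := fun n u => by
    have : (2 * Real.pi * Complex.I * n * u : ℂ) =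
      ((2 * Real.pi * n * u : ℝ) : ℂ) * Complex.I := by push_cast; ring
    rw [this, Complex.norm_exp_ofReal_mul_I]
  have hdom : ∀ j, ‖(m (lam j) * lam j : ℂ)‖ ≤ C₁ * lam j := fun j => by
    rw [norm_mul, Complex.norm_real (lam j), Real.norm_of_nonneg (h.nonneg j)]
    refine mul_le_mul_of_nonneg_right ?_ (h.nonneg j)
    rw [← (hm (lam j) ⟨h.nonneg j, h.le_one j⟩).tsum_eq]
    refine (tsum_of_norm_bounded hcs.hasSum fun n => ?_).trans ((hcs.tsum_le_tsum hcn hc).trans hC₁)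
    rw [norm_mul, hexp, mul_one]
  refine ⟨hdom, fun x => ?_⟩
  have hsum : ∀ z, HasSum (fun n : ℤ => c n * (((wt N x z ^ s : ℝ) : ℂ) * kern φ (osc lam n) x z))
      (((wt N x z ^ s : ℝ) : ℂ) * kern φ (fun j => m (lam j) * lam j) x z) := by
    intro z
    have hs2 : Summable (Function.uncurry fun (n : ℤ) (j : ℕ) =>
        c n * (osc lam n j * φ j x * φ j z)) := by
      refine Summable.of_norm_bounded (hcs.mul_of_nonneg (h.summable_abs x z).1
        (fun n => norm_nonneg _) (fun j => mul_nonneg (h.nonneg j) (by positivity))) fun ⟨n, j⟩ => ?_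
      simp only [Function.uncurry]
      rw [norm_mul, norm_mul, norm_mul, norm_osc, abs_of_nonneg (h.nonneg j), Complex.norm_real,
        Complex.norm_real, Real.norm_eq_abs, Real.norm_eq_abs, mul_assoc]
    have e1 : ∀ n, HasSum (fun j => c n * (osc lam n j * φ j x * φ j z))
        (c n * kern φ (osc lam n) x z) := fun n =>
      (h.hasSum_kern (h.norm_osc_le n) x z).1.mul_left _
    have e2 : ∀ j, HasSum (fun n => c n * (osc lam n j * φ j x * φ j z))
        (m (lam j) * lam j * φ j x * φ j z) := fun j => by
      have := (hm (lam j) ⟨h.nonneg j, h.le_one j⟩).mul_right (lam j * φ j x * φ j z : ℂ)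
      have e3 : (m (lam j) * lam j * φ j x * φ j z : ℂ) = m (lam j) * (lam j * φ j x * φ j z) := by
        ring
      have e4 : (fun n : ℤ => c n * (osc lam n j * φ j x * φ j z)) = fun n : ℤ => c n *
          Complex.exp (2 * Real.pi * Complex.I * n * lam j) * (lam j * φ j x * φ j z) := by
        funext n; rw [osc]; ring
      rw [e3, e4]
      exact this
    have e5 := hs2.hasSum.prod_fiberwise e1
    have e6 : ∑' p : ℤ × ℕ, Function.uncurry (fun (n : ℤ) (j : ℕ) =>
        c n * (osc lam n j * φ j x * φ j z)) p = kern φ (fun j => m (lam j) * lam j) x z := by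
      have := (Equiv.prodComm ℕ ℤ).hasSum_iff.2 hs2.hasSum
      exact (this.prod_fiberwise e2).tsum_eq.symm
    rw [e6] at e5
    have := e5.mul_left ((wt N x z ^ s : ℝ) : ℂ)
    have e7 : (fun n : ℤ => c n * (((wt N x z ^ s : ℝ) : ℂ) * kern φ (osc lam n) x z)) =
        fun n : ℤ => ((wt N x z ^ s : ℝ) : ℂ) * (c n * kern φ (osc lam n) x z) := by
      funext n; ring
    rw [e7]
    exact this
  refine (eLpNorm_le_tsum (fun n => (((h.measurable_wt_rpow_mul s x
    (h.norm_osc_le n)).const_mul (c n)).aestronglyMeasurable)) (Eventually.of_forall hsum)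
    one_le_two).trans ?_
  calc ∑' n : ℤ, eLpNorm (fun z => c n * (((wt N x z ^ s : ℝ) : ℂ) * kern φ (osc lam n) x z)) 2 μ
      ≤ ∑' n : ℤ, ENNReal.ofReal (‖c n‖ * (1 + |(n : ℝ)|) ^ s * (C * N ^ (α / 2))) := by
        refine ENNReal.tsum_le_tsum fun n => ?_
        have e : (fun z => c n * (((wt N x z ^ s : ℝ) : ℂ) * kern φ (osc lam n) x z)) =
          c n • fun z => ((wt N x z ^ s : ℝ) : ℂ) * kern φ (osc lam n) x z := rfl
        rw [e, eLpNorm_const_smul, ← ofReal_norm]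
        refine (mul_le_mul_right (hCb lam N h n x) _).trans (le_of_eq ?_)
        rw [← ENNReal.ofReal_mul (norm_nonneg _)]
        congr 1; ring
    _ = ENNReal.ofReal ((∑' n : ℤ, ‖c n‖ * (1 + |(n : ℝ)|) ^ s) * (C * N ^ (α / 2))) := by
        rw [← ENNReal.ofReal_tsum_of_nonneg (fun n => by positivity) (hc.mul_right _),
          tsum_mul_right]
    _ ≤ _ := by
        refine ENNReal.ofReal_le_ofReal ?_
        calc _ ≤ C₁ * (C * N ^ (α / 2)) := by gcongr
          _ = _ := by ring

/-- The `L¹` bound for the kernel of a smooth multiplier, uniform in the scale: writing the kernel as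
the heat kernel applied to that of `m(lam) lam` moves the weighted `L²` bound from `μ` to `ν`, and
the Cauchy-Schwarz inequality against `wt ^ (-2s)`, integrable as `2s > α`, does the rest. -/
theorem exists_lintegral_kern_le (μ : Measure M) [IsProbabilityMeasure μ]
    (φ : ℕ → M → ℝ) {α : ℝ} (hα : 0 < α) {D : ℝ} (hD : 0 < D) {q : ℝ} {S : ℕ}
    (hq : α + 2 * S < q) {s : ℝ} (hs : α < 2 * s) (hsS : s ≤ S) :
    ∃ C, 0 < C ∧ ∀ (lam : ℕ → ℝ) (N : ℝ), IsSmoothing μ φ α D q lam N →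
      ∀ (m : ℝ → ℝ) (c : ℤ → ℂ) (C₁ : ℝ), Summable (fun n : ℤ => ‖c n‖ * (1 + |(n : ℝ)|) ^ s) →
      ∑' n : ℤ, ‖c n‖ * (1 + |(n : ℝ)|) ^ s ≤ C₁ →
      (∀ u ∈ Set.Icc (0 : ℝ) 1, HasSum (fun n : ℤ => c n *
        Complex.exp (2 * Real.pi * Complex.I * n * u)) (m u : ℂ)) →
      ∀ (ν : Measure M) [SFinite ν] (D' d : ℝ), 0 < D' → 0 ≤ d →
      (∀ x s, 0 < s → ν (Metric.closedBall x s) ≤ ENNReal.ofReal (D' * (s ^ α + d ^ α))) →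
      ∀ x, ∫⁻ y, ‖kern φ (fun j => m (lam j) * lam j ^ 2) x y‖ₑ ∂ν ≤
        ENNReal.ofReal (C * C₁ * (D' * (1 + (N * d) ^ α))) := by
  have hs0 : 0 ≤ s := by linarith
  obtain ⟨C₂, hC₂, hCb₂⟩ := exists_eLpNorm_wt_rpow_mul_kern_le μ φ hα hD hq hs0 hsS
  obtain ⟨C₃, hC₃, hCb₃⟩ := exists_lintegral_kern_lam_le μ φ hα D (k := S) (q := q)
    (by linarith [(Nat.cast_nonneg S : (0 : ℝ) ≤ S)])
  obtain ⟨C₄, hC₄, hCb₄⟩ := exists_lintegral_decay_le hα hs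
  refine ⟨C₄ ^ (1 / 2 : ℝ) * (C₃ * D * D) ^ (1 / 2 : ℝ) * (C₃ * D) ^ (1 / 2 : ℝ) * C₂,
    by positivity, fun lam N h m c C₁ hc hC₁ hm ν _ D' d hD' hd hν x => ?_⟩
  have hN := h.N_pos
  have hC₁0 : 0 ≤ C₁ := (tsum_nonneg fun n => by positivity).trans hC₁
  obtain ⟨hdom, hv⟩ := hCb₂ lam N h m c C₁ hc hC₁ hm
  set v : M → ℂ := kern φ (fun j => (m (lam j) : ℂ) * lam j) x with hvdef
  have hdom2 : ∀ j, ‖(m (lam j) * lam j ^ 2 : ℂ)‖ ≤ C₁ * lam j := fun j => by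
    rw [sq, ← mul_assoc, norm_mul, Complex.norm_real (lam j), Real.norm_of_nonneg (h.nonneg j)]
    exact (mul_le_of_le_one_right (norm_nonneg _) (h.le_one j)).trans (hdom j)
  have hcomp : ∀ y, kern φ (fun j => m (lam j) * lam j ^ 2) x y =
      ∫ z, v z * kern φ (fun j => (lam j : ℂ)) z y ∂μ := fun y => by
    rw [h.integral_kern_mul_kern hdom h.norm_lam_le]
    congr 1; ext j; ring
  set X : ℝ := 1 + (N * d) ^ α with hX
  have hX0 : 0 < X := by positivity
  set F : M → ℂ := fun y =>
    ((wt N x y ^ s : ℝ) : ℂ) * kern φ (fun j => m (lam j) * lam j ^ 2) x y with hF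
  have hFm : Measurable F := h.measurable_wt_rpow_mul s x hdom2
  have hFb : ∀ y, ‖F y‖ₑ ≤ ∫⁻ z, wkern φ (fun j => (lam j : ℂ)) N S y z *
      ‖((wt N x z ^ s : ℝ) : ℂ) * v z‖ₑ ∂μ := by
    intro y
    rw [hF]
    beta_reduce
    rw [hcomp, ← integral_const_mul]
    refine (enorm_integral_le_lintegral_enorm _).trans (lintegral_mono fun z => ?_)
    beta_reduce
    rw [wkern_symm, wkern, ← ofReal_norm, ← ofReal_norm, ← ofReal_norm,
      ← ENNReal.ofReal_mul (norm_nonneg _)]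
    have hwy := wt_pos hN z y
    have hwx := wt_pos hN x z
    have hwxy := wt_pos hN x y
    rw [← ENNReal.ofReal_mul (by positivity)]
    refine ENNReal.ofReal_le_ofReal ?_
    rw [norm_mul, norm_mul, norm_mul, Complex.norm_real, Complex.norm_real,
      Real.norm_of_nonneg (by positivity), Real.norm_of_nonneg (by positivity)]
    have hw : wt N x y ^ s ≤ wt N x z ^ s * wt N z y ^ S := by
      calc wt N x y ^ s ≤ (wt N x z * wt N z y) ^ s :=
            Real.rpow_le_rpow hwxy.le (wt_le_mul hN x z y) hs0
        _ = wt N x z ^ s * wt N z y ^ s := Real.mul_rpow hwx.le hwy.le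
        _ ≤ wt N x z ^ s * wt N z y ^ S := by
            gcongr
            rw [← Real.rpow_natCast]
            exact Real.rpow_le_rpow_of_exponent_le (one_le_wt hN z y) hsS
    calc _ ≤ (wt N x z ^ s * wt N z y ^ S) *
          (‖v z‖ * ‖kern φ (fun j => (lam j : ℂ)) z y‖) := by gcongr
      _ = _ := by ring
  have hFn : eLpNorm F 2 ν ≤ ENNReal.ofReal ((C₃ * D * D) ^ (1 / 2 : ℝ) *
      (C₃ * D * D' * X) ^ (1 / 2 : ℝ) * (C₂ * C₁ * N ^ (α / 2))) := by
    have ha : ∀ y, ∫⁻ z, wkern φ (fun j => (lam j : ℂ)) N S y z ∂μ ≤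
        ENNReal.ofReal (C₃ * D * D) := fun y => by
      have := hCb₃ lam N h μ D 0 y hD le_rfl (h.ball' y)
      rwa [mul_zero, Real.zero_rpow hα.ne', add_zero, mul_one] at this
    have hb : ∀ z, ∫⁻ y, wkern φ (fun j => (lam j : ℂ)) N S y z ∂ν ≤
        ENNReal.ofReal (C₃ * D * D' * X) := fun z => by
      simp_rw [wkern_symm φ _ N S _ z]
      exact hCb₃ lam N h ν D' d z hD' hd (hν z)
    have := eLpNorm_le_of_schur (h.measurable_wkern h.norm_lam_le S)
      (h.measurable_wt_rpow_mul s x hdom).aestronglyMeasurable ha hb hFb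
      (inferInstance : ENNReal.HolderConjugate 2 2)
    refine this.trans ((mul_le_mul_right (hv x) _).trans (le_of_eq ?_))
    have e2 : ((2 : ℝ≥0∞)⁻¹).toReal = 1 / 2 := by simp
    rw [e2, ENNReal.ofReal_rpow_of_nonneg (by positivity) (by norm_num),
      ENNReal.ofReal_rpow_of_nonneg (by positivity) (by norm_num),
      ← ENNReal.ofReal_mul (by positivity), ← ENNReal.ofReal_mul (by positivity)]
  have hW : ∫⁻ y, ENNReal.ofReal (wt N x y ^ (-(2 * s))) ∂ν ≤
      ENNReal.ofReal (C₄ * D' * (N ^ (-α) * X)) := by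
    refine (hCb₄ ν D' N d x hD' hN hd (hν x)).trans (le_of_eq ?_)
    congr 2
    rw [hX, Real.mul_rpow hN.le hd, Real.rpow_neg hN.le]
    field_simp
  calc ∫⁻ y, ‖kern φ (fun j => m (lam j) * lam j ^ 2) x y‖ₑ ∂ν
      = ∫⁻ y, ENNReal.ofReal (wt N x y ^ (-(2 * s))) ^ (1 / 2 : ℝ) *
          (‖F y‖ₑ ^ (2 : ℝ)) ^ (1 / 2 : ℝ) ∂ν := by
        refine lintegral_congr fun y => ?_
        have hw := wt_pos hN x y
        rw [← ENNReal.rpow_mul, mul_one_div_cancel two_ne_zero, ENNReal.rpow_one, hF]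
        beta_reduce
        rw [enorm_mul, ← ofReal_norm (((wt N x y ^ s : ℝ) : ℂ)), Complex.norm_real,
          Real.norm_of_nonneg (by positivity), ← mul_assoc,
          ENNReal.ofReal_rpow_of_nonneg (by positivity) (by norm_num),
          ← ENNReal.ofReal_mul (by positivity), ← Real.rpow_mul hw.le, ← Real.rpow_add hw]
        ring_nf
        simp
    _ ≤ (∫⁻ y, ENNReal.ofReal (wt N x y ^ (-(2 * s))) ∂ν) ^ (1 / 2 : ℝ) *
          (∫⁻ y, ‖F y‖ₑ ^ (2 : ℝ) ∂ν) ^ (1 / 2 : ℝ) :=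
        ENNReal.lintegral_mul_norm_pow_le
          (((measurable_wt_right x N).pow_const _).ennreal_ofReal.aemeasurable)
          (hFm.enorm.pow_const _).aemeasurable (by norm_num) (by norm_num) (by norm_num)
    _ = (∫⁻ y, ENNReal.ofReal (wt N x y ^ (-(2 * s))) ∂ν) ^ (1 / 2 : ℝ) * eLpNorm F 2 ν := by
        rw [eLpNorm_eq_lintegral_rpow_enorm_toReal two_ne_zero ENNReal.ofNat_ne_top]
        simp only [ENNReal.toReal_ofNat]
    _ ≤ ENNReal.ofReal (C₄ * D' * (N ^ (-α) * X)) ^ (1 / 2 : ℝ) *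
          ENNReal.ofReal ((C₃ * D * D) ^ (1 / 2 : ℝ) *
          (C₃ * D * D' * X) ^ (1 / 2 : ℝ) * (C₂ * C₁ * N ^ (α / 2))) := by
        gcongr
    _ = _ := by
        rw [ENNReal.ofReal_rpow_of_nonneg (by positivity) (by norm_num),
          ← ENNReal.ofReal_mul (by positivity)]
        congr 1
        have e1 : (C₄ * D' * (N ^ (-α) * X)) ^ (1 / 2 : ℝ) =
            C₄ ^ (1 / 2 : ℝ) * (N ^ (-α)) ^ (1 / 2 : ℝ) * (D' * X) ^ (1 / 2 : ℝ) := by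
          rw [← Real.mul_rpow (by positivity) (by positivity),
            ← Real.mul_rpow (by positivity) (by positivity)]
          congr 1; ring
        have e2 : (C₃ * D * D' * X) ^ (1 / 2 : ℝ) =
            (C₃ * D) ^ (1 / 2 : ℝ) * (D' * X) ^ (1 / 2 : ℝ) := by
          rw [← Real.mul_rpow (by positivity) (by positivity)]
          congr 1; ring
        have e3 : (D' * X) ^ (1 / 2 : ℝ) * (D' * X) ^ (1 / 2 : ℝ) = D' * X := by
          rw [← Real.rpow_add (by positivity)]; norm_num
        have e4 : (N ^ (-α)) ^ (1 / 2 : ℝ) * N ^ (α / 2) = 1 := by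
          rw [← Real.rpow_mul hN.le, ← Real.rpow_add hN]
          convert Real.rpow_zero N using 2; ring
        rw [e1, e2]
        calc _ = C₄ ^ (1 / 2 : ℝ) * (C₃ * D * D) ^ (1 / 2 : ℝ) * (C₃ * D) ^ (1 / 2 : ℝ) * C₂ * C₁ *
              ((D' * X) ^ (1 / 2 : ℝ) * (D' * X) ^ (1 / 2 : ℝ)) *
              ((N ^ (-α)) ^ (1 / 2 : ℝ) * N ^ (α / 2)) := by ring
          _ = _ := by rw [e3, e4, mul_one]

end IsSmoothing

/-! ### The heat kernel: full support and completeness -/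

/-- The assumptions on the measure and the system that the argument uses: the dimension bound, and
that the heat kernel has integral `1` and Gaussian decay. -/
structure IsHeatSystem {M : Type*} [MetricSpace M] [MeasurableSpace M] (μ : Measure M)
    (φ : ℕ → M → ℝ) (ℓ : ℕ → ℝ) (α : ℝ) : Prop where
  alpha_pos : 0 < α
  ball : BallMeasureBound μ α
  sys : IsSystem μ φ ℓ
  int : ∀ t ∈ Set.Ioc (0 : ℝ) 1, ∀ x, ∫ y, heatKernel φ ℓ t x y ∂μ = 1
  gauss : GaussianBound φ ℓ α

/-- The eigenvalues `exp(-ℓ_j² a / N²)` of the heat operator at time `a / N²`. -/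
noncomputable def heatEig (ℓ : ℕ → ℝ) (a N : ℝ) (j : ℕ) : ℝ := Real.exp (-(ℓ j) ^ 2 * (a / N ^ 2))

/-- Gaussian decay beats any power. -/
lemma exp_neg_mul_sq_le {c q R : ℝ} (hc : 0 < c) (hq : 0 ≤ q) (hR : 0 ≤ R) :
    Real.exp (-c * R ^ 2) ≤ Real.exp (q ^ 2 / (4 * c)) * (1 + R) ^ (-q) := by
  have h1 : (1 + R) ^ q ≤ Real.exp (q * R) := by
    calc (1 + R) ^ q ≤ Real.exp R ^ q :=
          Real.rpow_le_rpow (by linarith) (by linarith [Real.add_one_le_exp R]) hq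
      _ = Real.exp (q * R) := by rw [← Real.exp_mul, mul_comm]
  have h2 : q * R - c * R ^ 2 ≤ q ^ 2 / (4 * c) := by
    rw [le_div_iff₀ (by positivity)]
    nlinarith [sq_nonneg (2 * c * R - q)]
  have h0 : (0 : ℝ) < 1 + R := by linarith
  rw [Real.rpow_neg h0.le, ← div_eq_mul_inv, le_div_iff₀ (by positivity)]
  calc Real.exp (-c * R ^ 2) * (1 + R) ^ q ≤ Real.exp (-c * R ^ 2) * Real.exp (q * R) := by gcongr
    _ = Real.exp (q * R - c * R ^ 2) := by rw [← Real.exp_add]; ring_nf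
    _ ≤ _ := Real.exp_le_exp.2 h2

namespace IsHeatSystem

variable {M : Type*} [MetricSpace M] [CompactSpace M] [MeasurableSpace M] [BorelSpace M]
  {μ : Measure M} [IsProbabilityMeasure μ] {φ : ℕ → M → ℝ} {ℓ : ℕ → ℝ} {α : ℝ}

lemma ell_nonneg (H : IsHeatSystem μ φ ℓ α) (j : ℕ) : 0 ≤ ℓ j :=
  H.sys.ell_zero ▸ H.sys.ell_mono (Nat.zero_le j)

lemma exists_isSmoothing (H : IsHeatSystem μ φ ℓ α) {q : ℝ} (hq : 0 ≤ q) {a : ℝ} (ha : 0 < a) :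
    ∃ D, 0 < D ∧ ∀ N, 0 < N → a ≤ N ^ 2 → IsSmoothing μ φ α D q (heatEig ℓ a N) N := by
  obtain ⟨c₀, hc₀, hball⟩ := H.ball
  obtain ⟨c, hc, c₁, hc₁, hG⟩ := H.gauss
  set D₁ := c₁ * a ^ (-α / 2) * Real.exp (q ^ 2 / (4 * (c / a))) with hD₁
  have hD₁0 : 0 < D₁ := by positivity
  refine ⟨c₀ + D₁, by positivity, fun N hN haN => ?_⟩
  have ht : a / N ^ 2 ∈ Set.Ioc (0 : ℝ) 1 :=
    ⟨by positivity, (div_le_one (by positivity)).2 haN⟩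
  refine ⟨H.sys.continuous, H.sys.orthonormal, H.alpha_pos, by positivity, hN, fun x s hs => ?_,
    fun j => (Real.exp_pos _).le, fun j => ?_, fun x y => (hG _ ht x y).1, fun x y => ?_⟩
  · rw [← ENNReal.ofReal_toReal (measure_ne_top μ (Metric.closedBall x s))]
    refine ENNReal.ofReal_le_ofReal ((hball x s hs).trans ?_)
    gcongr
    linarith
  · rw [heatEig, Real.exp_le_one_iff]
    have := sq_nonneg (ℓ j)
    nlinarith [ht.1]
  · refine (hG _ ht x y).2.trans ?_
    have e1 : -c * dist x y ^ 2 / (a / N ^ 2) = -(c / a) * (N * dist x y) ^ 2 := by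
      field_simp
    have e2 : (a / N ^ 2) ^ (-α / 2) = a ^ (-α / 2) * N ^ α := by
      rw [Real.div_rpow ha.le (by positivity), ← Real.rpow_natCast, ← Real.rpow_mul hN.le,
        div_eq_mul_inv, ← Real.rpow_neg hN.le]
      congr 2; push_cast; ring
    rw [e1, e2]
    have hR : 0 ≤ N * dist x y := by positivity
    calc c₁ * (a ^ (-α / 2) * N ^ α) * Real.exp (-(c / a) * (N * dist x y) ^ 2)
        ≤ c₁ * (a ^ (-α / 2) * N ^ α) * (Real.exp (q ^ 2 / (4 * (c / a))) *
          (1 + N * dist x y) ^ (-q)) := by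
          gcongr
          exact exp_neg_mul_sq_le (by positivity) hq hR
      _ = D₁ * N ^ α * (1 + N * dist x y) ^ (-q) := by rw [hD₁]; ring
      _ ≤ _ := by gcongr; linarith

lemma kern_heatEig (φ : ℕ → M → ℝ) (ℓ : ℕ → ℝ) (a N : ℝ) (x y : M) :
    kern φ (fun j => (heatEig ℓ a N j : ℂ)) x y = heatKernel φ ℓ (a / N ^ 2) x y := by
  rw [kern, heatKernel, Complex.ofReal_tsum]
  exact tsum_congr fun j => by rw [heatEig]; push_cast; rfl

lemma integral_kern_heatEig (H : IsHeatSystem μ φ ℓ α) {a N : ℝ} (ha : 0 < a) (hN : 0 < N)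
    (haN : a ≤ N ^ 2) (x : M) : ∫ y, kern φ (fun j => (heatEig ℓ a N j : ℂ)) x y ∂μ = 1 := by
  simp_rw [kern_heatEig]
  rw [integral_complex_ofReal,
    H.int _ ⟨by positivity, (div_le_one (by positivity)).2 haN⟩, Complex.ofReal_one]

/-- At every scale `1/N ≤ 1` the heat kernel of time `1/N²`, weighted by `1 + N ρ(x, y)`, is bounded
in `L¹`. -/
lemma exists_lintegral_wkern_heatEig_le (H : IsHeatSystem μ φ ℓ α) :
    ∃ B D, 0 < B ∧ ∀ N, 1 ≤ N → IsSmoothing μ φ α D (α + 2) (heatEig ℓ 1 N) N ∧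
      ∀ x, ∫⁻ y, wkern φ (fun j => (heatEig ℓ 1 N j : ℂ)) N 1 x y ∂μ ≤ ENNReal.ofReal B := by
  have hα := H.alpha_pos
  obtain ⟨D, hD, hS⟩ := H.exists_isSmoothing (q := α + 2) (by linarith) one_pos
  obtain ⟨C, hC, hCb⟩ := IsSmoothing.exists_lintegral_kern_lam_le μ φ hα D (k := 1) (q := α + 2)
    (by push_cast; linarith)
  refine ⟨C * D * D, D, by positivity, fun N hN => ?_⟩
  have h := hS N (by linarith) (by nlinarith)
  refine ⟨h, fun x => ?_⟩
  have := hCb _ N h μ D 0 x hD le_rfl (h.ball' x)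
  rwa [mul_zero, Real.zero_rpow hα.ne', add_zero, mul_one] at this

/-- The measure has full support: otherwise the heat kernel, which concentrates near the diagonal
as `t → 0`, could not have integral `1`. -/
lemma isOpenPosMeasure (H : IsHeatSystem μ φ ℓ α) : μ.IsOpenPosMeasure := by
  refine ⟨fun V hV hne h0 => ?_⟩
  obtain ⟨x, hx⟩ := hne
  obtain ⟨r, hr, hrV⟩ := Metric.isOpen_iff.1 hV x hx
  obtain ⟨B, D, hB, hS⟩ := H.exists_lintegral_wkern_heatEig_le
  set N : ℝ := max 1 (2 * B / r) with hN
  have hN1 : 1 ≤ N := le_max_left _ _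
  have hN0 : 0 < N := by linarith
  obtain ⟨h, hb⟩ := hS N hN1
  have hint := H.integral_kern_heatEig one_pos hN0 (by nlinarith) x
  have h1 : (1 : ℝ≥0∞) ≤ ∫⁻ y, ‖kern φ (fun j => (heatEig ℓ 1 N j : ℂ)) x y‖ₑ ∂μ := by
    have := enorm_integral_le_lintegral_enorm (μ := μ)
      (fun y => kern φ (fun j => (heatEig ℓ 1 N j : ℂ)) x y)
    rwa [hint, enorm_one] at this
  have hae : ∀ᵐ y ∂μ, r ≤ dist x y := by
    have : ∀ᵐ y ∂μ, y ∉ V := measure_eq_zero_iff_ae_notMem.1 h0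
    filter_upwards [this] with y hy
    by_contra hlt
    push Not at hlt
    exact hy (hrV (by rwa [Metric.mem_ball, dist_comm]))
  have h2 : ENNReal.ofReal (N * r) * ∫⁻ y, ‖kern φ (fun j => (heatEig ℓ 1 N j : ℂ)) x y‖ₑ ∂μ ≤
      ENNReal.ofReal B := by
    refine le_trans ?_ (hb x)
    rw [← lintegral_const_mul' _ _ ENNReal.ofReal_ne_top]
    refine lintegral_mono_ae ?_
    filter_upwards [hae] with y hy
    rw [wkern, mul_comm]
    gcongr
    rw [pow_one, wt]
    nlinarith
  have h3 : ENNReal.ofReal (N * r) ≤ ENNReal.ofReal B :=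
    (le_mul_of_one_le_right' h1).trans h2
  have h4 := (ENNReal.ofReal_le_ofReal_iff hB.le).1 h3
  have h5 : 2 * B ≤ N * r := by
    rw [← div_le_iff₀ hr]; exact le_max_right _ _
  linarith

/-- If `u` is orthogonal to all `φ_k`, then a function `g` that is close to `u` in `L¹` and almost
constant at the scale `1/N` of the heat kernel is small: write `g` as an average of `g(x) - g(y)`
and of `g - u` against the heat kernel. -/
lemma eLpNorm_le_of_coeff_eq_zero {D B δ N : ℝ}
    (h : IsSmoothing μ φ α D (α + 2) (heatEig ℓ 1 N) N)
    (hint : ∀ x, ∫ y, kern φ (fun j => (heatEig ℓ 1 N j : ℂ)) x y ∂μ = 1)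
    (hb : ∀ x, ∫⁻ y, wkern φ (fun j => (heatEig ℓ 1 N j : ℂ)) N 1 x y ∂μ ≤ ENNReal.ofReal B)
    (hB : 0 < B) (hδ : 0 < δ) {u g : M → ℂ} (hu : Integrable u μ)
    (h0 : ∀ k, ∫ y, φ k y * u y ∂μ = 0) (hgi : Integrable g μ)
    (hmod : ∀ x y, ‖g x - g y‖ ≤ wt N x y * (2 * δ))
    (hg : eLpNorm (u - g) 1 μ ≤ ENNReal.ofReal δ) :
    eLpNorm g 1 μ ≤ ENNReal.ofReal (3 * B * δ) := by
  have hN0 : 0 < N := h.N_pos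
  set K : M → M → ℂ := kern φ (fun j => (heatEig ℓ 1 N j : ℂ)) with hK
  have hKm := h.measurable_wkern h.norm_lam_le 1
  have hKi := fun x => h.integrable_kern h.norm_lam_le x
  have hKn := fun x y => (h.hasSum_kern h.norm_lam_le x y).2
  have hKu : ∀ x, ∫ y, K x y * u y ∂μ = 0 := fun x => by
    rw [hK, ← (h.hasSum_integral_kern_mul h.norm_lam_le hu x).tsum_eq]
    simp [h0]
  have hKg : ∀ {f : M → ℂ} x, Integrable f μ → Integrable (fun y => K x y * f y) μ := fun x hf =>
      hf.bdd_mul (hKi x).aestronglyMeasurable (Eventually.of_forall (hKn x))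
  have hrep : ∀ x, g x = (∫ y, K x y * (g x - g y) ∂μ) + ∫ y, K x y * (g y - u y) ∂μ := by
    intro x
    have i1 : Integrable (fun y => K x y * (g x - g y)) μ :=
      hKg x ((integrable_const _).sub hgi)
    have i2 : Integrable (fun y => K x y * (g y - u y)) μ := hKg x (hgi.sub hu)
    rw [← integral_add i1 i2]
    have e : ∀ y, K x y * (g x - g y) + K x y * (g y - u y) = K x y * g x - K x y * u y :=
      fun y => by ring
    simp_rw [e]
    rw [integral_sub ((hKi x).mul_const _) (hKg x hu), hKu, sub_zero, integral_mul_const,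
      hint x, one_mul]
  have hw1 : ∀ x y, ‖K x y‖ₑ ≤ wkern φ (fun j => (heatEig ℓ 1 N j : ℂ)) N 1 x y := fun x y => by
    rw [wkern]
    refine le_mul_of_one_le_right' ?_
    rw [pow_one, ENNReal.one_le_ofReal]
    exact one_le_wt hN0 x y
  have hpt : ∀ x, ‖g x‖ₑ ≤ ENNReal.ofReal (2 * δ * B) +
      ∫⁻ y, wkern φ (fun j => (heatEig ℓ 1 N j : ℂ)) N 1 x y * ‖g y - u y‖ₑ ∂μ := by
    intro x
    rw [hrep x]
    refine (enorm_add_le _ _).trans (add_le_add ?_ ?_)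
    · calc ‖∫ y, K x y * (g x - g y) ∂μ‖ₑ ≤ ∫⁻ y, ‖K x y * (g x - g y)‖ₑ ∂μ :=
            enorm_integral_le_lintegral_enorm _
        _ ≤ ∫⁻ y, wkern φ (fun j => (heatEig ℓ 1 N j : ℂ)) N 1 x y * ENNReal.ofReal (2 * δ) ∂μ := by
            refine lintegral_mono fun y => ?_
            rw [enorm_mul, wkern, mul_assoc, pow_one, ← ENNReal.ofReal_mul (wt_pos hN0 x y).le,
              ← ofReal_norm (g x - g y)]
            gcongr
            exact hmod x y
        _ ≤ _ := by
            rw [lintegral_mul_const' _ _ ENNReal.ofReal_ne_top, mul_comm (2 * δ) B,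
              ENNReal.ofReal_mul hB.le]
            gcongr
            exact hb x
    · refine (enorm_integral_le_lintegral_enorm _).trans (lintegral_mono fun y => ?_)
      rw [enorm_mul]
      gcongr
      exact hw1 x y
  have hswap : ∫⁻ x, ∫⁻ y, wkern φ (fun j => (heatEig ℓ 1 N j : ℂ)) N 1 x y *
      ‖g y - u y‖ₑ ∂μ ∂μ ≤ ENNReal.ofReal B * ENNReal.ofReal δ := by
    have hgu : AEMeasurable (fun y => ‖g y - u y‖ₑ) μ :=
      (hgi.aestronglyMeasurable.sub hu.aestronglyMeasurable).enorm
    rw [lintegral_lintegral_swap (hKm.aemeasurable.mul hgu.comp_snd)]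
    have hle : ∫⁻ y, ‖g y - u y‖ₑ ∂μ ≤ ENNReal.ofReal δ := by
      rw [eLpNorm_one_eq_lintegral_enorm] at hg
      refine le_trans (le_of_eq (lintegral_congr fun y => ?_)) hg
      rw [← enorm_neg]; simp
    calc _ ≤ ∫⁻ y, ENNReal.ofReal B * ‖g y - u y‖ₑ ∂μ := by
          refine lintegral_mono fun y => ?_
          beta_reduce
          simp_rw [wkern_symm φ _ N 1 _ y]
          rw [lintegral_mul_const _ (h.measurable_wkern_right h.norm_lam_le 1 y)]
          gcongr
          exact hb y
      _ ≤ _ := by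
          rw [lintegral_const_mul' _ _ ENNReal.ofReal_ne_top]
          gcongr
  rw [eLpNorm_one_eq_lintegral_enorm]
  refine (lintegral_mono hpt).trans ?_
  rw [lintegral_add_left measurable_const, lintegral_const, measure_univ, mul_one]
  refine (add_le_add_right hswap _).trans (le_of_eq ?_)
  rw [← ENNReal.ofReal_mul hB.le, ← ENNReal.ofReal_add (by positivity) (by positivity)]
  congr 1; ring

/-- The system is complete in `L¹`: the heat semigroup is an approximate identity. -/
lemma ae_eq_zero_of_coeff_eq_zero (H : IsHeatSystem μ φ ℓ α) {u : M → ℂ} (hu : Integrable u μ)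
    (h0 : ∀ k, ∫ y, φ k y * u y ∂μ = 0) : u =ᵐ[μ] 0 := by
  obtain ⟨B, D, hB, hS⟩ := H.exists_lintegral_wkern_heatEig_le
  have hmem : MemLp u 1 μ := memLp_one_iff_integrable.2 hu
  have key : ∀ δ : ℝ, 0 < δ → eLpNorm u 1 μ ≤ ENNReal.ofReal ((3 * B + 1) * δ) := by
    intro δ hδ
    obtain ⟨g, hg, hgm⟩ := hmem.exists_boundedContinuous_eLpNorm_sub_le ENNReal.one_ne_top
      (ε := ENNReal.ofReal δ) (by simpa using hδ)
    have hguc := CompactSpace.uniformContinuous_of_continuous g.continuous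
    obtain ⟨η, hη, hgη⟩ := Metric.uniformContinuous_iff.1 hguc δ hδ
    set R : ℝ := 2 * ‖g‖ / η with hR
    have hR0 : 0 ≤ R := by positivity
    have hmod : ∀ x y, ‖g x - g y‖ ≤ δ + R * dist x y := by
      intro x y
      rcases lt_or_ge (dist x y) η with hlt | hge
      · have := hgη hlt
        rw [dist_eq_norm] at this
        nlinarith [mul_nonneg hR0 (dist_nonneg (x := x) (y := y))]
      · have h1 : ‖g x - g y‖ ≤ 2 * ‖g‖ := by
          have := g.dist_le_two_norm x y
          rwa [dist_eq_norm] at this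
        have h2 : 2 * ‖g‖ ≤ R * dist x y := by
          rw [hR, div_mul_eq_mul_div, le_div_iff₀ hη]
          gcongr
        linarith
    set N : ℝ := max 1 (R / δ) with hN
    have hN1 : 1 ≤ N := le_max_left _ _
    have hN0 : 0 < N := by linarith
    have hRN : R ≤ δ * N := by
      rw [← div_le_iff₀' hδ]; exact le_max_right _ _
    obtain ⟨h, hb⟩ := hS N hN1
    have hgi : Integrable (⇑g) μ := memLp_one_iff_integrable.1 hgm
    have hgn : eLpNorm (⇑g) 1 μ ≤ ENNReal.ofReal (3 * B * δ) := by
      refine eLpNorm_le_of_coeff_eq_zero h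
        (H.integral_kern_heatEig one_pos hN0 (by nlinarith)) hb hB hδ hu h0 hgi (fun x y => ?_) hg
      refine (hmod x y).trans ?_
      unfold wt
      have := mul_le_mul_of_nonneg_right hRN (dist_nonneg (x := x) (y := y))
      have h3 : 0 ≤ N * dist x y * δ := by positivity
      nlinarith
    calc eLpNorm u 1 μ = eLpNorm ((u - ⇑g) + ⇑g) 1 μ := by rw [sub_add_cancel]
      _ ≤ eLpNorm (u - ⇑g) 1 μ + eLpNorm (⇑g) 1 μ :=
          eLpNorm_add_le (hu.aestronglyMeasurable.sub hgi.aestronglyMeasurable)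
            hgi.aestronglyMeasurable le_rfl
      _ ≤ ENNReal.ofReal δ + ENNReal.ofReal (3 * B * δ) := add_le_add hg hgn
      _ = _ := by
          rw [← ENNReal.ofReal_add (by positivity) (by positivity)]; congr 1; ring
  have hzero : eLpNorm u 1 μ = 0 := by
    by_contra hne
    have hpos : 0 < (eLpNorm u 1 μ).toReal := ENNReal.toReal_pos hne hmem.2.ne
    have := key ((eLpNorm u 1 μ).toReal / (2 * (3 * B + 1))) (by positivity)
    rw [← ENNReal.ofReal_toReal hmem.2.ne, ENNReal.ofReal_le_ofReal_iff (by positivity),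
      ENNReal.toReal_ofReal hpos.le] at this
    have e : (3 * B + 1) * ((eLpNorm u 1 μ).toReal / (2 * (3 * B + 1))) =
        (eLpNorm u 1 μ).toReal / 2 := by field_simp
    rw [e] at this
    linarith
  exact (eLpNorm_eq_zero_iff hu.aestronglyMeasurable one_ne_zero).1 hzero

end IsHeatSystem

/-! ### Dyadic blocks of a multiplier -/

/-- A family of constants with a common bound. -/
lemma UnifBdd.of_bounded_const {ι : Type*} {U : Set ℝ} {k : ℕ} {c : ι → ℝ} {B : ℝ}
    (hc : ∀ i, |c i| ≤ B) : UnifBdd U k (fun i _ => c i) := by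
  cases k with
  | zero => exact ⟨fun _ => continuousOn_const, B, fun i _ _ => hc i⟩
  | succ k => exact ⟨⟨B, fun i _ _ => hc i⟩, fun _ _ => 0, fun i x _ => hasDerivAt_const x (c i),
      UnifBdd.const 0⟩

/-- A smooth low-pass filter: `1` on `(-∞, 1/2]` and `0` on `[1, ∞)`. -/
noncomputable def lowPass (t : ℝ) : ℝ := Real.smoothTransition (2 - 2 * t)

lemma lowPass_of_le {t : ℝ} (ht : t ≤ 1 / 2) : lowPass t = 1 :=
  Real.smoothTransition.one_of_one_le (by linarith)

lemma lowPass_of_ge {t : ℝ} (ht : 1 ≤ t) : lowPass t = 0 :=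
  Real.smoothTransition.zero_of_nonpos (by linarith)

lemma lowPass_nonneg (t : ℝ) : 0 ≤ lowPass t := Real.smoothTransition.nonneg _

lemma lowPass_le_one (t : ℝ) : lowPass t ≤ 1 := Real.smoothTransition.le_one _

lemma contDiff_lowPass {k : ℕ∞} : ContDiff ℝ k lowPass :=
  Real.smoothTransition.contDiff.comp (by fun_prop)

/-- The band-pass filter `lowPass (t/2) - lowPass t`, supported in `[1/2, 2]`; its dyadic dilates
telescope. -/
noncomputable def bandPass (t : ℝ) : ℝ := lowPass (t / 2) - lowPass t

lemma bandPass_of_le {t : ℝ} (ht : t ≤ 1 / 2) : bandPass t = 0 := by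
  rw [bandPass, lowPass_of_le ht, lowPass_of_le (by linarith), sub_self]

lemma bandPass_of_ge {t : ℝ} (ht : 2 ≤ t) : bandPass t = 0 := by
  rw [bandPass, lowPass_of_ge (by linarith), lowPass_of_ge (by linarith), sub_self]

lemma contDiff_bandPass {k : ℕ∞} : ContDiff ℝ k bandPass :=
  (contDiff_lowPass.comp (by fun_prop)).sub contDiff_lowPass

lemma sum_bandPass (t N : ℝ) (J : ℕ) :
    ∑ i ∈ Finset.range J, bandPass (t / (2 ^ i * N)) = lowPass (t / (2 ^ J * N)) - lowPass (t / N) := by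
  induction J with
  | zero => simp
  | succ J ih =>
    rw [Finset.sum_range_succ, ih, bandPass, div_div,
      show 2 ^ J * N * 2 = 2 ^ (J + 1) * N by ring]
    ring

/-- The dyadic block at scale `N` of the multiplier `(1 + t)^γ Φ(log t)`. -/
noncomputable def block (γ : ℝ) (Φ : ℝ → ℝ) (N t : ℝ) : ℝ :=
  bandPass (t / N) * ((1 + t) ^ γ * Φ (Real.log t))

/-- The variable `v` with `u = exp (-a v²)`. -/
noncomputable def gaussInv (a u : ℝ) : ℝ := √(-Real.log u / a)

lemma gaussInv_exp {a v : ℝ} (ha : 0 < a) (hv : 0 ≤ v) : gaussInv a (Real.exp (-a * v ^ 2)) = v := by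
  rw [gaussInv, Real.log_exp, neg_mul, neg_neg, mul_div_cancel_left₀ _ ha.ne', Real.sqrt_sq hv]

lemma exp_neg_mul_gaussInv_sq {a u : ℝ} (ha : 0 < a) (hu : 0 < u) (hu1 : u ≤ 1) :
    Real.exp (-a * gaussInv a u ^ 2) = u := by
  have : 0 ≤ -Real.log u / a := div_nonneg (neg_nonneg.2 (Real.log_nonpos hu.le hu1)) ha.le
  rw [gaussInv, Real.sq_sqrt this, neg_mul, mul_div_cancel₀ _ ha.ne', neg_neg, Real.exp_log hu]

lemma exp_neg_sq_lt_iff {a v w : ℝ} (ha : 0 < a) (hv : 0 ≤ v) (hw : 0 ≤ w) :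
    Real.exp (-a * v ^ 2) < Real.exp (-a * w ^ 2) ↔ w < v := by
  rw [Real.exp_lt_exp, neg_mul, neg_mul, neg_lt_neg_iff, mul_lt_mul_iff_right₀ ha,
    sq_lt_sq₀ hw hv]

/-- The multiplier of the block at scale `N`, as a function of the eigenvalue `u = exp(-a(t/N)²)`
of the heat operator, divided by `u² N^γ`. -/
noncomputable def blockAux (γ : ℝ) (Φ : ℝ → ℝ) (a N u : ℝ) : ℝ :=
  (u⁻¹) ^ 2 * bandPass (gaussInv a u) * (1 / N + gaussInv a u) ^ γ *
    Φ (Real.log N + Real.log (gaussInv a u))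

/-- On the relevant range of eigenvalues all factors of `blockAux` are smooth with bounds that do
not depend on the scale `N ≥ Nmin`, because `v = gaussInv a u` stays between `1/3` and `3`. -/
lemma unifBdd_blockAux {a Nmin : ℝ} (ha : 0 < a) (hN : 0 < Nmin) {S : ℕ} {Φ : ℝ → ℝ}
    (hΦ : UnifBdd Set.univ S (fun _ : {N : ℝ // Nmin ≤ N} => Φ)) (γ : ℝ) :
    UnifBdd (Set.Ioo (Real.exp (-a * 3 ^ 2)) (Real.exp (-a * (1 / 3) ^ 2))) S
      (fun N : {N : ℝ // Nmin ≤ N} => blockAux γ Φ a N) := by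
  set U := Set.Ioo (Real.exp (-a * 3 ^ 2)) (Real.exp (-a * (1 / 3) ^ 2)) with hU
  set K := Set.Icc (Real.exp (-a * 3 ^ 2)) (Real.exp (-a * (1 / 3) ^ 2)) with hK
  have hUK : U ⊆ K := Set.Ioo_subset_Icc_self
  have hKV : K ⊆ Set.Ioo 0 1 := fun u hu => by
    refine ⟨(Real.exp_pos _).trans_le hu.1, hu.2.trans_lt ?_⟩
    rw [Real.exp_lt_one_iff]; nlinarith
  have hpos : ∀ u ∈ Set.Ioo (0 : ℝ) 1, 0 < -Real.log u / a := fun u hu =>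
    div_pos (neg_pos.2 (Real.log_neg hu.1 hu.2)) ha
  have hvpos : ∀ u ∈ Set.Ioo (0 : ℝ) 1, 0 < gaussInv a u := fun u hu => Real.sqrt_pos.2 (hpos u hu)
  have hlog : ∀ k : ℕ, ContDiffOn ℝ k (fun u => -Real.log u / a) (Set.Ioo 0 1) := fun k =>
    ((contDiffOn_id.log fun u hu => (hu.1 : (0 : ℝ) < u).ne').neg).div_const a
  have hv : ∀ k : ℕ, ContDiffOn ℝ k (gaussInv a) (Set.Ioo 0 1) := fun k =>
    (hlog k).sqrt fun u hu => (hpos u hu).ne'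
  have hof : ∀ (k : ℕ) {ψ : ℝ → ℝ}, ContDiffOn ℝ k ψ (Set.Ioo 0 1) →
      UnifBdd U k (fun _ : {N : ℝ // Nmin ≤ N} => ψ) := fun k ψ hψ =>
    (UnifBdd.of_contDiffOn isOpen_Ioo isCompact_Icc hKV hψ).mono hUK
  have hvlow : ∀ u ∈ U, 1 / 3 ≤ gaussInv a u := fun u hu => by
    have hu' := hKV (hUK hu)
    have := hu.2
    rw [← exp_neg_mul_gaussInv_sq ha hu'.1 hu'.2.le, exp_neg_sq_lt_iff ha (hvpos u hu').le
      (by norm_num)] at this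
    exact this.le
  have h1 := hof S (ψ := fun u => (u⁻¹) ^ 2)
    ((contDiffOn_id.inv fun u hu => (hu.1 : (0 : ℝ) < u).ne').pow 2)
  have h2 := hof S (ψ := fun u => bandPass (gaussInv a u))
    ((contDiff_bandPass (k := S)).comp_contDiffOn (hv S))
  have h3 : UnifBdd U S (fun (N : {N : ℝ // Nmin ≤ N}) u => (1 / (N : ℝ) + gaussInv a u) ^ γ) := by
    refine UnifBdd.rpow (c := 1 / 3) (by norm_num) ((UnifBdd.of_bounded_const
      (c := fun N : {N : ℝ // Nmin ≤ N} => 1 / (N : ℝ)) (B := 1 / Nmin) fun N => ?_).add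
      (hof S (hv S))) (fun N u hu => ?_) γ
    · have : 0 < (N : ℝ) := hN.trans_le N.2
      rw [abs_of_pos (by positivity)]
      exact one_div_le_one_div_of_le hN N.2
    · have : 0 < (N : ℝ) := hN.trans_le N.2
      have := hvlow u hu
      have : 0 ≤ 1 / (N : ℝ) := by positivity
      linarith
  have h4 : UnifBdd U S (fun (N : {N : ℝ // Nmin ≤ N}) u =>
      Φ (Real.log N + Real.log (gaussInv a u))) := by
    obtain ⟨-, l', hl', hl⟩ := hof (S + 1) (ψ := fun u => Real.log (gaussInv a u))
      ((hv (S + 1)).log fun u hu => (hvpos u hu).ne')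
    exact hΦ.comp (s' := l') (fun N u hu => (hl' N u hu).const_add _) (fun _ _ _ => trivial) hl
  exact ((h1.mul h2).mul h3).mul h4

namespace IsHeatSystem

variable {M : Type*} [MetricSpace M] [CompactSpace M] [MeasurableSpace M] [BorelSpace M]
  {μ : Measure M} [IsProbabilityMeasure μ] {φ : ℕ → M → ℝ} {ℓ : ℕ → ℝ} {α : ℝ}

/-- The normalization of `blockAux` is undone at the eigenvalues of the heat operator; off the range
of eigenvalues both sides vanish. -/
lemma indicator_blockAux_heatEig (H : IsHeatSystem μ φ ℓ α) (γ : ℝ) (Φ : ℝ → ℝ) {a N : ℝ}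
    (ha : 0 < a) (hN : 0 < N) (j : ℕ) :
    N ^ γ * ((Set.Ioo (Real.exp (-a * 3 ^ 2)) (Real.exp (-a * (1 / 3) ^ 2))).indicator
      (blockAux γ Φ a N) (heatEig ℓ a N j) * heatEig ℓ a N j ^ 2) = block γ Φ N (ℓ j) := by
  have hℓ := H.ell_nonneg j
  have hv : 0 ≤ ℓ j / N := by positivity
  have hE : heatEig ℓ a N j = Real.exp (-a * (ℓ j / N) ^ 2) := by
    rw [heatEig]; congr 1; field_simp
  have hE0 : heatEig ℓ a N j ≠ 0 := (Real.exp_pos _).ne'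
  by_cases hU : heatEig ℓ a N j ∈ Set.Ioo (Real.exp (-a * 3 ^ 2)) (Real.exp (-a * (1 / 3) ^ 2))
  · rw [Set.indicator_of_mem hU, blockAux]
    have hg : gaussInv a (heatEig ℓ a N j) = ℓ j / N := by rw [hE, gaussInv_exp ha hv]
    have hpos : 0 < ℓ j / N := by
      have := hU.2
      rw [hE, exp_neg_sq_lt_iff ha hv (by norm_num)] at this
      linarith
    have hℓ0 : ℓ j ≠ 0 := by rintro h; simp [h] at hpos
    rw [hg, block, ← Real.log_mul hN.ne' hpos.ne', mul_div_cancel₀ _ hN.ne', ← add_div,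
      Real.div_rpow (by linarith) hN.le]
    have : N ^ γ ≠ 0 := (Real.rpow_pos_of_pos hN γ).ne'
    field_simp
  · rw [Set.indicator_of_notMem hU, zero_mul, mul_zero, block]
    rw [hE, Set.mem_Ioo, exp_neg_sq_lt_iff ha (by norm_num) hv,
      exp_neg_sq_lt_iff ha hv (by norm_num), not_and_or, not_lt, not_lt] at hU
    rcases hU with h | h
    · rw [bandPass_of_ge (by linarith), zero_mul]
    · rw [bandPass_of_le (by linarith), zero_mul]

/-- The kernel of the dyadic block at scale `N` of the multiplier `(1 + t)^γ Φ(log t)` has `L¹` norm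
at most a multiple of `N^γ`, uniformly in `N`. The factor `u⁻²` in `blockAux` compensates for the
factor `lam_j²` of `IsSmoothing.exists_lintegral_kern_le`. -/
theorem exists_lintegral_block_le (H : IsHeatSystem μ φ ℓ α) {S : ℕ} (hS : α < S) {Nmin : ℝ}
    (hNmin : 0 < Nmin) {Φ : ℝ → ℝ}
    (hΦ : UnifBdd Set.univ S (fun _ : {N : ℝ // Nmin ≤ N} => Φ)) (γ : ℝ) :
    ∃ C, 0 < C ∧ ∀ N, Nmin ≤ N → ∀ (ν : Measure M) [SFinite ν] (D' d : ℝ), 0 < D' → 0 ≤ d →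
      (∀ x s, 0 < s → ν (Metric.closedBall x s) ≤ ENNReal.ofReal (D' * (s ^ α + d ^ α))) →
      ∀ x, ∫⁻ y, ‖kern φ (fun j => (block γ Φ N (ℓ j) : ℂ)) x y‖ₑ ∂ν ≤
        ENNReal.ofReal (C * N ^ γ * (D' * (1 + (N * d) ^ α))) := by
  have hα := H.alpha_pos
  have hS1 : (1 : ℝ) ≤ S := by
    have : 0 < S := by
      have : (0 : ℝ) < S := hα.trans hS
      exact_mod_cast this
    exact_mod_cast this
  -- The times `a / N²`, `N ≥ Nmin`, are at most `1`.
  set a : ℝ := min 1 (Nmin ^ 2) with ha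
  have ha0 : 0 < a := lt_min one_pos (by positivity)
  obtain ⟨D, hD, hsm⟩ := H.exists_isSmoothing (q := α + 2 * S + 1) (by positivity) ha0
  -- `s` lies between `α/2`, for integrability, and `S - 1/2`, for the Fourier series; there is room
  -- since `α < S` and `1 ≤ S`.
  set s : ℝ := (α / 2 + (S - 1 / 2)) / 2 with hs
  have hs1 : α < 2 * s := by rw [hs]; linarith
  have hs2 : s + 1 / 2 < S := by rw [hs]; linarith
  have hs0 : 0 ≤ s := by linarith
  obtain ⟨C, hC, hCb⟩ := IsSmoothing.exists_lintegral_kern_le μ φ hα hD (S := S)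
    (q := α + 2 * S + 1) (by linarith) hs1 (by linarith)
  set U := Set.Ioo (Real.exp (-a * 3 ^ 2)) (Real.exp (-a * (1 / 3) ^ 2)) with hU
  set K := Set.Icc (Real.exp (-a * 2 ^ 2)) (Real.exp (-a * (1 / 2) ^ 2)) with hK
  have hKU : K ⊆ U := Set.Icc_subset_Ioo
    ((exp_neg_sq_lt_iff ha0 (by norm_num) (by norm_num)).2 (by norm_num))
    ((exp_neg_sq_lt_iff ha0 (by norm_num) (by norm_num)).2 (by norm_num))
  have hU01 : U ⊆ Set.Ioo 0 1 := fun u hu => by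
    refine ⟨(Real.exp_pos _).trans hu.1, hu.2.trans ?_⟩
    rw [Real.exp_lt_one_iff]; nlinarith
  have hz : ∀ N : {N : ℝ // Nmin ≤ N}, ∀ u ∈ U, u ∉ K → blockAux γ Φ a N u = 0 := by
    intro N u hu huK
    have hu' := hU01 hu
    have hb : bandPass (gaussInv a u) = 0 := by
      rw [← exp_neg_mul_gaussInv_sq ha0 hu'.1 hu'.2.le] at huK
      have h0 : 0 ≤ gaussInv a u := Real.sqrt_nonneg _
      rw [hK, Set.mem_Icc, not_and_or, not_le, not_le, exp_neg_sq_lt_iff ha0 h0 (by norm_num),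
        exp_neg_sq_lt_iff ha0 (by norm_num) h0] at huK
      rcases huK with h | h
      · exact bandPass_of_ge h.le
      · exact bandPass_of_le h.le
    rw [blockAux, hb]; ring
  have hUB := (unifBdd_blockAux ha0 hNmin hΦ γ).indicator isOpen_Ioo isClosed_Icc hKU hz
  obtain ⟨C₁, hC₁⟩ := hUB.exists_fourier_series (K := K) isClosed_Icc (hKU.trans hU01)
    (fun N u hu => by
      by_cases huU : u ∈ U
      · rw [Set.indicator_of_mem huU, hz N u huU hu]
      · rw [Set.indicator_of_notMem huU]) hs0 hs2
  refine ⟨C * max C₁ 1, by positivity, fun N hN ν _ D' d hD' hd hν x => ?_⟩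
  have hN0 : 0 < N := hNmin.trans_le hN
  obtain ⟨c, hcs, hcC, hc⟩ := hC₁ ⟨N, hN⟩
  have haN : a ≤ N ^ 2 := (min_le_right _ _).trans (by gcongr)
  have key := hCb (heatEig ℓ a N) N (hsm N hN0 haN) _ c (max C₁ 1) hcs
    (hcC.trans (le_max_left _ _)) hc ν D' d hD' hd hν x
  have e : ∀ y, kern φ (fun j => (block γ Φ N (ℓ j) : ℂ)) x y = ((N ^ γ : ℝ) : ℂ) *
      kern φ (fun j => ((U.indicator (blockAux γ Φ a N) (heatEig ℓ a N j) : ℝ) : ℂ) *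
        (heatEig ℓ a N j : ℂ) ^ 2) x y := by
    intro y
    rw [kern, kern, ← tsum_mul_left]
    refine tsum_congr fun j => ?_
    rw [← H.indicator_blockAux_heatEig γ Φ ha0 hN0 j]
    push_cast
    ring
  have hNγ : 0 < N ^ γ := Real.rpow_pos_of_pos hN0 γ
  simp_rw [e, enorm_mul]
  rw [lintegral_const_mul' _ _ enorm_ne_top, ← ofReal_norm, Complex.norm_real,
    Real.norm_of_nonneg hNγ.le]
  refine (mul_le_mul' le_rfl key).trans (le_of_eq ?_)
  rw [← ENNReal.ofReal_mul hNγ.le]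
  ring_nf

end IsHeatSystem

/-! ### Low-pass operators -/

/-- The real kernel `∑_j a_j φ_j(x) φ_j(y)`. -/
noncomputable def rkern {M : Type*} (φ : ℕ → M → ℝ) (a : ℕ → ℝ) (x y : M) : ℝ :=
  ∑' j, a j * φ j x * φ j y

lemma kern_ofReal {M : Type*} (φ : ℕ → M → ℝ) (a : ℕ → ℝ) (x y : M) :
    kern φ (fun j => (a j : ℂ)) x y = rkern φ a x y := by
  rw [kern, rkern, Complex.ofReal_tsum]
  exact tsum_congr fun j => by push_cast; rfl

lemma rkern_symm {M : Type*} (φ : ℕ → M → ℝ) (a : ℕ → ℝ) (x y : M) :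
    rkern φ a x y = rkern φ a y x := tsum_congr fun j => by ring

lemma rkern_eq_sum {M : Type*} (φ : ℕ → M → ℝ) {a : ℕ → ℝ} {F : Finset ℕ}
    (hF : ∀ j ∉ F, a j = 0) (x y : M) : rkern φ a x y = ∑ j ∈ F, a j * φ j x * φ j y :=
  tsum_eq_sum fun j hj => by rw [hF j hj, zero_mul, zero_mul]

/-- The constant of Schur's test when both one-sided bounds are the same. -/
lemma rpow_mul_rpow_le {a b c : ℝ≥0∞} (ha : a ≤ c) (hb : b ≤ c) {p p' : ℝ≥0∞}
    (hp : p.HolderConjugate p') : a ^ (p'⁻¹).toReal * b ^ (p⁻¹).toReal ≤ c := by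
  have hpp : p⁻¹ + p'⁻¹ = 1 := ENNReal.HolderConjugate.inv_add_inv_eq_one p p'
  have h1 : p⁻¹ ≠ ⊤ := fun h => by simp [h] at hpp
  have h2 : p'⁻¹ ≠ ⊤ := fun h => by simp [h] at hpp
  calc a ^ (p'⁻¹).toReal * b ^ (p⁻¹).toReal ≤ c ^ (p'⁻¹).toReal * c ^ (p⁻¹).toReal := by gcongr
    _ = c := by
      rw [← ENNReal.rpow_add_of_nonneg _ _ ENNReal.toReal_nonneg ENNReal.toReal_nonneg,
        ← ENNReal.toReal_add h2 h1, add_comm, hpp, ENNReal.toReal_one, ENNReal.rpow_one]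

lemma two_pow_mul_rpow (β : ℝ) {N : ℝ} (hN : 0 < N) (i : ℕ) :
    ((2 : ℝ) ^ i * N) ^ β = (2 ^ β) ^ i * N ^ β := by
  rw [Real.mul_rpow (by positivity) hN.le, ← Real.rpow_natCast 2 i, ← Real.rpow_mul (by norm_num),
    mul_comm (i : ℝ), Real.rpow_mul (by norm_num), Real.rpow_natCast]

lemma sum_two_pow_mul_rpow_le {γ N : ℝ} (hγ : 0 < γ) (hN : 0 < N) (J : ℕ) :
    ∑ i ∈ Finset.range J, (2 ^ i * N) ^ γ ≤ (2 ^ γ - 1)⁻¹ * (2 ^ J * N) ^ γ := by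
  have h1 : (1 : ℝ) < 2 ^ γ := Real.one_lt_rpow (by norm_num) hγ
  simp_rw [two_pow_mul_rpow γ hN]
  rw [← Finset.sum_mul, geom_sum_eq h1.ne', ← mul_assoc, div_eq_inv_mul]
  have : 0 < (2 : ℝ) ^ γ - 1 := by linarith
  gcongr
  linarith

namespace IsHeatSystem

variable {M : Type*} [MetricSpace M] [CompactSpace M] [MeasurableSpace M] [BorelSpace M]
  {μ : Measure M} [IsProbabilityMeasure μ] {φ : ℕ → M → ℝ} {ℓ : ℕ → ℝ} {α : ℝ}
  {𝕜 : Type*} [RCLike 𝕜]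

lemma finite_ell_le (H : IsHeatSystem μ φ ℓ α) (R : ℝ) : {j | ℓ j ≤ R}.Finite := by
  have := (H.sys.ell_tendsto.eventually_gt_atTop R)
  rw [← Nat.cofinite_eq_atTop, eventually_cofinite] at this
  simpa using this

/-- The indices `j` with `ℓ_j ≤ R`. -/
noncomputable def ellLe (H : IsHeatSystem μ φ ℓ α) (R : ℝ) : Finset ℕ := (H.finite_ell_le R).toFinset

@[simp] lemma mem_ellLe (H : IsHeatSystem μ φ ℓ α) {R : ℝ} {j : ℕ} : j ∈ H.ellLe R ↔ ℓ j ≤ R := by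
  simp [ellLe]

lemma exists_abs_phi_le (H : IsHeatSystem μ φ ℓ α) (j : ℕ) : ∃ B, 0 ≤ B ∧ ∀ x, |φ j x| ≤ B := by
  obtain ⟨C, hC⟩ := isCompact_univ.exists_bound_of_continuousOn (H.sys.continuous j).continuousOn
  exact ⟨max C 0, le_max_right _ _, fun x => (hC x trivial).trans (le_max_left _ _)⟩

lemma continuous_rkern (H : IsHeatSystem μ φ ℓ α) {a : ℕ → ℝ} {F : Finset ℕ}
    (hF : ∀ j ∉ F, a j = 0) : Continuous (Function.uncurry (rkern φ a)) := by
  have : Function.uncurry (rkern φ a) = fun z : M × M => ∑ j ∈ F, a j * φ j z.1 * φ j z.2 := by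
    ext ⟨x, y⟩; exact rkern_eq_sum φ hF x y
  rw [this]
  refine continuous_finsetSum _ fun j _ => ?_
  have := H.sys.continuous j
  fun_prop

lemma integrable_mul_phi (H : IsHeatSystem μ φ ℓ α) {f : M → 𝕜} (hf : Integrable f μ) (j : ℕ) :
    Integrable (fun y => f y * (φ j y : 𝕜)) μ := by
  obtain ⟨C, -, hC⟩ := H.exists_abs_phi_le j
  refine hf.mul_bdd (c := C)
    (RCLike.continuous_ofReal.comp (H.sys.continuous j)).aestronglyMeasurable
    (Eventually.of_forall fun y => ?_)
  simpa using hC y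

lemma integral_rkern_mul (H : IsHeatSystem μ φ ℓ α) {a : ℕ → ℝ} {F : Finset ℕ}
    (hF : ∀ j ∉ F, a j = 0) {f : M → 𝕜} (hf : Integrable f μ) (x : M) :
    ∫ y, (rkern φ a x y : 𝕜) * f y ∂μ = ∑ j ∈ F, (a j : 𝕜) * (φ j x : 𝕜) * coeff μ φ f j := by
  have e : ∀ y, (rkern φ a x y : 𝕜) * f y =
      ∑ j ∈ F, (a j : 𝕜) * (φ j x : 𝕜) * (f y * (φ j y : 𝕜)) := fun y => by
    rw [rkern_eq_sum φ hF, RCLike.ofReal_sum, Finset.sum_mul]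
    refine Finset.sum_congr rfl fun j _ => ?_
    push_cast; ring
  simp_rw [e]
  rw [integral_finsetSum _ fun j _ => (H.integrable_mul_phi hf j).const_mul _]
  exact Finset.sum_congr rfl fun j _ => by rw [integral_const_mul, coeff]

lemma block_eq_zero (H : IsHeatSystem μ φ ℓ α) (γ : ℝ) (Φ : ℝ → ℝ) {N : ℝ} (hN : 0 < N) :
    ∀ j ∉ H.ellLe (2 * N), block γ Φ N (ℓ j) = 0 := fun j hj => by
  rw [mem_ellLe, not_le] at hj
  rw [block, bandPass_of_ge ((le_div_iff₀ hN).2 hj.le), zero_mul]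

lemma lowPass_mul_eq_zero (H : IsHeatSystem μ φ ℓ α) (m : ℝ → ℝ) {N : ℝ} (hN : 0 < N) :
    ∀ j ∉ H.ellLe N, lowPass (ℓ j / N) * m (ℓ j) = 0 := fun j hj => by
  rw [mem_ellLe, not_le] at hj
  rw [lowPass_of_ge ((one_le_div hN).2 hj.le), zero_mul]

/-- Schur's test for the operator with a continuous kernel of finite rank. -/
lemma eLpNorm_integral_rkern_mul_le (H : IsHeatSystem μ φ ℓ α) {a : ℕ → ℝ} {F : Finset ℕ}
    (hF : ∀ j ∉ F, a j = 0) {ν : Measure M} [SFinite ν] {c : ℝ≥0∞}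
    (h1 : ∀ x, ∫⁻ y, ‖rkern φ a x y‖ₑ ∂μ ≤ c) (h2 : ∀ x, ∫⁻ y, ‖rkern φ a x y‖ₑ ∂ν ≤ c)
    {f : M → 𝕜} (hf : AEStronglyMeasurable f μ) {p p' : ℝ≥0∞} (hp : p.HolderConjugate p') :
    eLpNorm (fun y => ∫ z, (rkern φ a y z : 𝕜) * f z ∂μ) p ν ≤ c * eLpNorm f p μ := by
  have hm : Measurable (Function.uncurry fun y z => ‖rkern φ a y z‖ₑ) :=
    (H.continuous_rkern hF).measurable.enorm
  refine (eLpNorm_le_of_schur hm hf h1 (b := c) (fun z => ?_) (fun y => ?_) hp).trans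
    (mul_le_mul' (rpow_mul_rpow_le le_rfl le_rfl hp) le_rfl)
  · simp_rw [rkern_symm φ a _ z]
    exact h2 z
  · refine (enorm_integral_le_lintegral_enorm _).trans (le_of_eq (lintegral_congr fun z => ?_))
    rw [enorm_mul]
    congr 1
    simp [← ofReal_norm]

lemma continuous_integral_rkern_mul (H : IsHeatSystem μ φ ℓ α) {a : ℕ → ℝ} {F : Finset ℕ}
    (hF : ∀ j ∉ F, a j = 0) {f : M → 𝕜} (hf : Integrable f μ) :
    Continuous fun y => ∫ z, (rkern φ a y z : 𝕜) * f z ∂μ := by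
  simp_rw [H.integral_rkern_mul hF hf]
  refine continuous_finsetSum _ fun j _ => ?_
  have := (RCLike.continuous_ofReal (K := 𝕜)).comp (H.sys.continuous j)
  exact (continuous_const.mul this).mul continuous_const

/-- A ball condition at scale `d` bounds the total mass, as `M` has finite diameter. -/
lemma exists_measure_univ_le (H : IsHeatSystem μ φ ℓ α) {D' Lmin : ℝ} (hD' : 0 < D')
    (hLmin : 0 < Lmin) :
    ∃ W, 0 < W ∧ ∀ L, Lmin ≤ L → ∀ ν : Measure M,
      (∀ x s, 0 < s → ν (Metric.closedBall x s) ≤ ENNReal.ofReal (D' * (s ^ α + (1 / L) ^ α))) →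
      ν Set.univ ≤ ENNReal.ofReal W := by
  have hα := H.alpha_pos
  obtain ⟨x⟩ := nonempty_of_isProbabilityMeasure μ
  set R := Metric.diam (Set.univ : Set M) + 1 with hR
  have hR0 : 0 < R := by have := Metric.diam_nonneg (s := (Set.univ : Set M)); linarith
  refine ⟨D' * (R ^ α + (1 / Lmin) ^ α), by positivity, fun L hL ν hν => ?_⟩
  have hu : Set.univ ⊆ Metric.closedBall x R := fun y _ => by
    rw [Metric.mem_closedBall]
    have := Metric.dist_le_diam_of_mem isCompact_univ.isBounded (Set.mem_univ y) (Set.mem_univ x)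
    linarith
  refine (measure_mono hu).trans ((hν x R hR0).trans (ENNReal.ofReal_le_ofReal ?_))
  gcongr
  exact (one_div_pos.2 (hLmin.trans_le hL)).le

lemma exists_ball (H : IsHeatSystem μ φ ℓ α) : ∃ c₀, 0 < c₀ ∧ ∀ x s, 0 < s →
    μ (Metric.closedBall x s) ≤ ENNReal.ofReal (c₀ * (s ^ α + 0 ^ α)) := by
  obtain ⟨c₀, hc₀, hball⟩ := H.ball
  refine ⟨c₀, hc₀, fun x s hs => ?_⟩
  rw [Real.zero_rpow H.alpha_pos.ne', add_zero,
    ← ENNReal.ofReal_toReal (measure_ne_top μ (Metric.closedBall x s))]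
  exact ENNReal.ofReal_le_ofReal (hball x s hs)

/-- The dyadic blocks, in the form used by Schur's test. -/
lemma exists_lintegral_rkern_block_le (H : IsHeatSystem μ φ ℓ α) {S : ℕ} (hS : α < S) {Nmin : ℝ}
    (hNmin : 0 < Nmin) {Φ : ℝ → ℝ}
    (hΦ : UnifBdd Set.univ S (fun _ : {N : ℝ // Nmin ≤ N} => Φ)) (γ : ℝ) {D' : ℝ} (hD' : 0 < D') :
    ∃ C, 0 < C ∧ ∀ N, Nmin ≤ N →
      (∀ x, ∫⁻ y, ‖rkern φ (fun j => block γ Φ N (ℓ j)) x y‖ₑ ∂μ ≤ ENNReal.ofReal (C * N ^ γ)) ∧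
      ∀ (ν : Measure M) [SFinite ν] (L : ℝ), 0 < L →
      (∀ x s, 0 < s → ν (Metric.closedBall x s) ≤ ENNReal.ofReal (D' * (s ^ α + (1 / L) ^ α))) →
      ∀ x, ∫⁻ y, ‖rkern φ (fun j => block γ Φ N (ℓ j)) x y‖ₑ ∂ν ≤
        ENNReal.ofReal (C * N ^ γ * (1 + (N / L) ^ α)) := by
  obtain ⟨c₀, hc₀, hball⟩ := H.exists_ball
  obtain ⟨C, hC, hCb⟩ := H.exists_lintegral_block_le hS hNmin hΦ γ
  have e : ∀ N x y, ‖kern φ (fun j => (block γ Φ N (ℓ j) : ℂ)) x y‖ₑ =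
      ‖rkern φ (fun j => block γ Φ N (ℓ j)) x y‖ₑ := fun N x y => by
    rw [kern_ofReal]; simp [← ofReal_norm]
  simp_rw [e] at hCb
  refine ⟨C * (c₀ + D'), by positivity, fun N hN => ?_⟩
  have hN0 : 0 < N := hNmin.trans_le hN
  have hNγ : 0 < N ^ γ := Real.rpow_pos_of_pos hN0 γ
  refine ⟨fun x => (hCb N hN μ c₀ 0 hc₀ le_rfl hball x).trans (ENNReal.ofReal_le_ofReal ?_),
    fun ν _ L hL hν x => (hCb N hN ν D' (1 / L) hD' (by positivity) hν x).trans
      (ENNReal.ofReal_le_ofReal ?_)⟩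
  · rw [mul_zero, Real.zero_rpow H.alpha_pos.ne', add_zero, mul_one]
    nlinarith [mul_pos (mul_pos hC hD') hNγ]
  · rw [mul_one_div]
    have : 0 < 1 + (N / L) ^ α := by positivity
    nlinarith [mul_pos (mul_pos (mul_pos hC hc₀) hNγ) this]

/-- The low-pass operator with multiplier `lowPass(t / 2L) m(t)`, where `m` grows like
`(1 + t)^γ` with `γ > 0`, has norm `O(L^γ)` from `L^p(μ)` to `L^p(ν)`, provided `ν` is
`α`-dimensional down to the scale `1/L`: the dyadic blocks at the scales `N ≤ L` have norms
`O(N^γ)`, and what remains at the lowest scale is a bounded kernel. -/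
theorem exists_eLpNorm_lowPass_le (H : IsHeatSystem μ φ ℓ α) {S : ℕ} (hS : α < S) {Lmin : ℝ}
    (hLmin : 0 < Lmin) {Φ : ℝ → ℝ}
    (hΦ : UnifBdd Set.univ S (fun _ : {N : ℝ // Lmin ≤ N} => Φ)) {γ : ℝ} (hγ : 0 < γ)
    {m : ℝ → ℝ} (hm : ∀ t, 0 < t → m t = (1 + t) ^ γ * Φ (Real.log t)) {D' : ℝ} (hD' : 0 < D')
    {p p' : ℝ≥0∞} (hp : p.HolderConjugate p') :
    ∃ C, 0 < C ∧ ∀ L, Lmin ≤ L → ∀ (ν : Measure M) [SFinite ν],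
      (∀ x s, 0 < s → ν (Metric.closedBall x s) ≤ ENNReal.ofReal (D' * (s ^ α + (1 / L) ^ α))) →
      ∀ f : M → 𝕜, Integrable f μ →
      eLpNorm (fun y => ∫ z, (rkern φ (fun j => lowPass (ℓ j / (2 * L)) * m (ℓ j)) y z : 𝕜) *
        f z ∂μ) p ν ≤ ENNReal.ofReal (C * L ^ γ) * eLpNorm f p μ := by
  have hp1 : 1 ≤ p := ENNReal.HolderConjugate.one_le p p'
  obtain ⟨W, hW, hWb⟩ := H.exists_measure_univ_le hD' hLmin
  obtain ⟨C, hC, hCb⟩ := H.exists_lintegral_rkern_block_le hS hLmin hΦ γ hD'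
  choose B hB0 hB using H.exists_abs_phi_le
  set C₀ := 1 + ∑ j ∈ H.ellLe (2 * Lmin), |m (ℓ j)| * B j * B j with hC₀
  have hC₀0 : 0 < C₀ := by
    have : 0 ≤ ∑ j ∈ H.ellLe (2 * Lmin), |m (ℓ j)| * B j * B j :=
      Finset.sum_nonneg fun j _ => mul_nonneg (mul_nonneg (abs_nonneg _) (hB0 j)) (hB0 j)
    linarith
  have h2γ : 0 < (2 : ℝ) ^ γ - 1 := by
    have := Real.one_lt_rpow (x := 2) (by norm_num) hγ
    linarith
  refine ⟨C₀ * (W + 1) * Lmin ^ (-γ) + C * 2 * ((2 ^ γ - 1)⁻¹ * 2 ^ γ), by positivity,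
    fun L hL ν _ hν f hf => ?_⟩
  have hL0 : 0 < L := hLmin.trans_le hL
  obtain ⟨J, hJ1, hJ2⟩ := exists_nat_pow_near (x := 2 * L / Lmin) (y := 2)
    ((one_le_div hLmin).2 (by linarith)) (by norm_num)
  -- The lowest scale `N` lies between `Lmin` and `2 Lmin`.
  set N := 2 * L / 2 ^ J with hN
  have hJ0 : (0 : ℝ) < 2 ^ J := by positivity
  have hN1 : Lmin ≤ N := by
    rw [hN, le_div_iff₀ hJ0]
    rw [le_div_iff₀ hLmin] at hJ1; linarith
  have hN2 : N ≤ 2 * Lmin := by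
    rw [hN, div_le_iff₀ hJ0]
    rw [div_lt_iff₀ hLmin, pow_succ] at hJ2; linarith
  have hN0 : 0 < N := hLmin.trans_le hN1
  have hJN : 2 ^ J * N = 2 * L := by rw [hN]; field_simp
  have hiN : ∀ i : ℕ, Lmin ≤ 2 ^ i * N := fun i => by
    have : (1 : ℝ) ≤ 2 ^ i := one_le_pow₀ (by norm_num)
    nlinarith
  have hiN0 : ∀ i : ℕ, 0 < 2 ^ i * N := fun i => hLmin.trans_le (hiN i)
  -- The multiplier is its part at the lowest scale plus dyadic blocks. At `t = 0` the blocks vanish,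
  -- so the value of `Φ (log 0)` is irrelevant.
  have hmul : ∀ j, lowPass (ℓ j / (2 * L)) * m (ℓ j) = lowPass (ℓ j / N) * m (ℓ j) +
      ∑ i ∈ Finset.range J, block γ Φ (2 ^ i * N) (ℓ j) := by
    intro j
    have : ∀ i : ℕ, block γ Φ (2 ^ i * N) (ℓ j) = bandPass (ℓ j / (2 ^ i * N)) * m (ℓ j) := by
      intro i
      rcases (H.ell_nonneg j).eq_or_lt with h | h
      · rw [block, ← h, zero_div, bandPass_of_le (by norm_num), zero_mul, zero_mul]
      · rw [block, hm _ h]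
    simp_rw [this]
    rw [← Finset.sum_mul, sum_bandPass, hJN]
    ring
  have hsplit : (fun y => ∫ z, (rkern φ (fun j => lowPass (ℓ j / (2 * L)) * m (ℓ j)) y z : 𝕜) *
        f z ∂μ) = (fun y => ∫ z, (rkern φ (fun j => lowPass (ℓ j / N) * m (ℓ j)) y z : 𝕜) * f z ∂μ) +
      ∑ i ∈ Finset.range J,
        fun y => ∫ z, (rkern φ (fun j => block γ Φ (2 ^ i * N) (ℓ j)) y z : 𝕜) * f z ∂μ := by
    ext y
    have hF1 : ∀ j ∉ H.ellLe (2 * L), lowPass (ℓ j / N) * m (ℓ j) = 0 := fun j hj => by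
      refine H.lowPass_mul_eq_zero m hN0 j fun h => hj ?_
      rw [mem_ellLe] at h ⊢
      have : (1 : ℝ) ≤ 2 ^ J := one_le_pow₀ (by norm_num)
      nlinarith
    have hF2 : ∀ i ∈ Finset.range J, ∀ j ∉ H.ellLe (2 * L),
        block γ Φ (2 ^ i * N) (ℓ j) = 0 := fun i hi j hj => by
      refine H.block_eq_zero γ Φ (hiN0 i) j fun h => hj ?_
      rw [mem_ellLe] at h ⊢
      have : (2 : ℝ) ^ (i + 1) ≤ 2 ^ J :=
        pow_le_pow_right₀ (by norm_num) (Finset.mem_range.1 hi)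
      rw [pow_succ] at this
      nlinarith
    rw [Pi.add_apply, Finset.sum_apply,
      H.integral_rkern_mul (H.lowPass_mul_eq_zero m (by positivity)) hf,
      H.integral_rkern_mul hF1 hf,
      Finset.sum_congr rfl fun i hi => H.integral_rkern_mul (hF2 i hi) hf y, Finset.sum_comm,
      ← Finset.sum_add_distrib]
    refine Finset.sum_congr rfl fun j _ => ?_
    rw [hmul j, ← Finset.sum_mul, ← Finset.sum_mul, ← add_mul, ← add_mul]
    push_cast
    rfl
  have hlow : ∀ x y, ‖rkern φ (fun j => lowPass (ℓ j / N) * m (ℓ j)) x y‖ₑ ≤ ENNReal.ofReal C₀ := by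
    intro x y
    rw [← ofReal_norm]
    refine ENNReal.ofReal_le_ofReal ?_
    rw [rkern_eq_sum φ (F := H.ellLe (2 * Lmin)) fun j hj => by
      refine H.lowPass_mul_eq_zero m hN0 j fun h => hj ?_
      rw [mem_ellLe] at h ⊢
      linarith]
    refine (norm_sum_le _ _).trans ?_
    refine le_trans (Finset.sum_le_sum fun j _ => ?_) (le_add_of_nonneg_left zero_le_one)
    rw [norm_mul, norm_mul, norm_mul, Real.norm_eq_abs, Real.norm_eq_abs, Real.norm_eq_abs,
      Real.norm_eq_abs, abs_of_nonneg (lowPass_nonneg _)]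
    have := hB0 j
    gcongr
    · exact mul_le_of_le_one_left (abs_nonneg _) (lowPass_le_one _)
    · exact hB j x
    · exact hB j y
  have hνu := hWb L hL ν hν
  have hbnd1 : eLpNorm (fun y => ∫ z, (rkern φ (fun j => lowPass (ℓ j / N) * m (ℓ j)) y z : 𝕜) *
      f z ∂μ) p ν ≤ ENNReal.ofReal (C₀ * (W + 1)) * eLpNorm f p μ := by
    refine H.eLpNorm_integral_rkern_mul_le (H.lowPass_mul_eq_zero m hN0) (fun x => ?_) (fun x => ?_)
      hf.aestronglyMeasurable hp
    · refine (lintegral_mono (hlow x)).trans ?_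
      rw [lintegral_const, measure_univ, mul_one]
      exact ENNReal.ofReal_le_ofReal (le_mul_of_one_le_right hC₀0.le (by linarith))
    · refine (lintegral_mono (hlow x)).trans ?_
      rw [lintegral_const, ENNReal.ofReal_mul hC₀0.le]
      gcongr
      exact hνu.trans (ENNReal.ofReal_le_ofReal (by linarith))
  have hbnd2 : ∀ i ∈ Finset.range J,
      eLpNorm (fun y => ∫ z, (rkern φ (fun j => block γ Φ (2 ^ i * N) (ℓ j)) y z : 𝕜) * f z ∂μ) p ν ≤
        ENNReal.ofReal (C * (2 ^ i * N) ^ γ * 2) * eLpNorm f p μ := by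
    intro i hi
    obtain ⟨b1, b2⟩ := hCb (2 ^ i * N) (hiN i)
    have hpos : 0 < C * (2 ^ i * N) ^ γ := mul_pos hC (Real.rpow_pos_of_pos (hiN0 i) γ)
    refine H.eLpNorm_integral_rkern_mul_le (H.block_eq_zero γ Φ (hiN0 i)) (fun x => ?_)
      (fun x => ?_) hf.aestronglyMeasurable hp
    · exact (b1 x).trans (ENNReal.ofReal_le_ofReal (by linarith))
    · refine (b2 ν L hL0 hν x).trans (ENNReal.ofReal_le_ofReal ?_)
      have : (2 ^ i * N / L) ^ α ≤ 1 := by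
        refine Real.rpow_le_one (by have := hiN0 i; positivity) ?_ H.alpha_pos.le
        rw [div_le_one hL0]
        have : (2 : ℝ) ^ (i + 1) ≤ 2 ^ J :=
          pow_le_pow_right₀ (by norm_num) (Finset.mem_range.1 hi)
        rw [pow_succ] at this
        nlinarith
      gcongr
      linarith
  rw [hsplit]
  refine (eLpNorm_add_le (H.continuous_integral_rkern_mul (H.lowPass_mul_eq_zero m hN0)
    hf).aestronglyMeasurable (Finset.aestronglyMeasurable_sum _ fun i _ =>
    (H.continuous_integral_rkern_mul (H.block_eq_zero γ Φ (hiN0 i)) hf).aestronglyMeasurable)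
    hp1).trans ?_
  refine (add_le_add hbnd1 ((eLpNorm_sum_le (fun i _ => (H.continuous_integral_rkern_mul
    (H.block_eq_zero γ Φ (hiN0 i)) hf).aestronglyMeasurable) hp1).trans
    (Finset.sum_le_sum hbnd2))).trans ?_
  rw [← Finset.sum_mul, ← add_mul, ← ENNReal.ofReal_sum_of_nonneg fun i _ => by
    have := Real.rpow_pos_of_pos (hiN0 i) γ
    positivity]
  rw [← ENNReal.ofReal_add (by positivity) (Finset.sum_nonneg fun i _ => by
    have := Real.rpow_pos_of_pos (hiN0 i) γ
    positivity)]
  gcongr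
  rw [add_mul _ _ (L ^ γ), ← Finset.sum_mul, ← Finset.mul_sum]
  refine add_le_add ?_ ?_
  · rw [mul_assoc, Real.rpow_neg hLmin.le, ← div_eq_inv_mul]
    refine le_mul_of_one_le_right (by positivity) ?_
    rw [one_le_div (by positivity)]
    gcongr
  · have := sum_two_pow_mul_rpow_le hγ hN0 J
    rw [hJN, Real.mul_rpow (by norm_num) hL0.le] at this
    nlinarith

end IsHeatSystem

/-! ### The high-frequency part of the network -/

/-- The measure `∑_{y ∈ C} |w_y| δ_y`. -/
noncomputable def weightMeasure {M : Type*} [MeasurableSpace M] (C : Finset M) (w : M → ℝ) :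
    Measure M := ∑ y ∈ C, ENNReal.ofReal |w y| • Measure.dirac y

lemma lintegral_weightMeasure {M : Type*} [MeasurableSpace M] [MeasurableSingletonClass M]
    (C : Finset M) (w : M → ℝ) (f : M → ℝ≥0∞) :
    ∫⁻ y, f y ∂(weightMeasure C w) = ∑ y ∈ C, ENNReal.ofReal |w y| * f y := by
  rw [weightMeasure, lintegral_finsetSum_measure]
  exact Finset.sum_congr rfl fun y _ => by rw [lintegral_smul_measure, lintegral_dirac, smul_eq_mul]

instance isFiniteMeasure_weightMeasure {M : Type*} [MeasurableSpace M]
    (C : Finset M) (w : M → ℝ) : IsFiniteMeasure (weightMeasure C w) := by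
  refine ⟨?_⟩
  rw [weightMeasure, Measure.finsetSum_apply]
  exact ENNReal.sum_lt_top.2 fun y _ => by simp

namespace IsHeatSystem

variable {M : Type*} [MetricSpace M] [CompactSpace M] [MeasurableSpace M] [BorelSpace M]
  {μ : Measure M} [IsProbabilityMeasure μ] {φ : ℕ → M → ℝ} {ℓ : ℕ → ℝ} {α : ℝ}
  {𝕜 : Type*} [RCLike 𝕜]

lemma integral_phi_mul_rkern (H : IsHeatSystem μ φ ℓ α) {a : ℕ → ℝ} {F : Finset ℕ}
    (hF : ∀ j ∉ F, a j = 0) (k : ℕ) (y : M) :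
    ∫ x, φ k x * rkern φ a x y ∂μ = a k * φ k y := by
  have hi : Integrable (φ k) μ :=
    (H.sys.continuous k).integrable_of_hasCompactSupport (HasCompactSupport.of_compactSpace _)
  have := H.integral_rkern_mul (𝕜 := ℝ) hF hi y
  simp only [RCLike.ofReal_real_eq_id, id_eq, coeff, H.sys.orthonormal] at this
  simp_rw [rkern_symm φ a _ y, mul_comm (φ k _)]
  rw [this]
  by_cases hk : k ∈ F
  · simp [hk]
  · simp [hk, hF k hk]

/-- The high frequency part of `G(·, y)` is the sum of its dyadic blocks, almost everywhere. -/
lemma hasSum_block_tail (H : IsHeatSystem μ φ ℓ α) {S : ℕ} (hS : α < S) {Φ : ℝ → ℝ} {N : ℝ}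
    (hN : 0 < N) (hΦ : UnifBdd Set.univ S (fun _ : {N' : ℝ // N ≤ N'} => Φ)) {β : ℝ} (hβ : 0 < β)
    {b : ℝ → ℝ} (hb : ∀ t, 0 < t → b t = (1 + t) ^ (-β) * Φ (Real.log t)) {G : M → M → ℝ}
    (hG : HasExpansion μ φ ℓ b G) (y : M) :
    ∀ᵐ x ∂μ, HasSum (fun i : ℕ => rkern φ (fun j => block (-β) Φ (2 ^ i * N) (ℓ j)) x y)
      (G x y - rkern φ (fun j => lowPass (ℓ j / N) * b (ℓ j)) x y) := by
  obtain ⟨C, hC, hCb⟩ := H.exists_lintegral_rkern_block_le hS hN hΦ (-β) one_pos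
  have hN1 : ∀ i : ℕ, N ≤ 2 ^ i * N := fun i => by
    have : (1 : ℝ) ≤ 2 ^ i := one_le_pow₀ (by norm_num)
    nlinarith
  have hN0 : ∀ i : ℕ, 0 < 2 ^ i * N := fun i => hN.trans_le (hN1 i)
  set K : ℕ → M → ℝ := fun i x => rkern φ (fun j => block (-β) Φ (2 ^ i * N) (ℓ j)) x y with hK
  have hKc : ∀ i, Continuous (K i) := fun i =>
    (H.continuous_rkern (H.block_eq_zero (-β) Φ (hN0 i))).comp (by fun_prop : Continuous fun x => (x, y))
  have hKi : ∀ i, Integrable (K i) μ := fun i =>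
    (hKc i).integrable_of_hasCompactSupport (HasCompactSupport.of_compactSpace _)
  have hsum : Summable fun i : ℕ => C * (2 ^ i * N) ^ (-β) := by
    simp_rw [two_pow_mul_rpow (-β) hN]
    refine (Summable.mul_right _ (summable_geometric_of_lt_one (by positivity) ?_)).mul_left _
    exact Real.rpow_lt_one_of_one_lt_of_neg (by norm_num) (by linarith)
  have hKl : ∀ i, ∫⁻ x, ‖K i x‖ₑ ∂μ ≤ ENNReal.ofReal (C * (2 ^ i * N) ^ (-β)) := fun i => by
    simp_rw [hK, rkern_symm φ _ _ y]
    exact (hCb _ (hN1 i)).1 y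
  have hpos : ∀ i : ℕ, 0 ≤ C * (2 ^ i * N) ^ (-β) := fun i => by have := hN0 i; positivity
  have hKn : ∀ i, ∫ x, ‖K i x‖ ∂μ ≤ C * (2 ^ i * N) ^ (-β) := fun i => by
    rw [integral_norm_eq_lintegral_enorm (hKi i).aestronglyMeasurable]
    exact ENNReal.toReal_le_of_le_ofReal (hpos i) (hKl i)
  have hKs : Summable fun i => ∫ x, ‖K i x‖ ∂μ :=
    hsum.of_nonneg_of_le (fun i => integral_nonneg fun x => norm_nonneg _) hKn
  have hfin : ∫⁻ x, ∑' i, ‖K i x‖ₑ ∂μ ≠ ⊤ := by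
    rw [lintegral_tsum fun i => (hKc i).measurable.enorm.aemeasurable]
    exact ne_top_of_le_ne_top (hsum.tsum_ofReal_ne_top) (ENNReal.tsum_le_tsum hKl)
  have hae : ∀ᵐ x ∂μ, Summable fun i => K i x := by
    have hm : Measurable fun x => ∑' i, ‖K i x‖ₑ :=
      Measurable.tsum fun i => (hKc i).measurable.enorm
    filter_upwards [ae_lt_top hm hfin] with x hx
    exact (ENNReal.tsum_coe_ne_top_iff_summable.1 hx.ne).of_nnnorm
  set V : M → ℝ := fun x => ∑' i, K i x with hV
  have hVm : AEStronglyMeasurable V μ := by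
    refine aestronglyMeasurable_of_tendsto_ae atTop
      (f := fun n x => ∑ i ∈ Finset.range n, K i x)
      (fun n => (continuous_finsetSum _ fun i _ => hKc i).aestronglyMeasurable) ?_
    filter_upwards [hae] with x hx
    exact hx.hasSum.tendsto_sum_nat
  have hVi : Integrable V μ := by
    refine ⟨hVm, lt_of_le_of_lt (lintegral_mono_ae ?_) hfin.lt_top⟩
    filter_upwards [hae] with x hx
    exact enorm_tsum_le_tsum_enorm
  have hlow : ∀ j ∉ H.ellLe N, lowPass (ℓ j / N) * b (ℓ j) = 0 := H.lowPass_mul_eq_zero b hN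
  set g : M → ℝ := fun x => rkern φ (fun j => lowPass (ℓ j / N) * b (ℓ j)) x y with hg
  have hgc : Continuous g := (H.continuous_rkern hlow).comp (by fun_prop : Continuous fun x => (x, y))
  have hgi : Integrable g μ :=
    hgc.integrable_of_hasCompactSupport (HasCompactSupport.of_compactSpace _)
  obtain ⟨hGi, hGc⟩ := hG y
  have hmulφ : ∀ {f : M → ℝ} (k : ℕ), Integrable f μ → Integrable (fun x => φ k x * f x) μ :=
    fun {f} k hf => by
      have := H.integrable_mul_phi (𝕜 := ℝ) hf k
      simpa [mul_comm] using this
  have hVcoef : ∀ k, ∫ x, φ k x * V x ∂μ = (1 - lowPass (ℓ k / N)) * b (ℓ k) * φ k y := by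
    intro k
    obtain ⟨B, hB0, hB⟩ := H.exists_abs_phi_le k
    have h1 := hasSum_integral_of_summable_integral_norm (F := fun i x => φ k x * K i x)
      (fun i => hmulφ k (hKi i)) <| by
        refine (hKs.mul_left B).of_nonneg_of_le (fun i => integral_nonneg fun x => norm_nonneg _)
          fun i => ?_
        rw [← integral_const_mul]
        refine integral_mono (hmulφ k (hKi i)).norm ((hKi i).norm.const_mul B) fun x => ?_
        beta_reduce
        rw [norm_mul]
        exact mul_le_mul_of_nonneg_right (hB x) (norm_nonneg _)
    simp_rw [tsum_mul_left] at h1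
    refine tendsto_nhds_unique h1.tendsto_sum_nat ?_
    have h2 : ∀ n, ∑ i ∈ Finset.range n, ∫ x, φ k x * K i x ∂μ =
        (lowPass (ℓ k / (2 ^ n * N)) - lowPass (ℓ k / N)) * b (ℓ k) * φ k y := by
      intro n
      rw [← sum_bandPass, Finset.sum_mul, Finset.sum_mul]
      refine Finset.sum_congr rfl fun i _ => ?_
      rw [H.integral_phi_mul_rkern (H.block_eq_zero (-β) Φ (hN0 i)), block]
      rcases (H.ell_nonneg k).eq_or_lt with h | h
      · rw [← h, zero_div, bandPass_of_le (by norm_num)]; simp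
      · rw [hb _ h]
    simp_rw [h2]
    refine tendsto_const_nhds.congr' ?_
    have h3 : Tendsto (fun n : ℕ => (2 : ℝ) ^ n) atTop atTop :=
      tendsto_pow_atTop_atTop_of_one_lt (by norm_num)
    filter_upwards [h3.eventually_ge_atTop (2 * ℓ k / N)] with n hn
    rw [lowPass_of_le (t := ℓ k / (2 ^ n * N))]
    rw [div_le_iff₀ hN] at hn
    rw [div_le_iff₀ (hN0 n)]
    linarith
  have hz : (fun x => ((G x y - g x - V x : ℝ) : ℂ)) =ᵐ[μ] 0 := by
    refine H.ae_eq_zero_of_coeff_eq_zero ((hGi.sub hgi).sub hVi).ofReal fun k => ?_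
    simp_rw [← Complex.ofReal_mul]
    rw [integral_complex_ofReal, Complex.ofReal_eq_zero]
    have hGk : ∫ x, φ k x * G x y ∂μ = b (ℓ k) * φ k y := by
      rw [← hGc k, coeff]
      simp [mul_comm]
    simp_rw [mul_sub]
    have hd : Integrable (fun x => φ k x * G x y - φ k x * g x) μ :=
      (hmulφ k hGi).sub (hmulφ k hgi)
    rw [integral_sub hd (hmulφ k hVi), integral_sub (hmulφ k hGi) (hmulφ k hgi), hGk, hVcoef, H.integral_phi_mul_rkern hlow]
    ring
  filter_upwards [hz, hae] with x hx1 hx2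
  have : G x y - g x = V x := by
    have : G x y - g x - V x = 0 := Complex.ofReal_eq_zero.1 hx1
    linarith
  rw [this]
  exact hx2.hasSum

/-- Removing from `G(·, y)` its frequencies below `2L` leaves an error `O(L^{-β})` in the synthesis
from samples. A dyadic block at scale `N ≥ L` contributes `N^{-β} (N/L)^{α/p'}`, since Schur's test
sees the discrete measure at a scale finer than `1/L` in one of the two variables; the condition
`β > α/p'` makes this summable. -/
theorem exists_eLpNorm_tail_le (H : IsHeatSystem μ φ ℓ α) {S : ℕ} (hS : α < S) {Lmin : ℝ}
    (hLmin : 0 < Lmin) {Φ : ℝ → ℝ}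
    (hΦ : ∀ N : ℝ, UnifBdd Set.univ S (fun _ : {N' : ℝ // N ≤ N'} => Φ)) {β : ℝ} (hβ : 0 < β)
    {b : ℝ → ℝ} (hb : ∀ t, 0 < t → b t = (1 + t) ^ (-β) * Φ (Real.log t)) {G : M → M → ℝ}
    (hG : HasExpansion μ φ ℓ b G) {D' : ℝ} (hD' : 0 < D')
    {p p' : ℝ≥0∞} (hp : p.HolderConjugate p') (hβp : α * (p'⁻¹).toReal < β) :
    ∃ K, 0 < K ∧ ∀ L, Lmin ≤ L → ∀ (C : Finset M) (w : M → ℝ),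
      (∀ x s, 0 < s → weightMeasure C w (Metric.closedBall x s) ≤
        ENNReal.ofReal (D' * (s ^ α + (1 / L) ^ α))) →
      ∀ T : M → 𝕜, Continuous T →
      eLpNorm (fun x => ∑ y ∈ C, (w y : 𝕜) * T y *
        ((G x y - rkern φ (fun j => lowPass (ℓ j / (2 * L)) * b (ℓ j)) x y : ℝ) : 𝕜)) p μ ≤
        ENNReal.ofReal (K * L ^ (-β)) * eLpNorm T p (weightMeasure C w) := by
  have hα := H.alpha_pos
  have hp1 : 1 ≤ p := ENNReal.HolderConjugate.one_le p p'
  obtain ⟨C₀, hC₀, hCb⟩ := H.exists_lintegral_rkern_block_le hS hLmin (hΦ Lmin) (-β) hD'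
  set θ := (p'⁻¹).toReal with hθ
  have hθ0 : 0 ≤ θ := ENNReal.toReal_nonneg
  have hpp : p⁻¹ + p'⁻¹ = 1 := ENNReal.HolderConjugate.inv_add_inv_eq_one p p'
  have hθ1 : θ + (p⁻¹).toReal = 1 := by
    rw [hθ, add_comm, ← ENNReal.toReal_add (fun h => by simp [h] at hpp)
      (fun h => by simp [h] at hpp), hpp, ENNReal.toReal_one]
  set ρ : ℝ := 2 ^ (α * θ - β) with hρ
  have hρ0 : 0 < ρ := by positivity
  have hρ1 : ρ < 1 := Real.rpow_lt_one_of_one_lt_of_neg (by norm_num) (by linarith)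
  have hgeo : Summable fun i : ℕ => ρ ^ i := summable_geometric_of_lt_one hρ0.le hρ1
  refine ⟨C₀ * 2 ^ (-β) * (1 + 2 ^ α) ^ θ * (∑' i : ℕ, ρ ^ i), ?_, fun L hL C w hν T hT => ?_⟩
  · rw [tsum_geometric_of_lt_one hρ0.le hρ1]
    have : 0 < 1 - ρ := by linarith
    positivity
  have hL0 : 0 < L := hLmin.trans_le hL
  have hN0 : ∀ i : ℕ, 0 < 2 ^ i * (2 * L) := fun i => by positivity
  have hN1 : ∀ i : ℕ, Lmin ≤ 2 ^ i * (2 * L) := fun i => by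
    have : (1 : ℝ) ≤ 2 ^ i := one_le_pow₀ (by norm_num)
    nlinarith
  set k : ℕ → M → M → ℝ := fun i x y => rkern φ (fun j => block (-β) Φ (2 ^ i * (2 * L)) (ℓ j)) x y
    with hk
  have hkc : ∀ i, Continuous (Function.uncurry (k i)) := fun i =>
    H.continuous_rkern (H.block_eq_zero (-β) Φ (hN0 i))
  set R : ℕ → M → 𝕜 := fun i x => ∑ y ∈ C, (w y : 𝕜) * T y * (k i x y : 𝕜) with hR
  have hRc : ∀ i, Continuous (R i) := fun i => by
    refine continuous_finsetSum _ fun y _ => continuous_const.mul (RCLike.continuous_ofReal.comp ?_)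
    exact (hkc i).comp (by fun_prop : Continuous fun x => (x, y))
  have hsum : ∀ᵐ x ∂μ, HasSum (fun i => R i x) (∑ y ∈ C, (w y : 𝕜) * T y *
      ((G x y - rkern φ (fun j => lowPass (ℓ j / (2 * L)) * b (ℓ j)) x y : ℝ) : 𝕜)) := by
    have : ∀ᵐ x ∂μ, ∀ y ∈ C, HasSum (fun i => k i x y)
        (G x y - rkern φ (fun j => lowPass (ℓ j / (2 * L)) * b (ℓ j)) x y) :=
      (Finset.eventually_all C).2 fun y _ =>
        H.hasSum_block_tail hS (by positivity : 0 < 2 * L) (hΦ _) hβ hb hG y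
    filter_upwards [this] with x hx
    refine hasSum_sum fun y hy => HasSum.mul_left _ ?_
    exact (hx y hy).mapL (RCLike.ofRealCLM (K := 𝕜))
  have hRb : ∀ i, eLpNorm (R i) p μ ≤ ENNReal.ofReal (C₀ * 2 ^ (-β) * (1 + 2 ^ α) ^ θ * ρ ^ i *
      L ^ (-β)) * eLpNorm T p (weightMeasure C w) := by
    intro i
    obtain ⟨b1, b2⟩ := hCb (2 ^ i * (2 * L)) (hN1 i)
    have hs := eLpNorm_le_of_schur (ν₁ := μ) (ν₂ := weightMeasure C w)
      (k := fun x y => ‖k i x y‖ₑ) (hkc i).measurable.enorm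
      (f := T) hT.aestronglyMeasurable (F := R i)
      (fun x => b2 (weightMeasure C w) L hL0 hν x)
      (fun y => by simp_rw [hk, rkern_symm φ _ _ y]; exact b1 y) (fun x => by
        rw [lintegral_weightMeasure]
        refine (enorm_sum_le _ _).trans (Finset.sum_le_sum fun y _ => le_of_eq ?_)
        rw [enorm_mul, enorm_mul, mul_assoc, mul_comm ‖T y‖ₑ, ← ofReal_norm (w y : 𝕜),
          RCLike.norm_ofReal, ← ofReal_norm (k i x y : 𝕜), RCLike.norm_ofReal, ← ofReal_norm (k i x y),
          Real.norm_eq_abs]) hp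
    refine hs.trans (mul_le_mul' ?_ le_rfl)
    set N := 2 ^ i * (2 * L) with hN
    have hNp : 0 < N := hN0 i
    have hNL : N / L = 2 ^ i * 2 := by rw [hN]; field_simp
    have hA : 0 < C₀ * N ^ (-β) := mul_pos hC₀ (Real.rpow_pos_of_pos hNp _)
    have hB : 0 < 1 + (N / L) ^ α := by positivity
    rw [ENNReal.ofReal_rpow_of_pos (mul_pos hA hB), ENNReal.ofReal_rpow_of_pos hA,
      ← ENNReal.ofReal_mul (by positivity), Real.mul_rpow hA.le hB.le, mul_right_comm,
      ← Real.rpow_add hA, hθ1, Real.rpow_one]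
    refine ENNReal.ofReal_le_ofReal ?_
    have e1 : N ^ (-β) = (2 ^ (-β)) ^ i * (2 ^ (-β) * L ^ (-β)) := by
      rw [hN, two_pow_mul_rpow _ (by positivity), Real.mul_rpow (by norm_num) hL0.le]
    have e2 : ρ ^ i = (2 ^ (-β)) ^ i * ((2 ^ α) ^ i) ^ θ := by
      rw [hρ, ← Real.rpow_natCast (2 ^ α) i, ← Real.rpow_mul (by positivity), mul_comm (i : ℝ) θ,
        Real.rpow_mul (by positivity), Real.rpow_natCast, ← mul_pow, ← Real.rpow_mul (by norm_num),
        ← Real.rpow_add (by norm_num)]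
      congr 2; ring
    have e3 : (1 + (N / L) ^ α) ^ θ ≤ ((2 ^ α) ^ i) ^ θ * (1 + 2 ^ α) ^ θ := by
      rw [← Real.mul_rpow (by positivity) (by positivity), hNL]
      refine Real.rpow_le_rpow (by positivity) ?_ hθ0
      rw [two_pow_mul_rpow _ (by norm_num), mul_add, mul_one]
      have : (1 : ℝ) ≤ (2 ^ α) ^ i := one_le_pow₀ (Real.one_le_rpow (by norm_num) hα.le)
      linarith
    calc C₀ * N ^ (-β) * (1 + (N / L) ^ α) ^ θ
        ≤ C₀ * N ^ (-β) * (((2 ^ α) ^ i) ^ θ * (1 + 2 ^ α) ^ θ) := by gcongr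
      _ = _ := by rw [e1, e2]; ring
  refine (eLpNorm_le_tsum (fun i => (hRc i).aestronglyMeasurable) hsum hp1).trans
    ((ENNReal.tsum_le_tsum hRb).trans ?_)
  rw [ENNReal.tsum_mul_right, ← ENNReal.ofReal_tsum_of_nonneg (fun i => by positivity)
    ((hgeo.mul_left _).mul_right _), tsum_mul_right, tsum_mul_left]

end IsHeatSystem

/-! ### The low frequencies and the quadrature error -/

/-- A mask of type `β` is comparable to `(1 + t)^{-β}`, also at `t = 0`. -/
lemma IsMask.exists_bounds {S : ℕ} {β : ℝ} {b : ℝ → ℝ} (hb : IsMask S β b) (hβ : 0 ≤ β) :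
    ∃ m₀ M₀, 0 < m₀ ∧ 0 < M₀ ∧ ∀ t, 0 ≤ t → m₀ * (1 + t) ^ (-β) ≤ b t ∧ b t ≤ M₀ := by
  obtain ⟨-, hbS, F, -, hbF, ⟨c, hc⟩, m, hm, hF⟩ := hb
  have hcF : ∀ u, F u ≤ c := fun u => by
    have := hc 0 (Nat.zero_le _) u
    rw [iteratedDeriv_zero] at this
    exact (le_abs_self _).trans this
  have hc0 : 0 < c := hm.trans_le ((hF 0).trans (hcF 0))
  refine ⟨m, c, hm, hc0, fun t ht => ?_⟩
  have ht' : t ∈ closure (Set.Ioi (0 : ℝ)) := by rw [closure_Ioi]; exact ht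
  have h1 : ContinuousOn (fun t : ℝ => m * (1 + t) ^ (-β)) (closure (Set.Ioi 0)) := by
    rw [closure_Ioi]
    refine continuousOn_const.mul (ContinuousOn.rpow_const (by fun_prop) fun x hx => Or.inl ?_)
    have : (0 : ℝ) ≤ x := hx
    positivity
  refine ⟨le_on_closure (f := fun t : ℝ => m * (1 + t) ^ (-β)) (fun s hs => ?_) h1
    hbS.continuous.continuousOn ht', le_on_closure (g := fun _ => c) (fun s hs => ?_)
    hbS.continuous.continuousOn continuousOn_const ht'⟩
  · have hs' : (0 : ℝ) < s := hs
    rw [hbF s hs, mul_comm]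
    gcongr
    exact hF _
  · have hs' : (0 : ℝ) < s := hs
    rw [hbF s hs]
    have h2 : (1 + s) ^ (-β) ≤ 1 := Real.rpow_le_one_of_one_le_of_nonpos (by linarith) (by linarith)
    have h3 : 0 ≤ (1 + s) ^ (-β) := by positivity
    nlinarith [hcF (Real.log s), hF (Real.log s)]

namespace IsHeatSystem

variable {M : Type*} [MetricSpace M] [CompactSpace M] [MeasurableSpace M] [BorelSpace M]
  {μ : Measure M} [IsProbabilityMeasure μ] {φ : ℕ → M → ℝ} {ℓ : ℕ → ℝ} {α : ℝ}
  {𝕜 : Type*} [RCLike 𝕜]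

/-- Polynomial bounds for the number of indices with `ℓ_j ≤ N` and for the size of those `φ_j`,
both from the trace of the heat kernel. -/
lemma exists_card_ellLe_le (H : IsHeatSystem μ φ ℓ α) {Lmin : ℝ} (hLmin : 0 < Lmin) :
    ∃ D, 0 < D ∧ ∀ N, Lmin ≤ N → ((H.ellLe N).card : ℝ) ≤ D * N ^ α ∧
      ∀ j, ℓ j ≤ N → ∀ x, |φ j x| ≤ D * N ^ α := by
  have hα := H.alpha_pos
  set a : ℝ := min 1 (Lmin ^ 2) with ha
  have ha0 : 0 < a := lt_min one_pos (by positivity)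
  obtain ⟨D, hD, hsm⟩ := H.exists_isSmoothing (q := 0) le_rfl ha0
  refine ⟨Real.exp 1 * D + (Lmin ^ α)⁻¹, by positivity, fun N hN => ?_⟩
  have hN0 : 0 < N := hLmin.trans_le hN
  have h := hsm N hN0 ((min_le_right _ _).trans (by gcongr))
  have hNα : 0 < N ^ α := Real.rpow_pos_of_pos hN0 α
  have hlam : ∀ j, ℓ j ≤ N → Real.exp (-1) ≤ heatEig ℓ a N j := fun j hj => by
    refine Real.exp_le_exp.2 ?_
    have h1 : ℓ j ^ 2 ≤ N ^ 2 := by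
      have := H.ell_nonneg j
      gcongr
    have h2 : ℓ j ^ 2 * (a / N ^ 2) ≤ N ^ 2 * (a / N ^ 2) := by gcongr
    have h3 : N ^ 2 * (a / N ^ 2) = a := by field_simp
    have : a ≤ 1 := min_le_left _ _
    linarith
  have hexp : Real.exp 1 * Real.exp (-1) = 1 := by rw [← Real.exp_add]; simp
  refine ⟨?_, fun j hj x => ?_⟩
  · have h1 : ((H.ellLe N).card : ℝ) * Real.exp (-1) ≤ D * N ^ α := by
      refine le_trans ?_ (h.sum_lam_le (H.ellLe N))
      rw [← nsmul_eq_mul]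
      exact Finset.card_nsmul_le_sum _ _ _ fun j hj => hlam j (H.mem_ellLe.1 hj)
    calc ((H.ellLe N).card : ℝ) = Real.exp 1 * ((H.ellLe N).card * Real.exp (-1)) := by
          linear_combination -((H.ellLe N).card : ℝ) * hexp
      _ ≤ Real.exp 1 * (D * N ^ α) := by gcongr
      _ ≤ _ := by
        have : 0 < (Lmin ^ α)⁻¹ * N ^ α := by positivity
        linarith
  · have h1 : heatEig ℓ a N j * φ j x * φ j x ≤ D * N ^ α :=
      ((h.summable x x).le_tsum j fun i _ => by
        rw [mul_assoc]; exact mul_nonneg (h.nonneg i) (mul_self_nonneg _)).trans (h.bound_diag x)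
    have h2 : |φ j x| ≤ 1 + φ j x * φ j x := by
      nlinarith [sq_nonneg (|φ j x| - 1), abs_mul_abs_self (φ j x)]
    have h3 : φ j x * φ j x ≤ Real.exp 1 * (D * N ^ α) := by
      calc φ j x * φ j x = Real.exp 1 * (Real.exp (-1) * (φ j x * φ j x)) := by
            linear_combination -(φ j x * φ j x) * hexp
        _ ≤ Real.exp 1 * (heatEig ℓ a N j * (φ j x * φ j x)) := by
          have := mul_self_nonneg (φ j x)
          have := hlam j hj
          gcongr
        _ ≤ _ := by rw [← mul_assoc (heatEig ℓ a N j)]; gcongr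
    have h4 : 1 ≤ (Lmin ^ α)⁻¹ * N ^ α := by
      rw [inv_mul_eq_div, one_le_div (by positivity)]
      gcongr
    linarith

/-- The product assumption, made uniform over `L ≥ Lmin`. -/
lemma exists_productDefect_le (H : IsHeatSystem μ φ ℓ α) {A : ℝ}
    (hprod : ProductAssumption 𝕜 μ φ ℓ A) {Lmin : ℝ} (hLmin : 0 < Lmin) {s : ℝ} (hs : 0 < s) :
    ∃ K, 0 < K ∧ ∀ L, Lmin ≤ L → productDefect 𝕜 μ φ ℓ A L ≤ ENNReal.ofReal (K * L ^ (-s)) := by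
  obtain ⟨L₀, hL₀⟩ := eventually_atTop.1
    ((hprod s hs).eventually (eventually_le_nhds (zero_lt_one' ℝ≥0∞)))
  choose B hB0 hB using H.exists_abs_phi_le
  set R := max L₀ Lmin with hR
  have hR0 : 0 < R := hLmin.trans_le (le_max_right _ _)
  set Q := ∑ j ∈ H.ellLe R, B j with hQ
  have hQ0 : 0 ≤ Q := Finset.sum_nonneg fun j _ => hB0 j
  refine ⟨1 + Q * Q * R ^ s, by positivity, fun L hL => ?_⟩
  have hL0 : 0 < L := hLmin.trans_le hL
  have hLs : 0 < L ^ s := Real.rpow_pos_of_pos hL0 s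
  rw [Real.rpow_neg hL0.le, ← div_eq_mul_inv]
  rcases le_total R L with hRL | hLR
  · have h1 := hL₀ L ((le_max_left _ _).trans hRL)
    rw [mul_comm, ← ENNReal.le_inv_iff_mul_le, ← ENNReal.ofReal_inv_of_pos hLs] at h1
    refine h1.trans (ENNReal.ofReal_le_ofReal ?_)
    rw [← one_div]
    gcongr
    have : 0 ≤ Q * Q * R ^ s := by positivity
    linarith
  · have h1 : Q * Q ≤ (1 + Q * Q * R ^ s) / L ^ s := by
      rw [le_div_iff₀ hLs]
      have : L ^ s ≤ R ^ s := by gcongr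
      nlinarith [mul_nonneg hQ0 hQ0]
    refine le_trans ?_ (ENNReal.ofReal_le_ofReal h1)
    have hphi : ∀ j, ℓ j ≤ L → ∀ x, |φ j x| ≤ Q := fun j hj x => (hB j x).trans <|
      Finset.single_le_sum (f := B) (fun i _ => hB0 i) (H.mem_ellLe.2 (hj.trans hLR))
    refine iSup₂_le fun j hj => iSup₂_le fun k hk => ?_
    refine (iInf₂_le (0 : M → 𝕜) (Submodule.zero_mem _)).trans ?_
    rw [sub_zero, eLpNorm_exponent_top]
    refine eLpNormEssSup_le_of_ae_bound (Eventually.of_forall fun x => ?_)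
    rw [RCLike.norm_ofReal, abs_mul]
    exact mul_le_mul (hphi j hj x) (hphi k hk x) (abs_nonneg _) hQ0

/-- A continuous function is bounded everywhere by its essential supremum, as `μ` has full
support. -/
lemma enorm_le_eLpNorm_top (H : IsHeatSystem μ φ ℓ α) {u : M → 𝕜} (hu : Continuous u) (x : M) :
    ‖u x‖ₑ ≤ eLpNorm u ⊤ μ := by
  have := H.isOpenPosMeasure
  rw [eLpNorm_exponent_top]
  by_contra hlt
  push Not at hlt
  have ho : IsOpen {y | eLpNormEssSup u μ < ‖u y‖ₑ} := isOpen_lt continuous_const hu.enorm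
  have hz : μ {y | eLpNormEssSup u μ < ‖u y‖ₑ} = 0 := by
    have := ae_le_eLpNormEssSup (f := u) (μ := μ)
    rw [ae_iff] at this
    simpa using this
  rw [ho.measure_eq_zero_iff μ] at hz
  exact (Set.eq_empty_iff_forall_notMem.1 hz x) hlt

lemma continuous_of_mem_diffPoly (H : IsHeatSystem μ φ ℓ α) {L : ℝ} {P : M → 𝕜}
    (hP : P ∈ diffPoly 𝕜 φ ℓ L) : Continuous P := by
  induction hP using Submodule.span_induction with
  | mem u hu =>
    obtain ⟨j, -, rfl⟩ := hu
    exact RCLike.continuous_ofReal.comp (H.sys.continuous j)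
  | zero => exact continuous_zero
  | add u v _ _ hu hv => exact hu.add hv
  | smul c u _ hu => exact hu.const_smul c

lemma integrable_of_continuous {u : M → 𝕜} (hu : Continuous u) : Integrable u μ :=
  hu.integrable_of_hasCompactSupport (HasCompactSupport.of_compactSpace _)

lemma coeff_phi (H : IsHeatSystem μ φ ℓ α) (j k : ℕ) :
    coeff μ φ (fun x => (φ j x : 𝕜)) k = if j = k then 1 else 0 := by
  have : ∀ x, (φ j x : 𝕜) * (φ k x : 𝕜) = ((φ j x * φ k x : ℝ) : 𝕜) := fun x => by push_cast; rfl
  rw [coeff]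
  simp_rw [this]
  rw [integral_ofReal, H.sys.orthonormal]
  split_ifs <;> simp

/-- Diffusion polynomials are given by their finitely many coefficients. -/
lemma eq_sum_of_mem_diffPoly (H : IsHeatSystem μ φ ℓ α) {L : ℝ} {P : M → 𝕜}
    (hP : P ∈ diffPoly 𝕜 φ ℓ L) : (∀ j, L < ℓ j → coeff μ φ P j = 0) ∧
      ∀ x, P x = ∑ j ∈ H.ellLe L, coeff μ φ P j * (φ j x : 𝕜) := by
  have hadd : ∀ {u v : M → 𝕜} (k : ℕ), Continuous u → Continuous v →
      coeff μ φ (u + v) k = coeff μ φ u k + coeff μ φ v k := fun {u v} k hu hv => by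
    simp_rw [coeff, Pi.add_apply, add_mul]
    exact integral_add (H.integrable_mul_phi (integrable_of_continuous hu) k)
      (H.integrable_mul_phi (integrable_of_continuous hv) k)
  have hsmul : ∀ (c : 𝕜) (u : M → 𝕜) (k : ℕ), coeff μ φ (c • u) k = c * coeff μ φ u k :=
    fun c u k => by
      simp_rw [coeff, Pi.smul_apply, smul_eq_mul, mul_assoc]
      exact integral_const_mul _ _
  induction hP using Submodule.span_induction with
  | mem u hu =>
    obtain ⟨i, hi, rfl⟩ := hu
    have hi : ℓ i ≤ L := hi
    simp_rw [H.coeff_phi]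
    refine ⟨fun j hj => if_neg fun h => ?_, fun x => ?_⟩
    · rw [h] at hi; linarith
    · simp [hi]
  | zero => simp [coeff]
  | add u v hu hv ihu ihv =>
    have := fun k => hadd k (H.continuous_of_mem_diffPoly hu) (H.continuous_of_mem_diffPoly hv)
    simp_rw [this]
    refine ⟨fun j hj => by rw [ihu.1 j hj, ihv.1 j hj, add_zero], fun x => ?_⟩
    simp_rw [Pi.add_apply, add_mul]
    rw [Finset.sum_add_distrib, ihu.2 x, ihv.2 x]
  | smul c u hu ih =>
    simp_rw [hsmul]
    refine ⟨fun j hj => by rw [ih.1 j hj, mul_zero], fun x => ?_⟩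
    rw [Pi.smul_apply, smul_eq_mul, ih.2 x, Finset.mul_sum]
    exact Finset.sum_congr rfl fun j _ => by ring

lemma dG_eq_sum (H : IsHeatSystem μ φ ℓ α) {L R : ℝ} (hLR : L ≤ R) {P : M → 𝕜}
    (hP : P ∈ diffPoly 𝕜 φ ℓ L) (b : ℝ → ℝ) (y : M) :
    dG μ φ ℓ b P y = ∑ j ∈ H.ellLe R, coeff μ φ P j / (b (ℓ j) : 𝕜) * (φ j y : 𝕜) := by
  refine finsum_eq_sum_of_support_subset _ fun j hj => ?_
  rw [Finset.mem_coe, mem_ellLe]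
  by_contra hlt
  push Not at hlt
  exact hj (by simp [(H.eq_sum_of_mem_diffPoly hP).1 j (hLR.trans_lt hlt)])

/-- The quadrature error of a product of two `φ`'s is controlled by the product defect. -/
lemma enorm_quadrature_error_le (H : IsHeatSystem μ φ ℓ α) {A L : ℝ} {C : Finset M} {w : M → ℝ}
    (hq : IsQuadrature 𝕜 μ φ ℓ (A * L) C w) {j k : ℕ} (hj : ℓ j ≤ L) (hk : ℓ k ≤ L) :
    ‖(∫ x, φ j x * φ k x ∂μ) - ∑ y ∈ C, w y * (φ j y * φ k y)‖ₑ ≤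
      (1 + weightMeasure C w Set.univ) * productDefect 𝕜 μ φ ℓ A L := by
  set f : M → 𝕜 := fun x => ((φ j x * φ k x : ℝ) : 𝕜) with hf
  have hfc : Continuous f :=
    RCLike.continuous_ofReal.comp ((H.sys.continuous j).mul (H.sys.continuous k))
  set c : ℝ≥0∞ := 1 + weightMeasure C w Set.univ with hc
  have hc0 : c ≠ 0 := by rw [hc]; exact (lt_of_lt_of_le one_pos le_self_add).ne'
  have hct : c ≠ ⊤ := by rw [hc]; exact ENNReal.add_ne_top.2 ⟨ENNReal.one_ne_top, measure_ne_top _ _⟩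
  have hE : (((∫ x, φ j x * φ k x ∂μ) - ∑ y ∈ C, w y * (φ j y * φ k y) : ℝ) : 𝕜) =
      (∫ x, f x ∂μ) - ∑ y ∈ C, (w y : 𝕜) * f y := by
    rw [hf, integral_ofReal]; push_cast; rfl
  have key : ∀ Q ∈ diffPoly 𝕜 φ ℓ (A * L),
      ‖(∫ x, f x ∂μ) - ∑ y ∈ C, (w y : 𝕜) * f y‖ₑ ≤ c * eLpNorm (f - Q) ⊤ μ := by
    intro Q hQ
    have hQc := H.continuous_of_mem_diffPoly hQ
    have hu : Continuous (f - Q) := hfc.sub hQc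
    have e : (∫ x, f x ∂μ) - ∑ y ∈ C, (w y : 𝕜) * f y =
        (∫ x, (f - Q) x ∂μ) - ∑ y ∈ C, (w y : 𝕜) * (f - Q) y := by
      simp_rw [Pi.sub_apply, mul_sub]
      rw [Finset.sum_sub_distrib, integral_sub (integrable_of_continuous hfc)
        (integrable_of_continuous hQc), hq Q hQ]
      ring
    rw [e, sub_eq_add_neg]
    refine (enorm_add_le _ _).trans ?_
    rw [enorm_neg, hc, add_mul, one_mul]
    refine add_le_add ?_ ?_
    · refine (enorm_integral_le_lintegral_enorm _).trans
        ((lintegral_mono fun x => H.enorm_le_eLpNorm_top hu x).trans ?_)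
      rw [lintegral_const, measure_univ, mul_one]
    · refine (enorm_sum_le _ _).trans ?_
      rw [← lintegral_one, lintegral_weightMeasure, Finset.sum_mul]
      refine Finset.sum_le_sum fun y _ => ?_
      rw [enorm_mul, mul_one, ← ofReal_norm (w y : 𝕜), RCLike.norm_ofReal]
      gcongr
      exact H.enorm_le_eLpNorm_top hu y
  have h1 : ‖(∫ x, φ j x * φ k x ∂μ) - ∑ y ∈ C, w y * (φ j y * φ k y)‖ₑ =
      ‖(∫ x, f x ∂μ) - ∑ y ∈ C, (w y : 𝕜) * f y‖ₑ := by
    rw [← hE, ← ofReal_norm, ← ofReal_norm, RCLike.norm_ofReal, Real.norm_eq_abs]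
  rw [h1, mul_comm, ← ENNReal.div_le_iff_le_mul (Or.inl hc0) (Or.inl hct)]
  refine le_trans (le_iInf₂ fun Q hQ => ENNReal.div_le_of_le_mul' (key Q hQ)) ?_
  exact le_iSup₂_of_le j hj (le_iSup₂_of_le k hk le_rfl)

/-- The low frequency part of the synthesis reproduces `P` up to any negative power of `L`. Integrals
instead of sums would reproduce `P` exactly, the integrands are products of two functions `φ_j`
with `ℓ_j ≤ 2L`, and these are integrated by the quadrature rule up to the product defect, which
beats the polynomially many terms of polynomial size. -/
theorem exists_norm_sub_sum_lowPass_le (H : IsHeatSystem μ φ ℓ α) {A : ℝ}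
    (hprod : ProductAssumption 𝕜 μ φ ℓ A) {S : ℕ} {β : ℝ} (hβ : 0 ≤ β) {b : ℝ → ℝ}
    (hb : IsMask S β b) {Lmin : ℝ} (hLmin : 0 < Lmin) {W : ℝ} (hW : 0 ≤ W) {s : ℝ} (hs : 0 ≤ s) :
    ∃ K, 0 < K ∧ ∀ L, Lmin ≤ L → ∀ (C : Finset M) (w : M → ℝ),
      weightMeasure C w Set.univ ≤ ENNReal.ofReal W → IsQuadrature 𝕜 μ φ ℓ (2 * A * L) C w →
      ∀ P ∈ diffPoly 𝕜 φ ℓ L, ∀ Z, (∀ j, ‖coeff μ φ P j‖ ≤ Z) → ∀ x,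
      ‖P x - ∑ y ∈ C, (w y : 𝕜) * dG μ φ ℓ b P y *
        (rkern φ (fun j => lowPass (ℓ j / (2 * L)) * b (ℓ j)) x y : 𝕜)‖ ≤ K * L ^ (-s) * Z := by
  have hα := H.alpha_pos
  obtain ⟨m₀, M₀, hm₀, hM₀, hbb⟩ := hb.exists_bounds hβ
  obtain ⟨D, hD, hDb⟩ := H.exists_card_ellLe_le hLmin
  -- The exponent pays for two counts of indices and one sup norm, `L^α` each, and for `1/b ≲ L^β`.
  obtain ⟨E, hE, hEb⟩ := H.exists_productDefect_le hprod hLmin (s := 3 * α + β + s) (by positivity)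
  refine ⟨(D * 2 ^ α) ^ 3 * ((1 / Lmin + 1) ^ β / m₀) * M₀ * ((1 + W) * E), by positivity,
    fun L hL C w hw hq P hP Z hZ x => ?_⟩
  have hL0 : 0 < L := hLmin.trans_le hL
  have hZ0 : 0 ≤ Z := (norm_nonneg _).trans (hZ 0)
  obtain ⟨hcard, hphi⟩ := hDb (2 * L) (by linarith)
  set F := H.ellLe (2 * L) with hF
  set e : ℕ → ℕ → ℝ := fun j k => (∫ x, φ j x * φ k x ∂μ) - ∑ y ∈ C, w y * (φ j y * φ k y) with he
  have heb : ∀ j ∈ F, ∀ k ∈ F, |e j k| ≤ (1 + W) * (E * L ^ (-(3 * α + β + s))) := by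
    intro j hj k hk
    have h1 := H.enorm_quadrature_error_le (𝕜 := 𝕜) (A := A) (L := 2 * L) (C := C) (w := w)
      (by rwa [show A * (2 * L) = 2 * A * L by ring]) (H.mem_ellLe.1 hj) (H.mem_ellLe.1 hk)
    have h2 : (2 * L) ^ (-(3 * α + β + s)) ≤ L ^ (-(3 * α + β + s)) :=
      Real.rpow_le_rpow_of_nonpos hL0 (by linarith) (by linarith)
    have h3 : ‖e j k‖ₑ ≤ ENNReal.ofReal ((1 + W) * (E * L ^ (-(3 * α + β + s)))) := by
      refine h1.trans ?_
      rw [ENNReal.ofReal_mul (by positivity), ENNReal.ofReal_add zero_le_one hW, ENNReal.ofReal_one]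
      gcongr
      exact (hEb _ (by linarith)).trans (ENNReal.ofReal_le_ofReal (by gcongr))
    rw [← ofReal_norm, ENNReal.ofReal_le_ofReal_iff (by positivity)] at h3
    exact h3
  set t : ℕ → 𝕜 := fun j => coeff μ φ P j / (b (ℓ j) : 𝕜) with ht
  set m : ℕ → ℝ := fun j => lowPass (ℓ j / (2 * L)) * b (ℓ j) with hm
  have hbpos : ∀ j, 0 < b (ℓ j) := fun j => by
    have := H.ell_nonneg j
    exact lt_of_lt_of_le (by positivity) (hbb _ this).1
  have htm : ∀ j, t j * (m j : 𝕜) = coeff μ φ P j := by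
    intro j
    rcases le_or_gt (ℓ j) L with h | h
    · have h1 : lowPass (ℓ j / (2 * L)) = 1 :=
        lowPass_of_le (by rw [div_le_iff₀ (by positivity)]; linarith)
      have h2 : (b (ℓ j) : 𝕜) ≠ 0 := by exact_mod_cast (hbpos j).ne'
      simp only [ht, hm, h1, one_mul]
      exact div_mul_cancel₀ _ h2
    · simp [ht, (H.eq_sum_of_mem_diffPoly hP).1 j h]
  have htb : ∀ j, ‖t j‖ ≤ Z * ((1 / Lmin + 1) ^ β / m₀ * L ^ β) := by
    intro j
    rcases le_or_gt (ℓ j) L with h | h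
    · have h0 := H.ell_nonneg j
      have h1 := (hbb _ h0).1
      rw [ht, norm_div, RCLike.norm_ofReal, abs_of_pos (hbpos j), div_eq_mul_inv]
      refine mul_le_mul (hZ j) ?_ (inv_nonneg.2 (hbpos j).le) hZ0
      have h2 : 0 < (1 + ℓ j) ^ β := by positivity
      have h3 : (b (ℓ j))⁻¹ ≤ (1 + ℓ j) ^ β / m₀ := by
        rw [Real.rpow_neg (by linarith), ← div_eq_mul_inv] at h1
        have := inv_anti₀ (by positivity) h1
        rwa [inv_div] at this
      refine h3.trans ?_
      rw [div_mul_eq_mul_div, ← Real.mul_rpow (by positivity) hL0.le]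
      gcongr
      have : 1 ≤ 1 / Lmin * L := by
        rw [one_div_mul_eq_div, one_le_div hLmin]; exact hL
      linarith
    · have : t j = 0 := by simp [ht, (H.eq_sum_of_mem_diffPoly hP).1 j h]
      rw [this, norm_zero]
      positivity
  have hmb : ∀ j, |m j| ≤ M₀ := fun j => by
    rw [hm, abs_of_nonneg (mul_nonneg (lowPass_nonneg _) (hbpos j).le)]
    exact (mul_le_of_le_one_left (hbpos j).le (lowPass_le_one _)).trans
      (hbb _ (H.ell_nonneg j)).2
  -- The error is a double sum of quadrature errors, since the exact integral reproduces `P`.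
  have hrep : P x - ∑ y ∈ C, (w y : 𝕜) * dG μ φ ℓ b P y * (rkern φ m x y : 𝕜) =
      ∑ j ∈ F, ∑ k ∈ F, t j * ((m k * φ k x * e j k : ℝ) : 𝕜) := by
    have h1 : P x = ∑ j ∈ F, ∑ k ∈ F, t j * ((m k * φ k x * ∫ z, φ j z * φ k z ∂μ : ℝ) : 𝕜) := by
      have hP2 : P x = ∑ j ∈ F, coeff μ φ P j * (φ j x : 𝕜) := by
        rw [(H.eq_sum_of_mem_diffPoly hP).2 x]
        refine Finset.sum_subset (fun j hj => ?_) fun j _ hj => ?_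
        · rw [hF, mem_ellLe]; rw [mem_ellLe] at hj; linarith
        · rw [mem_ellLe, not_le] at hj
          rw [(H.eq_sum_of_mem_diffPoly hP).1 j hj, zero_mul]
      rw [hP2]
      refine Finset.sum_congr rfl fun j hj => ?_
      rw [Finset.sum_eq_single j (fun k _ hkj => by
        rw [H.sys.orthonormal, if_neg hkj.symm]; simp) (fun h => absurd hj h),
        H.sys.orthonormal, if_pos rfl, ← htm j]
      push_cast; ring
    have h2 : ∑ y ∈ C, (w y : 𝕜) * dG μ φ ℓ b P y * (rkern φ m x y : 𝕜) =
        ∑ j ∈ F, ∑ k ∈ F, t j * ((m k * φ k x * ∑ y ∈ C, w y * (φ j y * φ k y) : ℝ) : 𝕜) := by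
      have h3 : ∀ y, (w y : 𝕜) * dG μ φ ℓ b P y * (rkern φ m x y : 𝕜) =
          ∑ j ∈ F, ∑ k ∈ F, t j * ((m k * φ k x * (w y * (φ j y * φ k y)) : ℝ) : 𝕜) := fun y => by
        rw [H.dG_eq_sum (by linarith : L ≤ 2 * L) hP,
          rkern_eq_sum φ (H.lowPass_mul_eq_zero b (by positivity : 0 < 2 * L)), RCLike.ofReal_sum,
          mul_assoc, Finset.sum_mul_sum, Finset.mul_sum]
        refine Finset.sum_congr rfl fun j _ => ?_
        rw [Finset.mul_sum]
        refine Finset.sum_congr rfl fun k _ => ?_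
        simp only [ht, hm]
        push_cast; ring
      simp_rw [h3]
      rw [Finset.sum_comm]
      refine Finset.sum_congr rfl fun j _ => ?_
      rw [Finset.sum_comm]
      refine Finset.sum_congr rfl fun k _ => ?_
      rw [Finset.mul_sum, RCLike.ofReal_sum, Finset.mul_sum]
    rw [h1, h2, ← Finset.sum_sub_distrib]
    refine Finset.sum_congr rfl fun j _ => ?_
    rw [← Finset.sum_sub_distrib]
    refine Finset.sum_congr rfl fun k _ => ?_
    rw [he]; push_cast; ring
  rw [hrep]
  set Y := Z * ((1 / Lmin + 1) ^ β / m₀ * L ^ β) * (M₀ * (D * (2 * L) ^ α) *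
    ((1 + W) * (E * L ^ (-(3 * α + β + s))))) with hY
  have hY0 : 0 ≤ Y := by positivity
  have hterm : ∀ j ∈ F, ∀ k ∈ F, ‖t j * ((m k * φ k x * e j k : ℝ) : 𝕜)‖ ≤ Y := by
    intro j hj k hk
    rw [norm_mul, RCLike.norm_ofReal, abs_mul, abs_mul, hY]
    refine mul_le_mul (htb j) ?_ (by positivity) (by positivity)
    refine mul_le_mul ?_ (heb j hj k hk) (abs_nonneg _) (by positivity)
    exact mul_le_mul (hmb k) (hphi k (H.mem_ellLe.1 hk) x) (abs_nonneg _) hM₀.le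
  calc _ ≤ ∑ j ∈ F, ∑ k ∈ F, Y := (norm_sum_le _ _).trans (Finset.sum_le_sum fun j hj =>
        (norm_sum_le _ _).trans (Finset.sum_le_sum (hterm j hj)))
    _ = F.card * F.card * Y := by
      rw [Finset.sum_const, Finset.sum_const, nsmul_eq_mul, nsmul_eq_mul]; ring
    _ ≤ (D * (2 * L) ^ α) * (D * (2 * L) ^ α) * Y := by gcongr
    _ = _ := by
      have h1 : L ^ (-s) = (L ^ α) ^ 3 * L ^ β * L ^ (-(3 * α + β + s)) := by
        rw [← Real.rpow_natCast (L ^ α), ← Real.rpow_mul hL0.le, ← Real.rpow_add hL0,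
          ← Real.rpow_add hL0]
        congr 1; push_cast; ring
      rw [hY, h1, Real.mul_rpow (by norm_num) hL0.le]
      ring

end IsHeatSystem

/-! ### Samples of `𝒟_G P` and the conclusion -/

namespace IsHeatSystem

variable {M : Type*} [MetricSpace M] [CompactSpace M] [MeasurableSpace M] [BorelSpace M]
  {μ : Measure M} [IsProbabilityMeasure μ] {φ : ℕ → M → ℝ} {ℓ : ℕ → ℝ} {α : ℝ}
  {𝕜 : Type*} [RCLike 𝕜]

/-- Regular weights satisfy a ball condition at the scale `1/L`. -/
lemma exists_weightMeasure_closedBall_le (H : IsHeatSystem μ φ ℓ α) {κ : ℝ} (hκ : 0 < κ) :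
    ∃ D', 0 < D' ∧ ∀ L, 0 < L → ∀ (C : Finset M) (w : M → ℝ),
      IsRegularWeights μ α κ (1 / L) C w → ∀ x s, 0 < s →
      weightMeasure C w (Metric.closedBall x s) ≤ ENNReal.ofReal (D' * (s ^ α + (1 / L) ^ α)) := by
  classical
  obtain ⟨c₀, hc₀, hball⟩ := H.ball
  refine ⟨κ * (c₀ + 1), by positivity, fun L hL C w hw x s hs => ?_⟩
  have h1 : weightMeasure C w (Metric.closedBall x s) =
      ENNReal.ofReal (∑ y ∈ C with y ∈ Metric.closedBall x s, |w y|) := by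
    rw [← lintegral_indicator_one Metric.isClosed_closedBall.measurableSet, lintegral_weightMeasure,
      ENNReal.ofReal_sum_of_nonneg fun _ _ => abs_nonneg _, Finset.sum_filter]
    refine Finset.sum_congr rfl fun y _ => ?_
    by_cases hy : y ∈ Metric.closedBall x s
    · rw [Set.indicator_of_mem hy, if_pos hy, Pi.one_apply, mul_one]
    · rw [Set.indicator_of_notMem hy, if_neg hy, mul_zero]
  rw [h1]
  refine ENNReal.ofReal_le_ofReal ?_
  have h2 := hw x s hs
  have h3 := hball x s hs
  have h4 : 0 ≤ (1 / L) ^ α := by positivity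
  have h5 : 0 ≤ s ^ α := by positivity
  calc _ ≤ κ * (μ.real (Metric.closedBall x s) + (1 / L) ^ α) := by convert h2
    _ ≤ κ * ((c₀ + 1) * (s ^ α + (1 / L) ^ α)) := by
      gcongr
      nlinarith
    _ = _ := by ring

/-- Coefficients are bounded by `L^p` norms, as `μ` is a probability measure. -/
lemma norm_coeff_le (H : IsHeatSystem μ φ ℓ α) {p : ℝ≥0∞} (hp : 1 ≤ p) {u : M → 𝕜}
    (hu : MemLp u p μ) {j : ℕ} {B : ℝ} (hB : ∀ x, |φ j x| ≤ B) :
    ‖coeff μ φ u j‖ ≤ B * (eLpNorm u p μ).toReal := by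
  have hui : Integrable u μ := hu.integrable hp
  have hB0 : 0 ≤ B := by
    obtain ⟨x⟩ := nonempty_of_isProbabilityMeasure μ
    exact (abs_nonneg _).trans (hB x)
  calc ‖coeff μ φ u j‖ ≤ ∫ x, ‖u x * (φ j x : 𝕜)‖ ∂μ := norm_integral_le_integral_norm _
    _ ≤ ∫ x, B * ‖u x‖ ∂μ := by
      refine integral_mono (H.integrable_mul_phi hui j).norm (hui.norm.const_mul B) fun x => ?_
      beta_reduce
      rw [norm_mul, RCLike.norm_ofReal, mul_comm]
      exact mul_le_mul_of_nonneg_right (hB x) (norm_nonneg _)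
    _ = B * (eLpNorm u 1 μ).toReal := by
      rw [integral_const_mul, integral_norm_eq_lintegral_enorm hui.aestronglyMeasurable,
        eLpNorm_one_eq_lintegral_enorm]
    _ ≤ _ := by
      gcongr
      · exact hu.2.ne
      · exact eLpNorm_le_eLpNorm_of_exponent_le hp hu.1

lemma continuous_dG (H : IsHeatSystem μ φ ℓ α) {L : ℝ} {P : M → 𝕜} (hP : P ∈ diffPoly 𝕜 φ ℓ L)
    (b : ℝ → ℝ) : Continuous (dG μ φ ℓ b P) := by
  have : dG μ φ ℓ b P = fun y => ∑ j ∈ H.ellLe L, coeff μ φ P j / (b (ℓ j) : 𝕜) * (φ j y : 𝕜) :=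
    funext fun y => H.dG_eq_sum le_rfl hP b y
  rw [this]
  exact continuous_finsetSum _ fun j _ =>
    continuous_const.mul (RCLike.continuous_ofReal.comp (H.sys.continuous j))

/-- The samples of `𝒟_G P` in `ℓ^p` at the nodes. The low-pass operator with multiplier `1/b`
reproduces `𝒟_G P` from `P = f - (f - P)`. It costs `L^β` on `f - P`, and on
`f = (Δ*)^{-r} g` only `L^{β - r}`. -/
theorem exists_eLpNorm_dG_le (H : IsHeatSystem μ φ ℓ α) {S : ℕ} (hS : α < S) {Lmin : ℝ}
    (hLmin : 0 < Lmin) {β : ℝ} {b : ℝ → ℝ} (hb : IsMask S β b) {r : ℝ} (hr : 0 ≤ r) (hrβ : r < β)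
    {D' : ℝ} (hD' : 0 < D') {p p' : ℝ≥0∞} (hp : p.HolderConjugate p') :
    ∃ K, 0 < K ∧ ∀ L, Lmin ≤ L → ∀ (ν : Measure M) [SFinite ν],
      (∀ x s, 0 < s → ν (Metric.closedBall x s) ≤ ENNReal.ofReal (D' * (s ^ α + (1 / L) ^ α))) →
      ∀ f g P : M → 𝕜, Integrable f μ → Integrable g μ →
      (∀ k, coeff μ φ g k = (((1 + ℓ k) ^ r : ℝ) : 𝕜) * coeff μ φ f k) → P ∈ diffPoly 𝕜 φ ℓ L →
      eLpNorm (dG μ φ ℓ b P) p ν ≤ ENNReal.ofReal (K * L ^ β) * eLpNorm (f - P) p μ +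
        ENNReal.ofReal (K * L ^ (β - r)) * eLpNorm g p μ := by
  have hp1 : 1 ≤ p := ENNReal.HolderConjugate.one_le p p'
  obtain ⟨-, hbS, F, hFS, hbF, hFb, m, hm, hFm⟩ := hb
  have hF : ∀ N : ℝ, UnifBdd Set.univ S (fun (_ : {N' : ℝ // N ≤ N'}) u => (F u)⁻¹) := fun N =>
    (UnifBdd.of_iteratedDeriv hFS hFb).inv hm fun _ u _ => hFm u
  have hm1 : ∀ t, 0 < t → (b t)⁻¹ = (1 + t) ^ β * (F (Real.log t))⁻¹ := fun t ht => by
    rw [hbF t ht, mul_inv, Real.rpow_neg (by linarith), inv_inv]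
  have hm2 : ∀ t, 0 < t → (b t)⁻¹ * (1 + t) ^ (-r) = (1 + t) ^ (β - r) * (F (Real.log t))⁻¹ :=
    fun t ht => by
      rw [hm1 t ht, sub_eq_add_neg, Real.rpow_add (by linarith)]; ring
  obtain ⟨K₁, hK₁, h₁⟩ := H.exists_eLpNorm_lowPass_le (𝕜 := 𝕜) hS hLmin (hF Lmin)
    (hr.trans_lt hrβ) hm1 hD' hp
  obtain ⟨K₂, hK₂, h₂⟩ := H.exists_eLpNorm_lowPass_le (𝕜 := 𝕜) hS hLmin (hF Lmin)
    (sub_pos.2 hrβ) hm2 hD' hp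
  refine ⟨K₁ + K₂, by positivity, fun L hL ν _ hν f g P hf hg hfg hP => ?_⟩
  have hL0 : 0 < L := hLmin.trans_le hL
  have h2L : 0 < 2 * L := by positivity
  have hPi : Integrable P μ := integrable_of_continuous (H.continuous_of_mem_diffPoly hP)
  have z1 := H.lowPass_mul_eq_zero (fun t => (b t)⁻¹) h2L
  have z2 := H.lowPass_mul_eq_zero (fun t => (b t)⁻¹ * (1 + t) ^ (-r)) h2L
  have hrep : dG μ φ ℓ b P =
      (fun y => ∫ z, (rkern φ (fun j => lowPass (ℓ j / (2 * L)) *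
        ((b (ℓ j))⁻¹ * (1 + ℓ j) ^ (-r))) y z : 𝕜) * g z ∂μ) -
      fun y => ∫ z, (rkern φ (fun j => lowPass (ℓ j / (2 * L)) * (b (ℓ j))⁻¹) y z : 𝕜) *
        (f - P) z ∂μ := by
    ext y
    rw [Pi.sub_apply, H.integral_rkern_mul z1 (hf.sub hPi), H.integral_rkern_mul z2 hg,
      H.dG_eq_sum (by linarith : L ≤ 2 * L) hP, ← Finset.sum_sub_distrib]
    refine Finset.sum_congr rfl fun j _ => ?_
    have hc : coeff μ φ (f - P) j = coeff μ φ f j - coeff μ φ P j := by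
      simp_rw [coeff, Pi.sub_apply, sub_mul]
      exact integral_sub (H.integrable_mul_phi hf j) (H.integrable_mul_phi hPi j)
    have hl : (lowPass (ℓ j / (2 * L)) : 𝕜) * coeff μ φ P j = coeff μ φ P j := by
      rcases le_or_gt (ℓ j) L with h | h
      · rw [lowPass_of_le (by rw [div_le_iff₀ h2L]; linarith)]; simp
      · rw [(H.eq_sum_of_mem_diffPoly hP).1 j h, mul_zero]
    have hrr : (((1 + ℓ j) ^ (-r) : ℝ) : 𝕜) * (((1 + ℓ j) ^ r : ℝ) : 𝕜) = 1 := by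
      have h0 := H.ell_nonneg j
      rw [← RCLike.ofReal_mul, ← Real.rpow_add (by linarith), neg_add_cancel, Real.rpow_zero,
        RCLike.ofReal_one]
    rw [hc, hfg, div_eq_mul_inv]
    push_cast at hrr ⊢
    linear_combination (-(b (ℓ j) : 𝕜)⁻¹ * (φ j y : 𝕜)) * hl -
      (lowPass (ℓ j / (2 * L)) : 𝕜) * (b (ℓ j) : 𝕜)⁻¹ * (φ j y : 𝕜) * coeff μ φ f j * hrr
  rw [hrep]
  refine (eLpNorm_sub_le (H.continuous_integral_rkern_mul z2 hg).aestronglyMeasurable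
    (H.continuous_integral_rkern_mul z1 (hf.sub hPi)).aestronglyMeasurable hp1).trans ?_
  rw [add_comm]
  refine add_le_add ((h₁ L hL ν hν _ (hf.sub hPi)).trans ?_) ((h₂ L hL ν hν _ hg).trans ?_)
  · gcongr; linarith
  · gcongr; linarith

end IsHeatSystem

/-- The mesh condition keeps `L` away from `0`, as `M` has finite diameter. -/
lemma le_of_isQuasiUniform {M : Type*} [MetricSpace M] [CompactSpace M] {C : Finset M}
    (hC : IsQuasiUniform C) {κ₁ L : ℝ} (hκ₁ : 0 < κ₁) (hL : κ₁ * (C : Set M).infsep⁻¹ ≤ L) :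
    κ₁ / (Metric.diam (Set.univ : Set M) + 1) ≤ L := by
  have hpos : 0 < (C : Set M).infsep := (C.finite_toSet.infsep_pos_iff_nontrivial).2 hC.1
  refine le_trans ?_ hL
  rw [← div_eq_mul_inv]
  gcongr
  obtain ⟨x, hx, y, hy, hxy⟩ := hC.1
  have h1 : (C : Set M).infsep ≤ dist x y := Set.infsep_le_dist_of_mem hx hy hxy
  have h2 := Metric.dist_le_diam_of_mem isCompact_univ.isBounded (Set.mem_univ x) (Set.mem_univ y)
  linarith

end Eignet

theorem theorem3p1 {𝕜 : Type*} [RCLike 𝕜] {n : ℕ} {M : Type*} [MetricSpace M]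
    [ChartedSpace (EuclideanSpace ℝ (Fin n)) M]
    [IsManifold 𝓘(ℝ, EuclideanSpace ℝ (Fin n)) ∞ M]
    [RiemannianBundle (fun x : M => TangentSpace 𝓘(ℝ, EuclideanSpace ℝ (Fin n)) x)]
    [IsContMDiffRiemannianBundle 𝓘(ℝ, EuclideanSpace ℝ (Fin n)) ∞ (EuclideanSpace ℝ (Fin n))
      (fun x : M => TangentSpace 𝓘(ℝ, EuclideanSpace ℝ (Fin n)) x)]
    [IsRiemannianManifold 𝓘(ℝ, EuclideanSpace ℝ (Fin n)) M]
    [CompactSpace M] [ConnectedSpace M] [MeasurableSpace M] [BorelSpace M]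
    (μ : Measure M) [IsProbabilityMeasure μ]
    (α : ℝ) (hα : 0 < α) (hball : Eignet.BallMeasureBound μ α)
    (φ : ℕ → M → ℝ) (ℓ : ℕ → ℝ) (hsys : Eignet.IsSystem μ φ ℓ)
    (hint : ∀ t ∈ Set.Ioc (0 : ℝ) 1, ∀ x, ∫ y, Eignet.heatKernel φ ℓ t x y ∂μ = 1)
    (hgauss : Eignet.GaussianBound φ ℓ α)
    (hgrad : Eignet.GaussianGradientBound (n := n) φ ℓ α)
    (A : ℝ) (hA : 2 ≤ A) (hprod : Eignet.ProductAssumption 𝕜 μ φ ℓ A)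
    (S : ℕ) (hS : α < S) (β : ℝ) (hβ : 0 < β) (b : ℝ → ℝ) (hb : Eignet.IsMask S β b)
    (G : M → M → ℝ) (hG : Eignet.HasExpansion μ φ ℓ b G)
    (p p' : ℝ≥0∞) (hp : p.HolderConjugate p') (hβp : α * (p'⁻¹).toReal < β)
    (r : ℝ) (hr : 0 ≤ r) (hrβ : r < β)
    (κ₁ κ₂ κ c : ℝ) (hκ₁ : 0 < κ₁) (hκ₂ : 0 < κ₂) (hκ : 0 < κ) (hc : 0 < c) :
    ∃ c₁ : ℝ, 0 < c₁ ∧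
      ∀ (C : Finset M) (L : ℝ) (w : M → ℝ) (f g P : M → 𝕜),
        Eignet.IsQuasiUniform C →
        κ₁ * (C : Set M).infsep⁻¹ ≤ L → L ≤ κ₂ * (C : Set M).infsep⁻¹ →
        Eignet.IsRegularWeights μ α κ (1 / L) C w →
        Eignet.IsQuadrature 𝕜 μ φ ℓ (2 * A * L) C w →
        Eignet.HasDeltaStar μ φ ℓ p r f g →
        P ∈ Eignet.diffPoly 𝕜 φ ℓ L →
        eLpNorm (f - P) p μ ≤ ENNReal.ofReal (c * L ^ (-r)) * eLpNorm g p μ →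
        eLpNorm (f - Eignet.eignet μ φ ℓ b G C w P) p μ ≤
          ENNReal.ofReal (c₁ * L ^ (-r)) * eLpNorm g p μ := by
  have H : Eignet.IsHeatSystem μ φ ℓ α := ⟨hα, hball, hsys, hint, hgauss⟩
  have hp1 : 1 ≤ p := ENNReal.HolderConjugate.one_le p p'
  set Lmin : ℝ := κ₁ / (Metric.diam (Set.univ : Set M) + 1) with hLm
  have hLmin : 0 < Lmin := by
    have := Metric.diam_nonneg (s := (Set.univ : Set M)); positivity
  obtain ⟨D', hD', hreg⟩ := H.exists_weightMeasure_closedBall_le hκ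
  obtain ⟨W, hW, hWb⟩ := H.exists_measure_univ_le hD' hLmin
  obtain ⟨Kd, hKd, hdG⟩ := H.exists_eLpNorm_dG_le (𝕜 := 𝕜) hS hLmin hb hr hrβ hD' hp
  obtain ⟨D, hD, hDb⟩ := H.exists_card_ellLe_le hLmin
  -- The extra power `L^{-α}` absorbs the bound `O(L^α)` for the coefficients of `P`.
  obtain ⟨Kl, hKl, hlow⟩ := H.exists_norm_sub_sum_lowPass_le (𝕜 := 𝕜) hprod hβ.le hb hLmin hW.le
    (s := α + r) (by positivity)
  obtain ⟨-, -, F, hFS, hbF, hFb, -⟩ := hb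
  obtain ⟨Kt, hKt, htail⟩ := H.exists_eLpNorm_tail_le (𝕜 := 𝕜) hS hLmin
    (fun N => Eignet.UnifBdd.of_iteratedDeriv hFS hFb) hβ hbF hG hD' hp hβp
  refine ⟨c + Kl * D * (c * Lmin ^ (-r) + 1) + Kt * Kd * (c + 1), by positivity,
    fun C L w f g P hC hL1 _ hw hq hfg hP hfP => ?_⟩
  have hL : Lmin ≤ L := Eignet.le_of_isQuasiUniform hC hκ₁ hL1
  have hL0 : 0 < L := hLmin.trans_le hL
  have hν := hreg L hL0 C w hw
  have hfL : MemLp f p μ := hfg.mem.1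
  have hgL : MemLp g p μ := hfg.mem_delta.1
  have hPc := H.continuous_of_mem_diffPoly hP
  have hPL : MemLp P p μ := hPc.memLp_of_hasCompactSupport (HasCompactSupport.of_compactSpace _)
  have hTc := H.continuous_dG hP b
  set E := (eLpNorm g p μ).toReal with hE
  have hEo : ENNReal.ofReal E = eLpNorm g p μ := ENNReal.ofReal_toReal hgL.2.ne
  have hLr : 0 < L ^ (-r) := Real.rpow_pos_of_pos hL0 _
  have hfPE : (eLpNorm (f - P) p μ).toReal ≤ c * L ^ (-r) * E := by
    refine ENNReal.toReal_le_of_le_ofReal (by positivity) ?_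
    rwa [ENNReal.ofReal_mul (by positivity), hEo]
  have hcoef : ∀ j, ‖Eignet.coeff μ φ P j‖ ≤ D * L ^ α * ((c * Lmin ^ (-r) + 1) * E) := by
    intro j
    rcases le_or_gt (ℓ j) L with h | h
    · have hB := (hDb L hL).2 j h
      have h1 := H.norm_coeff_le hp1 (hfL.sub hPL) hB
      have h2 := H.norm_coeff_le hp1 hgL hB
      have h3 : ‖Eignet.coeff μ φ f j‖ ≤ ‖Eignet.coeff μ φ g j‖ := by
        have h0 := H.ell_nonneg j
        rw [hfg.coeff_eq, norm_mul, RCLike.norm_ofReal, abs_of_nonneg (by positivity)]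
        exact le_mul_of_one_le_left (norm_nonneg _) (Real.one_le_rpow (by linarith) hr)
      have h4 : Eignet.coeff μ φ P j = Eignet.coeff μ φ f j - Eignet.coeff μ φ (f - P) j := by
        simp_rw [Eignet.coeff, Pi.sub_apply, sub_mul]
        rw [integral_sub (H.integrable_mul_phi (hfL.integrable hp1) j)
          (H.integrable_mul_phi (hPL.integrable hp1) j), sub_sub_cancel]
      have h5 : L ^ (-r) ≤ Lmin ^ (-r) := Real.rpow_le_rpow_of_nonpos hLmin hL (by linarith)
      have h6 : c * L ^ (-r) * E ≤ c * Lmin ^ (-r) * E := by gcongr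
      have hDL : 0 ≤ D * L ^ α := by positivity
      rw [h4]
      refine (norm_sub_le _ _).trans ?_
      calc _ ≤ D * L ^ α * E + D * L ^ α * (c * Lmin ^ (-r) * E) :=
            add_le_add (h3.trans h2) (h1.trans (mul_le_mul_of_nonneg_left (hfPE.trans h6) hDL))
        _ = _ := by ring
    · rw [(H.eq_sum_of_mem_diffPoly hP).1 j h, norm_zero]
      positivity
  have hTb : eLpNorm (Eignet.dG μ φ ℓ b P) p (Eignet.weightMeasure C w) ≤
      ENNReal.ofReal (Kd * (c + 1) * L ^ (β - r)) * eLpNorm g p μ := by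
    refine (hdG L hL _ hν f g P (hfL.integrable hp1) (hgL.integrable hp1) hfg.coeff_eq hP).trans ?_
    refine (add_le_add (mul_le_mul' le_rfl hfP) le_rfl).trans (le_of_eq ?_)
    rw [← mul_assoc, ← add_mul, ← ENNReal.ofReal_mul (by positivity),
      ← ENNReal.ofReal_add (by positivity) (by positivity), sub_eq_add_neg, Real.rpow_add hL0]
    congr 2; ring
  have ht := htail L hL C w hν _ hTc
  -- Split `G(·, y)` at the frequency `2L`.
  set low : M → 𝕜 := fun x => P x - ∑ y ∈ C, (w y : 𝕜) * Eignet.dG μ φ ℓ b P y *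
    (Eignet.rkern φ (fun j => Eignet.lowPass (ℓ j / (2 * L)) * b (ℓ j)) x y : 𝕜) with hlo
  set tail : M → 𝕜 := fun x => ∑ y ∈ C, (w y : 𝕜) * Eignet.dG μ φ ℓ b P y * ((G x y -
    Eignet.rkern φ (fun j => Eignet.lowPass (ℓ j / (2 * L)) * b (ℓ j)) x y : ℝ) : 𝕜) with hta
  have hz := H.lowPass_mul_eq_zero b (by positivity : 0 < 2 * L)
  have hkc : ∀ y, Continuous fun x =>
      Eignet.rkern φ (fun j => Eignet.lowPass (ℓ j / (2 * L)) * b (ℓ j)) x y := fun y =>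
    (H.continuous_rkern hz).comp (by fun_prop : Continuous fun x => (x, y))
  have hlowc : Continuous low := hPc.sub <| continuous_finsetSum _ fun y _ =>
    continuous_const.mul (RCLike.continuous_ofReal.comp (hkc y))
  have htailm : AEStronglyMeasurable tail μ := by
    refine Finset.aestronglyMeasurable_fun_sum _ fun y _ => AEStronglyMeasurable.const_mul ?_ _
    exact RCLike.continuous_ofReal.comp_aestronglyMeasurable
      ((hG y).1.aestronglyMeasurable.sub (hkc y).aestronglyMeasurable)
  have hsplit : f - Eignet.eignet μ φ ℓ b G C w P = (f - P) + low - tail := by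
    ext x
    have : Eignet.eignet μ φ ℓ b G C w P x = P x - low x + tail x := by
      rw [hlo, hta, Eignet.eignet, sub_sub_cancel, ← Finset.sum_add_distrib]
      refine Finset.sum_congr rfl fun y _ => ?_
      push_cast; ring
    rw [Pi.sub_apply, this]
    simp only [Pi.sub_apply, Pi.add_apply]
    ring
  have hlowb : eLpNorm low p μ ≤
      ENNReal.ofReal (Kl * D * (c * Lmin ^ (-r) + 1) * L ^ (-r)) * eLpNorm g p μ := by
    have h1 := hlow L hL C w (hWb L hL _ hν) hq P hP _ hcoef
    refine (eLpNorm_le_of_ae_bound (Eventually.of_forall h1)).trans ?_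
    rw [measure_univ, ENNReal.one_rpow, one_mul, ← hEo, ← ENNReal.ofReal_mul (by positivity)]
    refine ENNReal.ofReal_le_ofReal (le_of_eq ?_)
    have : L ^ (-(α + r)) * L ^ α = L ^ (-r) := by
      rw [← Real.rpow_add hL0]; congr 1; ring
    rw [← this]; ring
  have htb : eLpNorm tail p μ ≤
      ENNReal.ofReal (Kt * Kd * (c + 1) * L ^ (-r)) * eLpNorm g p μ := by
    refine ht.trans ((mul_le_mul' le_rfl hTb).trans (le_of_eq ?_))
    rw [← mul_assoc, ← ENNReal.ofReal_mul (by positivity)]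
    have : L ^ (-r) = L ^ (-β) * L ^ (β - r) := by
      rw [← Real.rpow_add hL0]; congr 1; ring
    rw [this]
    congr 2; ring
  rw [hsplit]
  have hfPm := hfL.1.sub hPL.1
  refine (eLpNorm_sub_le (hfPm.add hlowc.aestronglyMeasurable) htailm hp1).trans ?_
  refine (add_le_add ((eLpNorm_add_le hfPm hlowc.aestronglyMeasurable hp1).trans
    (add_le_add hfP hlowb)) htb).trans (le_of_eq ?_)
  rw [← add_mul, ← add_mul, ← ENNReal.ofReal_add (by positivity) (by positivity),
    ← ENNReal.ofReal_add (by positivity) (by positivity)]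
  congr 2; ring
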